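/- An instance of Edge-Disjoint Triangle Packing parameterized by treewidth consists of a finite simple graph $G$ together with a tree decomposition $\mathcal T=(T,\{X_t\}_{t\in V(T)})$ of $G$; its parameter is the width $\ell=\max_t|X_t|-1$ of $\mathcal T$ (taken to be $0$ if $G$ has no vertices). A solution is a family $S$ of $3$-element subsets of $V(G)$ such that $G[X]$ is a triangle for every $X\in S$ and distinct members of $S$ are edge-disjoint; its value is $|S|$, and $\mathrm{OPT}(G)$ is the maximum value of a solution. For real $c\ge 1$, a $c$-approximate solution is a solution $S$ with $c\cdot|S|\ge \mathrm{OPT}(G)$, and a $c$-approximate oracle is an oracle that, in a single step, answers every instance with a $c$-approximate solution of it. Theorem. There is a constant $C>0$ such that for every real $\varepsilon$ with $0<\varepsilon\le 1$ there is a computable function $f\colon\mathbb N\to\mathbb N$ with $f(\ell)\le C\,\ell^2/\varepsilon$ for all $\ell$, such that Edge-Disjoint Triangle Packing parameterized by treewidth has a $(1+\varepsilon)$-approximate Turing kernel with $f(\ell)=\mathcal O(\ell^2/\varepsilon)$ vertices. That is, there are a deterministic oracle algorithm and a polynomial $p$, both independent of $c$ and of the oracle, such that for every real $c\ge 1$,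 every $c$-approximate oracle and every instance $I=(G,\mathcal T)$ of width $\ell$, the algorithm - halts after at most $p(|I|+\ell)$ steps, where $|I|$ is the size of the encoding of $I$, - outputs a solution $S$ of $I$ with $(1+\varepsilon)\cdot c\cdot|S|\ge \mathrm{OPT}(G)$, and - queries the oracle only on instances whose graph has at most $f(\ell)$ vertices, and whose tree decomposition has at most $f(\ell)$ nodes and width at most $f(\ell)$. -/

import Mathlib

namespace TuringKernel

/-! ### Data, programs with an oracle, and their running time -/

/-- The data on which programs work: finite binary trees. They play the role of strings. -/
inductive Data : Type
  | nil : Data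
  | cons : Data → Data → Data

namespace Data

/-- The size of a piece of data: its number of tree nodes, leaves included. -/
def size : Data → ℕ
  | nil => 1
  | cons a b => 1 + a.size + b.size

/-- First component (`nil` for `nil`). -/
def fst : Data → Data
  | nil => nil
  | cons a _ => a

/-- Second component (`nil` for `nil`). -/
def snd : Data → Data
  | nil => nil
  | cons _ b => b

/-- Natural numbers are written in unary. -/
def ofNat : ℕ → Data
  | 0 => nil
  | k + 1 => cons nil (ofNat k)

/-- Lists are written as right-nested pairs ending in `nil`. -/
def ofList : List Data → Data
  | [] => nil
  | a :: l => cons a (ofList l)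

end Data

/-- Programs: a while-language over `Data` in which one can call an oracle.
A program transforms one piece of data (several variables are held in nested pairs). -/
inductive Prog : Type
  /-- return `nil` -/
  | nil : Prog
  /-- return the input -/
  | id : Prog
  /-- return the first component of the input -/
  | fst : Prog
  /-- return the second component of the input -/
  | snd : Prog
  /-- run both programs on the input and pair the results -/
  | pair : Prog → Prog → Prog
  /-- `comp P R` runs `R` on the input and then `P` on the result -/
  | comp : Prog → Prog → Prog
  /-- `ite B P R` runs `P` on the input if `B` returns something other than `nil` on it,
  and `R` otherwise -/
  | ite : Prog → Prog → Prog → Prog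
  /-- `loop B P`: as long as `B` does not return `nil` on the current data, replace the current
  data by the result of `P` on it -/
  | loop : Prog → Prog → Prog
  /-- send the input to the oracle and return its answer -/
  | ask : Prog

/-- `Run O P x y t qs`: with oracle `O`, the program `P` halts on input `x` with output `y`
after `t` steps, and `qs` is the list of the oracle queries it makes.
An elementary operation that handles `x` costs `x.size` steps (not just one step), so that in
`t` steps a program cannot build data whose size is not polynomial in `t` and in the sizes of
its input and of the oracle answers. A call of the oracle is a single step. -/
inductive Run (O : Data → Data) : Prog → Data → Data → ℕ → List Data → Prop
  | nil (x : Data) : Run O Prog.nil x Data.nil 1 []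
  | id (x : Data) : Run O Prog.id x x x.size []
  | fst (x : Data) : Run O Prog.fst x x.fst x.size []
  | snd (x : Data) : Run O Prog.snd x x.snd x.size []
  | pair {P R : Prog} {x y z : Data} {s t : ℕ} {ps qs : List Data} :
      Run O P x y s ps → Run O R x z t qs →
      Run O (Prog.pair P R) x (Data.cons y z) (s + t + 1) (ps ++ qs)
  | comp {P R : Prog} {x y z : Data} {s t : ℕ} {ps qs : List Data} :
      Run O R x y s ps → Run O P y z t qs →
      Run O (Prog.comp P R) x z (s + t + 1) (ps ++ qs)
  | ite_then {B P R : Prog} {x b y : Data} {s t : ℕ} {ps qs : List Data} :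
      Run O B x b s ps → b ≠ Data.nil → Run O P x y t qs →
      Run O (Prog.ite B P R) x y (s + t + 1) (ps ++ qs)
  | ite_else {B P R : Prog} {x y : Data} {s t : ℕ} {ps qs : List Data} :
      Run O B x Data.nil s ps → Run O R x y t qs →
      Run O (Prog.ite B P R) x y (s + t + 1) (ps ++ qs)
  | loop_stop {B P : Prog} {x : Data} {s : ℕ} {ps : List Data} :
      Run O B x Data.nil s ps →
      Run O (Prog.loop B P) x x (s + x.size) ps
  | loop_step {B P : Prog} {x b y z : Data} {s t u : ℕ} {ps qs rs : List Data} :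
      Run O B x b s ps → b ≠ Data.nil → Run O P x y t qs → Run O (Prog.loop B P) y z u rs →
      Run O (Prog.loop B P) x z (s + t + u + 1) (ps ++ qs ++ rs)
  | ask (x : Data) : Run O Prog.ask x (O x) 1 [x]

/-! ### Parameterized maximization problems and approximate Turing kernels -/

/-- A parameterized maximization problem. -/
structure ParamMaxProblem where
  /-- the instances -/
  Inst : Type
  /-- how an instance (without its parameter) is written down -/
  enc : Inst → Data
  /-- the parameter of an instance -/
  param : Inst → ℕ
  /-- the measure of instances in which the size of a kernel is expressed -/
  measure : Inst → ℕ
  /-- the solutions of an instance -/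
  Sol : Inst → Type
  /-- the value of a solution -/
  value : (I : Inst) → Sol I → ℕ
  /-- `Repr I s S`: the data `s` is a way of writing down the solution `S` of `I` -/
  Repr : (I : Inst) → Data → Sol I → Prop

namespace ParamMaxProblem

/-- An instance is handed to programs and oracles as the pair of its encoding and its parameter. -/
def input (Q : ParamMaxProblem) (I : Q.Inst) : Data :=
  Data.cons (Q.enc I) (Data.ofNat (Q.param I))

/-- The optimal value. -/
noncomputable def opt (Q : ParamMaxProblem) (I : Q.Inst) : ℕ :=
  sSup (Set.range (Q.value I))

/-- `s` is a solution of `I` whose value is at least `1 / c` times the optimal value. -/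
def IsApproxSolution (Q : ParamMaxProblem) (c : ℝ) (I : Q.Inst) (s : Data) : Prop :=
  ∃ S : Q.Sol I, Q.Repr I s S ∧ (Q.opt I : ℝ) ≤ c * (Q.value I S : ℝ)

/-- The oracle `O` answers every instance with a `c`-approximate solution. -/
def IsApproxOracle (Q : ParamMaxProblem) (c : ℝ) (O : Data → Data) : Prop :=
  ∀ I : Q.Inst, Q.IsApproxSolution c I (O (Q.input I))

/-- `Q` has an `α`-approximate Turing kernel of size `f`: there is one program, running in
polynomial time, that with every `c`-approximate oracle, for every `c ≥ 1`, turns every instance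
with parameter `k` into an `α * c`-approximate solution, and that queries the oracle only on
instances whose measure and parameter are at most `f k`. -/
def HasApproxTuringKernel (Q : ParamMaxProblem) (α : ℝ) (f : ℕ → ℕ) : Prop :=
  1 ≤ α ∧ Computable f ∧
  ∃ (P : Prog) (p : Polynomial ℕ),
    ∀ c : ℝ, 1 ≤ c → ∀ O : Data → Data, Q.IsApproxOracle c O →
      ∀ I : Q.Inst, ∃ (s : Data) (t : ℕ) (qs : List Data),
        Run O P (Q.input I) s t qs ∧
        t ≤ p.eval ((Q.enc I).size + Q.param I) ∧
        Q.IsApproxSolution (α * c) I s ∧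
        ∀ q ∈ qs, ∃ J : Q.Inst, q = Q.input J ∧
          Q.measure J ≤ f (Q.param I) ∧ Q.param J ≤ f (Q.param I)

end ParamMaxProblem

/-! ### Graphs with a tree decomposition -/

/-- A finite simple graph given together with a tree decomposition. -/
structure TDGraph where
  /-- the number of vertices of the graph -/
  n : ℕ
  /-- the graph -/
  G : SimpleGraph (Fin n)
  /-- the number of nodes of the decomposition tree -/
  m : ℕ
  /-- the decomposition tree -/
  T : SimpleGraph (Fin m)
  isTree : T.IsTree
  /-- the bags -/
  bag : Fin m → Finset (Fin n)
  vertex_mem : ∀ v : Fin n, ∃ t, v ∈ bag t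
  edge_mem : ∀ u v : Fin n, G.Adj u v → ∃ t, u ∈ bag t ∧ v ∈ bag t
  connected : ∀ v : Fin n, (T.induce {t | v ∈ bag t}).Connected

/-- The width of the decomposition: the size of a largest bag minus one
(and `0` if all bags are empty, that is, if the graph has no vertices). -/
def TDGraph.width (I : TDGraph) : ℕ :=
  (Finset.univ.sup fun t => (I.bag t).card) - 1

open Classical in
/-- A set of vertices is written as the increasing list of its members. -/
noncomputable def encSet {n : ℕ} (s : Set (Fin n)) : Data :=
  Data.ofList (((List.finRange n).filter fun v => decide (v ∈ s)).map fun v : Fin n => Data.ofNat v.val)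

/-- A graph is written as the list of its neighbourhoods. -/
noncomputable def encGraph {n : ℕ} (G : SimpleGraph (Fin n)) : Data :=
  Data.ofList ((List.finRange n).map fun v => encSet (G.neighborSet v))

/-- A graph with a tree decomposition is written as the graph, the tree and the list of bags. -/
noncomputable def TDGraph.enc (I : TDGraph) : Data :=
  Data.cons (encGraph I.G) (Data.cons (encGraph I.T)
    (Data.ofList ((List.finRange I.m).map fun t => encSet (I.bag t : Set (Fin I.n)))))

/-! ### Edge-disjoint triangle packing -/

/-- `S` is a family of vertex sets of pairwise edge-disjoint triangles of `G`; two different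
triangles are edge-disjoint if and only if they have at most one vertex in common. -/
def IsTrianglePacking {V : Type} (G : SimpleGraph V) (S : Finset (Finset V)) : Prop :=
  (∀ X ∈ S, G.IsNClique 3 X) ∧
  (S : Set (Finset V)).Pairwise fun X Y => ((X : Set V) ∩ (Y : Set V)).Subsingleton

/-- A triangle is written as the list of its three vertices, in any order. -/
def encTriple {n : ℕ} (x : Fin n × Fin n × Fin n) : Data :=
  Data.ofList [Data.ofNat x.1.val, Data.ofNat x.2.1.val, Data.ofNat x.2.2.val]

/-- `s` is a list, without repetitions and in any order, of the members of the family `S`. -/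
def ReprFamily {n : ℕ} (s : Data) (S : Finset (Finset (Fin n))) : Prop :=
  ∃ L : List (Fin n × Fin n × Fin n),
    s = Data.ofList (L.map encTriple) ∧
    (L.map fun x => ({x.1, x.2.1, x.2.2} : Finset (Fin n))).Nodup ∧
    (L.map fun x => ({x.1, x.2.1, x.2.2} : Finset (Fin n))).toFinset = S

/-- Edge-Disjoint Triangle Packing parameterized by the width of a given tree decomposition.
The size of a kernel is measured in vertices of the graph; so that the tree decompositions in
the queries are small as well, the number of their nodes is subject to the same bound. -/
noncomputable def ETP : ParamMaxProblem where
  Inst := TDGraph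
  enc I := I.enc
  param I := I.width
  measure I := max I.n I.m
  Sol I := {S : Finset (Finset (Fin I.n)) // IsTrianglePacking I.G S}
  value _ S := S.1.card
  Repr _ s S := ReprFamily s S.1

end TuringKernel

open Polynomial

namespace TuringKernel

/-! ### Running programs within time and query bounds -/

/-! Fix `N ≥ 1 / ε`, let `ℓ` be the width, `w = 4ℓ²` and `K = N * w`. The graph is cut into
edge-disjoint pieces with packing number `O(K)`, at a loss of a factor `1 + 1/N`; each piece is
shrunk to `O(K)` vertices without lowering its packing number; the oracle is asked about each
shrunken piece, and the union of its answers is the solution.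

Cutting (`pieces_spec`). By the Helly property of subtrees (`exists_mem_three`) each triangle lies
in a bag, which becomes its home. Leaves of the tree are removed one at a time, and a leaf hands its
triangles over to its neighbour `p`. As soon as the triangles held by `p` have a greedy packing of
size at least `K`, they are split off as a piece, and all other triangles that share an edge with
them are dropped. A vertex that occurs both in a triangle held by `p` and in one held elsewhere lies
in the bag of `p` (`OwnInv.takeOver`), so a shared edge is a pair in that bag. Hence a packing loses
at most `(ℓ + 1)² ≤ w` triangles per piece, while the piece has a packing of size at least `K = N *
w`. This charges the loss to the pieces: `N * OPT` is at most `N + 1` times the sum of the optima. A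
greedy packing is within a factor 9 of the optimum, so before a handover both clusters have packing
number at most `9 * K`, and the merged one at most `18 * K` (`SplitInv.prune`).

Shrinking (`exists_packing_kernel`). Let `W` be the vertex set of a maximal packing. A triangle not
inside `W` is an edge inside `W` plus an apex outside. In the bipartite graph of such edges and
apices there are a matching and a set `O` of apices such that every edge adjacent to `O` is matched
into `O`, and every apex outside `O` is matched (`auction_spec`). It suffices to keep `W` and the
matched apices: a triangle of a packing whose apex is in `O` is rerouted to the apex matched with
its edge. The matching is found by an auction, which is easier to run and to analyse than augmenting
paths. The kernel has at most `12 * 18 * K = 864 * N * ℓ²` vertices.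

Asking. A query carries the decomposition with a single bag, so its number of nodes and its width
are bounded as well. Pieces have no edge in common, so answers to different queries are
edge-disjoint (`collect_spec`), and the factors `c` and `1 + 1/N` multiply.

Running time. Elementary operations cost the size of their input, so a query-free program outputs no
more than its running time, and polynomial time is closed under composition. `PTF` collects such
functions on encoded types and is set up for `fun_prop`; the only real obligations are size bounds
for the intermediate results of folds and iterations. -/

theorem eval_mono (p : ℕ[X]) {a b : ℕ} (h : a ≤ b) : p.eval a ≤ p.eval b := by
  rw [Polynomial.eval_eq_sum_range, Polynomial.eval_eq_sum_range]
  exact Finset.sum_le_sum fun i _ => Nat.mul_le_mul_left _ (Nat.pow_le_pow_left h i)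

/-- With oracle `O`, the program `P` turns `x` into `y` in at most `T` steps, and all its queries
satisfy `Q`. -/
def RunIn (O : Data → Data) (P : Prog) (x y : Data) (T : ℕ) (Q : Data → Prop) : Prop :=
  ∃ t qs, Run O P x y t qs ∧ t ≤ T ∧ ∀ q ∈ qs, Q q

namespace RunIn

variable {O : Data → Data} {P R B : Prog} {x y z b : Data} {S T U : ℕ} {Q Q' : Data → Prop}

theorem mono (h : RunIn O P x y S Q) (hT : S ≤ T) (hQ : ∀ q, Q q → Q' q) : RunIn O P x y T Q' := by
  obtain ⟨t, qs, h1, h2, h3⟩ := h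
  exact ⟨t, qs, h1, h2.trans hT, fun q hq => hQ q (h3 q hq)⟩

theorem le (h : RunIn O P x y S Q) (hT : S ≤ T) : RunIn O P x y T Q := h.mono hT fun _ => id

theorem nil : RunIn O Prog.nil x Data.nil 1 Q := ⟨1, [], .nil x, le_rfl, by simp⟩

theorem id : RunIn O Prog.id x x x.size Q := ⟨_, [], .id x, le_rfl, by simp⟩

theorem fst : RunIn O Prog.fst x x.fst x.size Q := ⟨_, [], .fst x, le_rfl, by simp⟩

theorem snd : RunIn O Prog.snd x x.snd x.size Q := ⟨_, [], .snd x, le_rfl, by simp⟩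

theorem ask (h : Q x) : RunIn O Prog.ask x (O x) 1 Q := ⟨_, [x], .ask x, le_rfl, by simpa⟩

theorem pair (h : RunIn O P x y S Q) (h' : RunIn O R x z T Q) :
    RunIn O (Prog.pair P R) x (Data.cons y z) (S + T + 1) Q := by
  obtain ⟨t, qs, h1, h2, h3⟩ := h
  obtain ⟨t', qs', h1', h2', h3'⟩ := h'
  refine ⟨_, _, .pair h1 h1', by omega, fun q hq => ?_⟩
  exact (List.mem_append.1 hq).elim (h3 q) (h3' q)

theorem comp (h : RunIn O R x y S Q) (h' : RunIn O P y z T Q) :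
    RunIn O (Prog.comp P R) x z (S + T + 1) Q := by
  obtain ⟨t, qs, h1, h2, h3⟩ := h
  obtain ⟨t', qs', h1', h2', h3'⟩ := h'
  refine ⟨_, _, .comp h1 h1', by omega, fun q hq => ?_⟩
  exact (List.mem_append.1 hq).elim (h3 q) (h3' q)

theorem ite_then (h : RunIn O B x b S Q) (hb : b ≠ Data.nil) (h' : RunIn O P x y T Q) :
    RunIn O (Prog.ite B P R) x y (S + T + 1) Q := by
  obtain ⟨t, qs, h1, h2, h3⟩ := h
  obtain ⟨t', qs', h1', h2', h3'⟩ := h'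
  refine ⟨_, _, .ite_then h1 hb h1', by omega, fun q hq => ?_⟩
  exact (List.mem_append.1 hq).elim (h3 q) (h3' q)

theorem ite_else (h : RunIn O B x Data.nil S Q) (h' : RunIn O R x y T Q) :
    RunIn O (Prog.ite B P R) x y (S + T + 1) Q := by
  obtain ⟨t, qs, h1, h2, h3⟩ := h
  obtain ⟨t', qs', h1', h2', h3'⟩ := h'
  refine ⟨_, _, .ite_else h1 h1', by omega, fun q hq => ?_⟩
  exact (List.mem_append.1 hq).elim (h3 q) (h3' q)

/-- Prescribing the whole sequence of states lets the induction peel off the first round by shifting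
the sequence. `T` bounds the test, the body and the final copy alike. -/
theorem loop (st : ℕ → Data) (n : ℕ)
    (hstep : ∀ i < n, ∃ b, b ≠ Data.nil ∧ RunIn O B (st i) b T Q ∧
      RunIn O P (st i) (st (i + 1)) T Q)
    (hend : RunIn O B (st n) Data.nil T Q) (hsize : (st n).size ≤ T) :
    RunIn O (Prog.loop B P) (st 0) (st n) (n * (2 * T + 1) + 2 * T) Q := by
  induction n generalizing st with
  | zero =>
    obtain ⟨t, qs, h1, h2, h3⟩ := hend
    exact ⟨_, _, Run.loop_stop h1, by omega, h3⟩
  | succ n ih =>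
    obtain ⟨b, hb, ⟨t, qs, h1, h2, h3⟩, ⟨t', qs', h1', h2', h3'⟩⟩ := hstep 0 (by omega)
    obtain ⟨u, rs, g1, g2, g3⟩ := ih (fun i => st (i + 1)) (fun i hi => hstep (i + 1) (by omega))
      hend hsize
    refine ⟨_, _, .loop_step h1 hb h1' g1, ?_, ?_⟩
    · rw [Nat.succ_mul]; omega
    · simp only [List.mem_append]
      rintro q ((h | h) | h)
      exacts [h3 q h, h3' q h, g3 q h]

end RunIn

/-- Without queries, the output is at most as large as the running time. -/
theorem Run.size_le {O : Data → Data} {P : Prog} {x y : Data} {t : ℕ} {qs : List Data}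
    (h : Run O P x y t qs) (hq : qs = []) : y.size ≤ t := by
  induction h with
  | nil x => simp [Data.size]
  | id x => exact le_rfl
  | fst x => cases x <;> simp [Data.fst, Data.size]; omega
  | snd x => cases x <;> simp [Data.snd, Data.size]
  | pair _ _ ih ih' =>
    simp only [List.append_eq_nil_iff] at hq
    have := ih hq.1; have := ih' hq.2
    simp only [Data.size]; omega
  | comp _ _ ih ih' =>
    simp only [List.append_eq_nil_iff] at hq
    have := ih' hq.2; omega
  | ite_then _ _ _ ih ih' =>
    simp only [List.append_eq_nil_iff] at hq
    have := ih' hq.2; omega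
  | ite_else _ _ ih ih' =>
    simp only [List.append_eq_nil_iff] at hq
    have := ih' hq.2; omega
  | loop_stop _ ih => omega
  | loop_step _ _ _ _ ih ih' ih'' =>
    simp only [List.append_eq_nil_iff] at hq
    have := ih'' hq.2; omega
  | ask x => simp at hq

/-- The query predicate `False` expresses that no query is made. This is essential: an oracle answer
costs one step whatever its size. -/
theorem RunIn.size_le {O : Data → Data} {P : Prog} {x y : Data} {T : ℕ}
    (h : RunIn O P x y T fun _ => False) : y.size ≤ T := by
  obtain ⟨t, qs, h1, h2, h3⟩ := h
  exact (h1.size_le (List.eq_nil_iff_forall_not_mem.2 h3)).trans h2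

/-! ### Encoded types and polynomial-time functions -/

/-- Types whose elements are written as data. -/
class Enc (α : Type) where
  /-- the encoding -/
  enc : α → Data

open Enc (enc)

instance : Enc Data := ⟨fun x => x⟩
instance : Enc ℕ := ⟨Data.ofNat⟩
instance : Enc Unit := ⟨fun _ => Data.nil⟩
instance : Enc Bool := ⟨fun b => if b then Data.cons Data.nil Data.nil else Data.nil⟩
instance {α β : Type} [Enc α] [Enc β] : Enc (α × β) := ⟨fun x => Data.cons (enc x.1) (enc x.2)⟩
instance {α : Type} [Enc α] : Enc (List α) := ⟨fun l => Data.ofList (l.map enc)⟩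

/-! ### Sizes of encodings -/

section enc

variable {α β : Type} [Enc α] [Enc β]

/-- The size of the encoding. -/
def esize (a : α) : ℕ := (enc a).size

theorem enc_pair (x : α × β) : enc x = Data.cons (enc x.1) (enc x.2) := rfl
theorem enc_nil : enc ([] : List α) = Data.nil := rfl
theorem enc_cons (a : α) (l : List α) : enc (a :: l) = Data.cons (enc a) (enc l) := rfl
theorem enc_true : enc true = Data.cons Data.nil Data.nil := rfl
theorem enc_false : enc false = Data.nil := rfl

@[simp] theorem esize_pair (x : α × β) : esize x = 1 + esize x.1 + esize x.2 := rfl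
@[simp] theorem esize_nil : esize ([] : List α) = 1 := rfl
@[simp] theorem esize_cons (a : α) (l : List α) : esize (a :: l) = 1 + esize a + esize l := rfl

theorem esize_nat (n : ℕ) : esize n = 2 * n + 1 := by
  induction n with
  | zero => rfl
  | succ n ih =>
    have : esize (n + 1) = 1 + 1 + esize n := rfl
    omega

theorem esize_append (l l' : List α) : esize (l ++ l') + 1 = esize l + esize l' := by
  induction l with
  | nil => simp [add_comm]
  | cons a l ih => simp only [List.cons_append, esize_cons]; omega

theorem length_le_esize (l : List α) : l.length + 1 ≤ esize l := by
  induction l with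
  | nil => simp
  | cons a l ih => simp only [List.length_cons, esize_cons]; omega

theorem esize_le_of_mem {a : α} {l : List α} (h : a ∈ l) : esize a + 1 ≤ esize l := by
  induction l with
  | nil => simp at h
  | cons b l ih =>
    simp only [esize_cons]
    rcases List.mem_cons.1 h with rfl | h
    · omega
    · have := ih h; omega

theorem esize_le_of_sublist {l l' : List α} (h : l.Sublist l') : esize l ≤ esize l' := by
  induction h with
  | slnil => simp
  | cons a _ ih => simp only [esize_cons]; omega
  | cons_cons a _ ih => simp only [esize_cons]; omega

theorem esize_reverse (l : List α) : esize l.reverse = esize l := by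
  induction l with
  | nil => rfl
  | cons a l ih =>
    have := esize_append l.reverse [a]
    simp only [List.reverse_cons, esize_cons, esize_nil] at *; omega

theorem esize_list_le {l : List α} {B : ℕ} (h : ∀ a ∈ l, esize a ≤ B) :
    esize l ≤ l.length * (B + 1) + 1 := by
  induction l with
  | nil => simp
  | cons a l ih =>
    have := ih fun b hb => h b (List.mem_cons_of_mem _ hb)
    have := h a List.mem_cons_self
    simp only [esize_cons, List.length_cons, Nat.succ_mul]; omega

end enc

/-- The function `f` is computed by a program that makes no queries, in polynomial time. -/
@[fun_prop]
def PTF {α β : Type} [Enc α] [Enc β] (f : α → β) : Prop :=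
  ∃ (P : Prog) (p : ℕ[X]), ∀ O a,
    RunIn O P (enc a) (enc (f a)) (p.eval (esize a)) fun _ => False

namespace PTF

variable {α β γ δ σ : Type} [Enc α] [Enc β] [Enc γ] [Enc δ] [Enc σ]

theorem esize_le {f : α → β} (hf : PTF f) : ∃ p : ℕ[X], ∀ a, esize (f a) ≤ p.eval (esize a) := by
  obtain ⟨P, p, h⟩ := hf
  exact ⟨p, fun a => (h (fun x => x) a).size_le⟩

@[fun_prop]
theorem id : PTF (fun a : α => a) := ⟨.id, X, fun O a => by rw [eval_X]; exact RunIn.id⟩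

theorem exists_const (d : Data) : ∃ (P : Prog) (T : ℕ), ∀ O x, RunIn O P x d T fun _ => False := by
  induction d with
  | nil => exact ⟨.nil, 1, fun _ _ => RunIn.nil⟩
  | cons a b iha ihb =>
    obtain ⟨P, S, h⟩ := iha
    obtain ⟨R, T, h'⟩ := ihb
    exact ⟨.pair P R, _, fun O x => (h O x).pair (h' O x)⟩

@[fun_prop]
theorem const (b : β) : PTF (fun _ : α => b) := by
  obtain ⟨P, T, h⟩ := exists_const (enc b)
  exact ⟨P, C T, fun O a => by simpa using h O (enc a)⟩

-- The second program is charged for the size of the intermediate result, which is at most the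
-- running time of the first.
@[fun_prop]
theorem comp {g : β → γ} {f : α → β} (hg : PTF g) (hf : PTF f) : PTF (fun a => g (f a)) := by
  obtain ⟨R, r, hr⟩ := hf
  obtain ⟨P, p, hp⟩ := hg
  refine ⟨.comp P R, r + p.comp r + 1, fun O a => ((hr O a).comp (hp O (f a))).le ?_⟩
  have : esize (f a) ≤ r.eval (esize a) := (hr O a).size_le
  simpa using eval_mono p this

@[fun_prop]
theorem prodMk {f : α → β} {g : α → γ} (hf : PTF f) (hg : PTF g) : PTF (fun a => (f a, g a)) := by
  obtain ⟨P, p, hp⟩ := hf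
  obtain ⟨R, r, hr⟩ := hg
  exact ⟨.pair P R, p + r + 1, fun O a => ((hp O a).pair (hr O a)).le (by simp)⟩

/-- Functions whose output is computed from the encoding by a single program. -/
theorem of_eq_enc {f : α → β} {g : α → γ} (hf : PTF f) (h : ∀ a, enc (g a) = enc (f a)) : PTF g := by
  obtain ⟨P, p, hp⟩ := hf
  exact ⟨P, p, fun O a => by rw [h]; exact hp O a⟩

theorem fst' : PTF (fun a : α × β => a.1) := ⟨.fst, X, fun O a => by
  rw [eval_X]; exact RunIn.fst⟩

theorem snd' : PTF (fun a : α × β => a.2) := ⟨.snd, X, fun O a => by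
  rw [eval_X]; exact RunIn.snd⟩

@[fun_prop]
theorem fst {f : α → β × γ} (hf : PTF f) : PTF (fun a => (f a).1) := fst'.comp hf

@[fun_prop]
theorem snd {f : α → β × γ} (hf : PTF f) : PTF (fun a => (f a).2) := snd'.comp hf

/-- Case distinction on whether a piece of data is `nil`. -/
theorem ite_enc {b : α → β} {f g h : α → γ} (hb : PTF b) (hf : PTF f) (hg : PTF g)
    (h₁ : ∀ a, enc (b a) ≠ Data.nil → h a = f a) (h₂ : ∀ a, enc (b a) = Data.nil → h a = g a) :
    PTF h := by
  obtain ⟨B, q, hb⟩ := hb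
  obtain ⟨P, p, hp⟩ := hf
  obtain ⟨R, r, hr⟩ := hg
  refine ⟨.ite B P R, q + p + r + 1, fun O a => ?_⟩
  by_cases h : enc (b a) = Data.nil
  · rw [h₂ a h]
    have := hb O a
    rw [h] at this
    exact (this.ite_else (hr O a)).le (by simp)
  · rw [h₁ a h]
    exact ((hb O a).ite_then h (hp O a)).le (by simp)

@[fun_prop]
theorem cond {b : α → Bool} {f g : α → γ} (hb : PTF b) (hf : PTF f) (hg : PTF g) :
    PTF (fun a => bif b a then f a else g a) :=
  ite_enc hb hf hg (fun a h => by cases hb : b a <;> simp_all [enc_false])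
    (fun a h => by cases hb : b a <;> simp_all [enc_true])

/-- Left folds along a list whose intermediate results have polynomial size. -/
theorem foldl {l : γ → List α} {init : γ → σ} {step : γ → σ → α → σ} (hl : PTF l)
    (hi : PTF init) (hs : PTF fun x : (γ × σ) × α => step x.1.1 x.1.2 x.2) (q : ℕ[X])
    (hq : ∀ c i, esize (((l c).take i).foldl (step c) (init c)) ≤ q.eval (esize c)) :
    PTF fun c => (l c).foldl (step c) (init c) := by
  obtain ⟨L, pl, hL⟩ := hl
  obtain ⟨I, pi, hI⟩ := hi
  obtain ⟨S, ps, hS⟩ := hs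
  -- The loop works on the triple of remaining list, accumulator and context. Its test is `fst`,
  -- which is `nil` exactly when the list is used up.
  let head := Prog.comp .fst .fst
  let acc := Prog.comp .fst .snd
  let ctx := Prog.comp .snd .snd
  let body := Prog.pair (.comp .snd .fst) (.pair (.comp S (.pair (.pair ctx acc) head)) ctx)
  let sz : ℕ[X] := pl + q + X + 2
  -- `sz` bounds every loop state, and `2 * sz` the argument of `S`, in which the parts of a state
  -- are paired anew. The constants in `tm` absorb the projections and pairings of one round.
  let tm : ℕ[X] := 12 * sz + 20 + ps.comp (2 * sz)
  refine ⟨.comp acc (.comp (.loop .fst body) (.pair L (.pair I .id))),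
    pl + pi + X + 8 + pl * (2 * tm + 1) + 2 * tm + 2 * sz, fun O c => ?_⟩
  let st : ℕ → Data := fun i => Data.cons (enc ((l c).drop i))
    (Data.cons (enc (((l c).take i).foldl (step c) (init c))) (enc c))
  have hl1 : esize (l c) ≤ pl.eval (esize c) := (hL O c).size_le
  have hsz : ∀ i, (st i).size ≤ sz.eval (esize c) := by
    intro i
    have h1 : esize ((l c).drop i) ≤ esize (l c) := esize_le_of_sublist (List.drop_sublist _ _)
    have h2 := hq c i
    simp only [st, Data.size, sz, Polynomial.eval_add, Polynomial.eval_X, Polynomial.eval_ofNat]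
    simp only [esize] at *
    omega
  have htm : tm.eval (esize c) = 12 * sz.eval (esize c) + 20 + ps.eval (2 * sz.eval (esize c)) := by
    simp [tm]
  have hloop : RunIn O (.loop .fst body) (st 0) (st (l c).length)
      ((l c).length * (2 * tm.eval (esize c) + 1) + 2 * tm.eval (esize c)) fun _ => False := by
    apply RunIn.loop
    · intro i hi
      have hd : (l c).drop i = (l c)[i] :: (l c).drop (i + 1) := List.drop_eq_getElem_cons hi
      have hst : st i = Data.cons (Data.cons (enc (l c)[i]) (enc ((l c).drop (i + 1))))
        (Data.cons (enc (((l c).take i).foldl (step c) (init c))) (enc c)) := by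
        simp only [st, hd, enc_cons]
      have hs1 := hsz i
      refine ⟨(st i).fst, by rw [hst]; simp [Data.fst], RunIn.fst.le (by omega), ?_⟩
      have hst' : st (i + 1) = Data.cons (enc ((l c).drop (i + 1)))
          (Data.cons (enc (step c (((l c).take i).foldl (step c) (init c)) (l c)[i])) (enc c)) := by
        simp only [st]
        rw [List.take_succ_eq_append_getElem hi, List.foldl_append]
        rfl
      rw [hst']
      have hS' := hS O ((c, ((l c).take i).foldl (step c) (init c)), (l c)[i])
      have hes : esize ((c, ((l c).take i).foldl (step c) (init c)), (l c)[i]) ≤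
          2 * sz.eval (esize c) := by
        rw [hst] at hs1
        simp only [Data.size] at hs1
        simp only [esize_pair]
        simp only [esize] at hs1 ⊢
        omega
      have hps := eval_mono ps hes
      have hx : (st i).size ≤ sz.eval (esize c) := hs1
      rw [hst] at hx ⊢
      have hctx : RunIn O ctx (Data.cons (Data.cons (enc (l c)[i]) (enc ((l c).drop (i + 1))))
        (Data.cons (enc (((l c).take i).foldl (step c) (init c))) (enc c))) (enc c)
          (2 * sz.eval (esize c) + 1) (fun _ => False) :=
        ((RunIn.snd.le hx).comp RunIn.snd).le (by simp only [Data.size, Data.snd] at *; omega)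
      have hacc : RunIn O acc (Data.cons (Data.cons (enc (l c)[i]) (enc ((l c).drop (i + 1))))
        (Data.cons (enc (((l c).take i).foldl (step c) (init c))) (enc c)))
          (enc (((l c).take i).foldl (step c) (init c)))
          (2 * sz.eval (esize c) + 1) (fun _ => False) :=
        ((RunIn.snd.le hx).comp RunIn.fst).le (by simp only [Data.size, Data.snd] at *; omega)
      have hhead : RunIn O head (Data.cons (Data.cons (enc (l c)[i]) (enc ((l c).drop (i + 1))))
        (Data.cons (enc (((l c).take i).foldl (step c) (init c))) (enc c)))
          (enc (l c)[i])
          (2 * sz.eval (esize c) + 1) (fun _ => False) :=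
        ((RunIn.fst.le hx).comp RunIn.fst).le (by simp only [Data.size, Data.fst] at *; omega)
      have htail : RunIn O (.comp .snd .fst) (Data.cons (Data.cons (enc (l c)[i]) (enc ((l c).drop (i + 1))))
        (Data.cons (enc (((l c).take i).foldl (step c) (init c))) (enc c)))
          (enc ((l c).drop (i + 1)))
          (2 * sz.eval (esize c) + 1) (fun _ => False) :=
        ((RunIn.fst.le hx).comp RunIn.snd).le (by simp only [Data.size, Data.fst] at *; omega)
      exact (htail.pair ((((hctx.pair hacc).pair hhead).comp (hS'.le hps)).pair hctx)).le
        (by rw [htm]; omega)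
    · have : Data.nil = (st (l c).length).fst := by simp [st, Data.fst, enc_nil]
      rw [this]
      refine RunIn.fst.le ((hsz _).trans (by omega))
    · exact (hsz _).trans (by omega)
  have hlen : (l c).length ≤ pl.eval (esize c) := by
    have := length_le_esize (l c); omega
  have hmul := Nat.mul_le_mul_right (2 * tm.eval (esize c) + 1) hlen
  have hinit : RunIn O (.pair L (.pair I .id)) (enc c) (st 0)
      (pl.eval (esize c) + (pi.eval (esize c) + esize c + 1) + 1) fun _ => False :=
    (hL O c).pair ((hI O c).pair RunIn.id)
  have hs2 := hsz (l c).length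
  have hfin : RunIn O acc (st (l c).length) (enc ((l c).foldl (step c) (init c)))
      (2 * sz.eval (esize c) + 1) fun _ => False := by
    have h1 : (st (l c).length).snd.fst = enc ((l c).foldl (step c) (init c)) := by
      simp [st, Data.fst, Data.snd]
    rw [← h1]
    refine ((RunIn.snd.le hs2).comp RunIn.fst).le ?_
    simp only [st, Data.size, Data.snd] at hs2 ⊢
    omega
  refine ((hinit.comp hloop).comp hfin).le ?_
  simp only [Polynomial.eval_add, Polynomial.eval_mul, Polynomial.eval_X, Polynomial.eval_ofNat,
    Polynomial.eval_one]
  omega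

end PTF

end TuringKernel

open Polynomial

namespace TuringKernel
open Enc (enc)

namespace PTF

variable {α β γ δ σ : Type} [Enc α] [Enc β] [Enc γ] [Enc δ] [Enc σ]

/-! ### Booleans and lists -/

@[fun_prop]
theorem not {f : α → Bool} (hf : PTF f) : PTF fun a => !(f a) :=
  (cond hf (const false) (const true)).of_eq_enc fun a => by cases f a <;> rfl

@[fun_prop]
theorem and {f g : α → Bool} (hf : PTF f) (hg : PTF g) : PTF fun a => f a && g a :=
  (cond hf hg (const false)).of_eq_enc fun a => by cases f a <;> rfl

@[fun_prop]
theorem or {f g : α → Bool} (hf : PTF f) (hg : PTF g) : PTF fun a => f a || g a :=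
  (cond hf (const true) hg).of_eq_enc fun a => by cases f a <;> rfl

@[fun_prop]
theorem cons {f : γ → α} {l : γ → List α} (hf : PTF f) (hl : PTF l) : PTF fun c => f c :: l c :=
  (prodMk hf hl).of_eq_enc fun _ => rfl

@[fun_prop]
theorem tail {l : γ → List α} (hl : PTF l) : PTF fun c => (l c).tail := by
  have h : PTF fun l : List α => l.tail := ⟨.snd, X, fun O l => by
    have : enc l.tail = (enc l).snd := by cases l <;> rfl
    rw [eval_X, this]; exact RunIn.snd⟩
  exact h.comp hl

@[fun_prop]
theorem isEmpty {l : γ → List α} (hl : PTF l) : PTF fun c => (l c).isEmpty :=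
  ite_enc hl (const false) (const true) (fun c h => by cases hc : l c <;> simp_all [enc_nil])
    (fun c h => by cases hc : l c <;> simp_all [enc_cons])

@[fun_prop]
theorem headD {l : γ → List α} {d : γ → α} (hl : PTF l) (hd : PTF d) :
    PTF fun c => (l c).headD (d c) := by
  -- The head is taken on the level of `Data`, since the `fst` of an empty list, `nil`, need not
  -- encode an element of `α`.
  have h : PTF fun l : List α => (enc l).fst := ⟨.fst, X, fun O l => by
    rw [eval_X]; exact RunIn.fst⟩
  have hd' : PTF fun c => enc (d c) := hd.of_eq_enc fun _ => rfl
  have : PTF fun c => enc ((l c).headD (d c)) := ite_enc hl (h.comp hl) hd'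
    (fun c h => by cases hc : l c <;> simp_all [enc_nil, enc_cons, Data.fst])
    (fun c h => by cases hc : l c <;> simp_all [enc_nil, enc_cons])
  exact this.of_eq_enc fun _ => rfl

@[fun_prop]
theorem reverseAppend {l l' : γ → List α} (hl : PTF l) (hl' : PTF l') :
    PTF fun c => (l c).reverse ++ l' c := by
  obtain ⟨p, hp⟩ := hl.esize_le
  obtain ⟨p', hp'⟩ := hl'.esize_le
  have : PTF fun c => (l c).foldl (fun acc a => a :: acc) (l' c) := by
    refine foldl hl hl' (by fun_prop) (p + p') fun c i => ?_
    have h1 := esize_append ((l c).take i).reverse (l' c)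
    have h2 := esize_le_of_sublist (List.take_sublist i (l c))
    have h3 := hp c
    have h4 := hp' c
    rw [esize_reverse] at h1
    rw [List.foldl_flip_cons_eq_append']
    simp only [eval_add]
    omega
  simpa only [List.foldl_flip_cons_eq_append'] using this

@[fun_prop]
theorem reverse {l : γ → List α} (hl : PTF l) : PTF fun c => (l c).reverse := by
  simpa using reverseAppend hl (const ([] : List α))

@[fun_prop]
theorem append {l l' : γ → List α} (hl : PTF l) (hl' : PTF l') : PTF fun c => l c ++ l' c := by
  simpa using reverseAppend (reverse hl) hl'

@[fun_prop]
theorem flatMap {l : γ → List α} {f : γ → α → List β} (hl : PTF l)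
    (hf : PTF fun x : γ × α => f x.1 x.2) : PTF fun c => (l c).flatMap (f c) := by
  obtain ⟨p, hp⟩ := hl.esize_le
  obtain ⟨q, hq⟩ := hf.esize_le
  have key : ∀ c (l : List α), l.foldl (fun acc a => acc ++ f c a) [] = l.flatMap (f c) := by
    intro c l
    rw [List.flatMap_eq_foldl]
  have : PTF fun c => (l c).foldl (fun acc a => acc ++ f c a) [] := by
    refine foldl hl (const []) (by fun_prop) (p * q.comp (1 + X + p) + 1) fun c i => ?_
    rw [key]
    have bound : ∀ l' : List α, l' ⊆ l c →
        esize (l'.flatMap (f c)) ≤ l'.length * q.eval (1 + esize c + p.eval (esize c)) + 1 := by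
      intro l' hl'
      induction l' with
      | nil => simp
      | cons a l' ih =>
        have h1 := ih fun b hb => hl' (List.mem_cons_of_mem _ hb)
        have h2 := esize_append (f c a) (l'.flatMap (f c))
        have h3 := hq (c, a)
        have h4 : esize (c, a) ≤ 1 + esize c + p.eval (esize c) := by
          have := esize_le_of_mem (hl' List.mem_cons_self)
          have := hp c
          simp only [esize_pair]; omega
        have h5 := eval_mono q h4
        simp only [List.flatMap_cons, List.length_cons, Nat.succ_mul]
        simp only at h3
        omega
    have h1 := bound _ (List.take_subset i (l c))
    have h2 : ((l c).take i).length ≤ p.eval (esize c) := by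
      have := length_le_esize (l c)
      have := hp c
      simp only [List.length_take]; omega
    simp only [eval_add, eval_mul, eval_comp, eval_X, eval_one]
    exact h1.trans (Nat.add_le_add_right (Nat.mul_le_mul_right _ h2) _)
  simpa only [key] using this

@[fun_prop]
theorem map {l : γ → List α} {f : γ → α → β} (hl : PTF l)
    (hf : PTF fun x : γ × α => f x.1 x.2) : PTF fun c => (l c).map (f c) := by
  have : PTF fun c => (l c).flatMap fun a => [f c a] := by fun_prop
  simpa only [List.map_eq_flatMap] using this

@[fun_prop]
theorem flatten {l : γ → List (List α)} (hl : PTF l) : PTF fun c => (l c).flatten := by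
  have : PTF fun c => (l c).flatMap fun a => a := by fun_prop
  simpa using this

@[fun_prop]
theorem filter {l : γ → List α} {p : γ → α → Bool} (hl : PTF l)
    (hp : PTF fun x : γ × α => p x.1 x.2) : PTF fun c => (l c).filter (p c) := by
  have : PTF fun c => (l c).flatMap fun a => bif p c a then [a] else [] := by fun_prop
  convert this using 2 with c
  induction l c with
  | nil => rfl
  | cons a l ih => rw [List.filter_cons, List.flatMap_cons, ih]; cases p c a <;> simp

@[fun_prop]
theorem any {l : γ → List α} {p : γ → α → Bool} (hl : PTF l)
    (hp : PTF fun x : γ × α => p x.1 x.2) : PTF fun c => (l c).any (p c) := by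
  have : PTF fun c => !((l c).filter (p c)).isEmpty := by fun_prop
  convert this using 2 with c
  induction l c with
  | nil => rfl
  | cons a l ih => rw [List.filter_cons, List.any_cons, ih]; cases p c a <;> simp

@[fun_prop]
theorem all {l : γ → List α} {p : γ → α → Bool} (hl : PTF l)
    (hp : PTF fun x : γ × α => p x.1 x.2) : PTF fun c => (l c).all (p c) := by
  have : PTF fun c => !(l c).any fun a => !p c a := by fun_prop
  convert this using 2 with c
  rw [List.all_eq_not_any_not]

/-! ### Natural numbers -/

/-- Unary numbers and lists of units have the same encoding, so arithmetic reduces to operations on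
lists. -/
theorem enc_nat (n : ℕ) : enc n = enc (List.replicate n ()) := by
  induction n with
  | zero => rfl
  | succ n ih => rw [List.replicate_succ, enc_cons, ← ih]; rfl

@[fun_prop]
theorem replicateUnit {f : γ → ℕ} (hf : PTF f) : PTF fun c => List.replicate (f c) () :=
  hf.of_eq_enc fun _ => (enc_nat _).symm

theorem of_replicate {f : γ → ℕ} (hf : PTF fun c => List.replicate (f c) ()) : PTF f :=
  hf.of_eq_enc fun _ => enc_nat _

@[fun_prop]
theorem length {l : γ → List α} (hl : PTF l) : PTF fun c => (l c).length := by
  have : PTF fun c => (l c).map fun _ => () := by fun_prop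
  exact of_replicate (by simpa [List.map_const'] using this)

@[fun_prop]
theorem add {f g : γ → ℕ} (hf : PTF f) (hg : PTF g) : PTF fun c => f c + g c := by
  have : PTF fun c => List.replicate (f c) () ++ List.replicate (g c) () := by fun_prop
  exact of_replicate (by simpa using this)

@[fun_prop]
theorem mul {f g : γ → ℕ} (hf : PTF f) (hg : PTF g) : PTF fun c => f c * g c := by
  have : PTF fun c => (List.replicate (f c) ()).flatMap fun _ => List.replicate (g c) () := by
    fun_prop
  refine of_replicate (this.of_eq_enc fun c => congrArg enc ?_)
  rw [eq_comm, List.eq_replicate_iff]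
  simp

/-- Iterating a function, if the intermediate results have polynomial size. -/
theorem iterate {n : γ → ℕ} {init : γ → σ} {step : γ → σ → σ} (hn : PTF n)
    (hi : PTF init) (hs : PTF fun x : γ × σ => step x.1 x.2) (q : ℕ[X])
    (hq : ∀ c, ∀ i ≤ n c, esize ((step c)^[i] (init c)) ≤ q.eval (esize c)) :
    PTF fun c => (step c)^[n c] (init c) := by
  have key : ∀ c (l : List Unit), l.foldl (fun s _ => step c s) (init c) =
      (step c)^[l.length] (init c) := by
    intro c l
    induction l using List.reverseRecOn with
    | nil => rfl
    | append_singleton l a ih =>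
      rw [List.foldl_append, ih, List.length_append, List.length_singleton,
        Function.iterate_succ_apply']
      rfl
  have : PTF fun c => (List.replicate (n c) ()).foldl (fun s _ => step c s) (init c) := by
    refine foldl (step := fun c s _ => step c s) (by fun_prop) hi ?_ q fun c i => ?_
    · exact hs.comp (g := fun x => step x.1 x.2) (f := fun x : (γ × σ) × Unit => x.1) (by fun_prop)
    · rw [key]; exact hq c _ (by simp)
  simpa only [key, List.length_replicate] using this

@[fun_prop]
theorem drop {n : γ → ℕ} {l : γ → List α} (hn : PTF n) (hl : PTF l) :
    PTF fun c => (l c).drop (n c) := by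
  obtain ⟨p, hp⟩ := hl.esize_le
  have key : ∀ i (l : List α), List.tail^[i] l = l.drop i := by
    intro i
    induction i with
    | zero => intro l; rfl
    | succ i ih => intro l; rw [Function.iterate_succ_apply, ih]; cases l <;> simp
  have := iterate (step := fun _ l => List.tail l) hn hl (by fun_prop) p fun c i _ => by
    rw [key]; exact (esize_le_of_sublist (List.drop_sublist _ _)).trans (hp c)
  simpa only [key] using this

@[fun_prop]
theorem getD {n : γ → ℕ} {l : γ → List α} {d : γ → α} (hn : PTF n) (hl : PTF l) (hd : PTF d) :
    PTF fun c => (l c).getD (n c) (d c) := by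
  have : PTF fun c => ((l c).drop (n c)).headD (d c) := by fun_prop
  convert this using 2 with c
  simp [List.getD_eq_getElem?_getD, List.headD_eq_head?_getD]

@[fun_prop]
theorem sub {f g : γ → ℕ} (hf : PTF f) (hg : PTF g) : PTF fun c => f c - g c := by
  have : PTF fun c => (List.replicate (f c) ()).drop (g c) := by fun_prop
  exact of_replicate (by simpa using this)

@[fun_prop]
theorem ble {f g : γ → ℕ} (hf : PTF f) (hg : PTF g) : PTF fun c => Nat.ble (f c) (g c) := by
  have : PTF fun c => (List.replicate (f c - g c) ()).isEmpty := by fun_prop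
  convert this using 2 with c
  rw [Bool.eq_iff_iff]
  simp [Nat.sub_eq_zero_iff_le]

@[fun_prop]
theorem beqNat {f g : γ → ℕ} (hf : PTF f) (hg : PTF g) : PTF fun c => f c == g c := by
  have : PTF fun c => Nat.ble (f c) (g c) && Nat.ble (g c) (f c) := by fun_prop
  convert this using 2 with c
  rw [Bool.eq_iff_iff]
  simp only [beq_iff_eq, Bool.and_eq_true, Nat.ble_eq]
  omega

@[fun_prop]
theorem beqPair {f g : γ → ℕ × ℕ} (hf : PTF f) (hg : PTF g) : PTF fun c => f c == g c := by
  have : PTF fun c => (f c).1 == (g c).1 && (f c).2 == (g c).2 := by fun_prop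
  exact this

@[fun_prop]
theorem containsNat {l : γ → List ℕ} {f : γ → ℕ} (hl : PTF l) (hf : PTF f) :
    PTF fun c => (l c).contains (f c) := by
  have : PTF fun c => (l c).any fun a => f c == a := by fun_prop
  simpa only [List.contains_eq_any_beq] using this

@[fun_prop]
theorem containsPair {l : γ → List (ℕ × ℕ)} {f : γ → ℕ × ℕ} (hl : PTF l) (hf : PTF f) :
    PTF fun c => (l c).contains (f c) := by
  have : PTF fun c => (l c).any fun a => f c == a := by fun_prop
  simpa only [List.contains_eq_any_beq] using this

@[fun_prop]
theorem count {l : γ → List ℕ} {f : γ → ℕ} (hl : PTF l) (hf : PTF f) :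
    PTF fun c => (l c).count (f c) := by
  have : PTF fun c => ((l c).filter fun a => a == f c).length := by fun_prop
  simpa only [List.count, List.countP_eq_length_filter] using this

@[fun_prop]
theorem range {n : γ → ℕ} (hn : PTF n) : PTF fun c => List.range (n c) := by
  have key : ∀ i, (fun l : List ℕ => l ++ [l.length])^[i] [] = List.range i := by
    intro i
    induction i with
    | zero => rfl
    | succ i ih => rw [Function.iterate_succ_apply', ih, List.range_succ]; simp
  obtain ⟨p, hp⟩ := hn.esize_le
  have : PTF fun c => (List.replicate (n c) ()).foldl (fun l _ => l ++ [l.length]) [] := by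
    refine foldl (by fun_prop) (const []) (by fun_prop) (p * (2 * p + 2) + 1) fun c i => ?_
    have key' : ∀ l : List Unit, l.foldl (fun l _ => l ++ [l.length]) [] = List.range l.length := by
      intro l
      induction l using List.reverseRecOn with
      | nil => rfl
      | append_singleton l a ih => rw [List.foldl_append, ih]; simp [List.range_succ]
    rw [key']
    have hn := hp c
    rw [esize_nat] at hn
    have hle : ((List.replicate (n c) ()).take i).length ≤ n c := by simp
    generalize ((List.replicate (n c) ()).take i).length = k at hle
    refine (esize_list_le (B := 2 * p.eval (esize c) + 1) fun a ha => ?_).trans ?_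
    · rw [List.mem_range] at ha; rw [esize_nat]; omega
    · simp only [List.length_range, eval_add, eval_mul, eval_one, eval_ofNat]
      exact Nat.add_le_add_right (Nat.mul_le_mul (by omega) (by omega)) _
  convert this using 2 with c
  induction n c with
  | zero => rfl
  | succ i ih => rw [List.replicate_succ', List.foldl_append, ← ih]; simp [List.range_succ]

end PTF

end TuringKernel

open Polynomial

namespace TuringKernel
open Enc (enc)

/-! ### The algorithm -/

/-- The members of a list picked greedily so that no two of them are in conflict. -/
def greedyBy {α : Type} (r : α → α → Bool) (l : List α) : List α :=
  l.foldl (fun acc a => bif acc.any (r a) then acc else a :: acc) []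

/-- The lists `x` and `y` have at least two common members. -/
def shares (x y : List ℕ) : Bool := Nat.ble 2 (x.filter fun u => y.contains u).length

/-- A maximal packing. -/
def greedy (τ : List (List ℕ)) : List (List ℕ) := greedyBy shares τ

/-- The vertices that occur in a list of triangles. -/
def vertices (τ : List (List ℕ)) : List ℕ := greedyBy (fun u v => u == v) τ.flatten

/-- The admissible bids of an auction in which the left ends of the pairs in `B` compete for the
right ends. The state consists of the current assignment and the list of all past bids; the price
of a right end is the number of bids for it. -/
def bids (B : List ((ℕ × ℕ) × ℕ)) (s : List ((ℕ × ℕ) × ℕ) × List ℕ) : List ((ℕ × ℕ) × ℕ) :=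
  B.filter fun b => !(s.1.map fun x => x.1).contains b.1 && (Nat.ble (s.2.count b.2) B.length &&
    B.all fun b' => !(b'.1 == b.1) || Nat.ble (s.2.count b.2) (s.2.count b'.2))

/-- One round of the auction. -/
def bid (B : List ((ℕ × ℕ) × ℕ)) (s : List ((ℕ × ℕ) × ℕ) × List ℕ) :
    List ((ℕ × ℕ) × ℕ) × List ℕ :=
  bif (bids B s).isEmpty then s else
    ((bids B s).headD ((0, 0), 0) ::
        s.1.filter fun b' => !(b'.2 == ((bids B s).headD ((0, 0), 0)).2),
      ((bids B s).headD ((0, 0), 0)).2 :: s.2)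

/-- The state at the end of the auction. -/
def auction (B : List ((ℕ × ℕ) × ℕ)) : List ((ℕ × ℕ) × ℕ) × List ℕ :=
  (bid B)^[(B.length + 1) * B.length + 1] ([], [])

/-- All members of `x` are members of `W`. -/
def inside (W x : List ℕ) : Bool := x.all fun u => W.contains u

/-- The part of a triangle inside `W` (an edge) and its part outside (a vertex). -/
def split (W x : List ℕ) : (ℕ × ℕ) × ℕ :=
  (((x.filter fun u => W.contains u).headD 0, (x.filter fun u => W.contains u).tail.headD 0),
    (x.filter fun u => !W.contains u).headD 0)

/-- The triangles not covered by the vertices of a maximal packing. -/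
def outer (τ : List (List ℕ)) : List (List ℕ) :=
  τ.filter fun x => !inside (greedy τ).flatten x

/-- The edges and apices of the triangles not covered by the vertices of a maximal packing. -/
def outerPairs (τ : List (List ℕ)) : List ((ℕ × ℕ) × ℕ) :=
  (outer τ).map fun x => split (greedy τ).flatten x

/-- A kernel for triangle packing: the vertices of a maximal packing, and the vertices assigned to
their edges by the auction. -/
def kernel (τ : List (List ℕ)) : List (List ℕ) :=
  τ.filter fun x => inside ((greedy τ).flatten ++ (auction (outerPairs τ)).1.map fun b => b.2) x

/-- The neighbours of `t` in the set `A`. -/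
def nbrsIn (tree : List (List ℕ)) (A : List ℕ) (t : ℕ) : List ℕ :=
  (tree.getD t []).filter fun u => A.contains u

/-- A leaf of the subtree with node set `A`. -/
def leaf (tree : List (List ℕ)) (A : List ℕ) : ℕ :=
  (A.filter fun t => (nbrsIn tree A t).length == 1).headD 0

/-- The neighbour of that leaf. -/
def leafNbr (tree : List (List ℕ)) (A : List ℕ) : ℕ := (nbrsIn tree A (leaf tree A)).headD 0

/-- Hand over the triangles that belong to `t` to `p`. -/
def handOver (t p : ℕ) (D : List (List ℕ × ℕ)) : List (List ℕ × ℕ) :=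
  D.map fun y => (y.1, bif y.2 == t then p else y.2)

/-- The triangles that belong to `p`. -/
def cluster (p : ℕ) (D : List (List ℕ × ℕ)) : List (List ℕ) :=
  (D.filter fun y => y.2 == p).map fun y => y.1

/-- If the triangles that belong to `p` have a packing of size `K`, split them off, and drop all
triangles that have an edge in common with them. -/
def cut (K p : ℕ) (s : List (List ℕ × ℕ) × List (List (List ℕ))) :
    List (List ℕ × ℕ) × List (List (List ℕ)) :=
  bif Nat.ble K (greedy (cluster p s.1)).length then
    (s.1.filter fun y => !(y.2 == p) && !(cluster p s.1).any fun x => shares y.1 x,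
      cluster p s.1 :: s.2)
  else s

/-- Remove a leaf from the tree. -/
def prune (tree : List (List ℕ)) (K : ℕ)
    (s : List ℕ × List (List ℕ × ℕ) × List (List (List ℕ))) :
    List ℕ × List (List ℕ × ℕ) × List (List (List ℕ)) :=
  (s.1.filter fun t => !(t == leaf tree s.1),
    cut K (leafNbr tree s.1) (handOver (leaf tree s.1) (leafNbr tree s.1) s.2.1, s.2.2))

/-- All triangles of a graph given by its neighbourhoods, as increasing lists. -/
def triangles (adj : List (List ℕ)) : List (List ℕ) :=
  (List.range adj.length).flatMap fun a => (adj.getD a []).flatMap fun b =>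
    ((adj.getD b []).filter fun c =>
      Nat.ble (a + 1) b && (Nat.ble (b + 1) c && (adj.getD a []).contains c)).map fun c => [a, b, c]

/-- A bag that contains `x`. -/
def home (bags : List (List ℕ)) (x : List ℕ) : ℕ :=
  ((List.range bags.length).filter fun t => inside (bags.getD t []) x).headD 0

/-- The triangles with the nodes to which they belong initially. -/
def homes (adj bags : List (List ℕ)) : List (List ℕ × ℕ) :=
  (triangles adj).map fun x => (x, home bags x)

/-- The state after `i` rounds. -/
def pruned (adj tree bags : List (List ℕ)) (K i : ℕ) :
    List ℕ × List (List ℕ × ℕ) × List (List (List ℕ)) :=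
  (prune tree K)^[i] (List.range bags.length, homes adj bags, [])

/-- The lists of triangles into which the graph is split. -/
def pieces (adj tree bags : List (List ℕ)) (K : ℕ) : List (List (List ℕ)) :=
  (pruned adj tree bags K (bags.length - 1)).2.1.map (fun y => y.1) ::
    (pruned adj tree bags K (bags.length - 1)).2.2

/-- The vertices `u` and `v` are adjacent in the graph formed by the triangles in `τ`. -/
def linked (τ : List (List ℕ)) (u v : ℕ) : Bool :=
  !(u == v) && τ.any fun x => x.contains u && x.contains v

/-- The instance formed by the triangles in `τ`, with a tree decomposition with a single bag. -/
def query (τ : List (List ℕ)) : (List (List ℕ) × List (List ℕ) × List (List ℕ)) × ℕ :=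
  (((List.range (vertices τ).length).map fun i => (List.range (vertices τ).length).filter fun j =>
      linked τ ((vertices τ).getD i 0) ((vertices τ).getD j 0),
    [[]], [List.range (vertices τ).length]), (vertices τ).length - 1)

/-- The queries, each with the original names of its vertices. -/
def queries (N : ℕ) (I : (List (List ℕ) × List (List ℕ) × List (List ℕ)) × ℕ) :
    List (List ℕ × ((List (List ℕ) × List (List ℕ) × List (List ℕ)) × ℕ)) :=
  bif I.2 == 0 then [] else
    (pieces I.1.1 I.1.2.1 I.1.2.2 (N * (I.2 * I.2))).map fun τ =>
      (vertices (kernel τ), query (kernel τ))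

/-- The union of the answers, in the original names. -/
def collect (L : List (List ℕ × List (List ℕ))) : List (List ℕ) :=
  L.flatMap fun y => y.2.map fun x => x.map fun i => y.1.getD i 0

/-! ### Size bounds for the intermediate results of the algorithm -/

/-- Members are picked from left to right but put in front, hence the reversal. It yields the size
bound for the fold as well as membership. -/
theorem greedyBy_sublist {α : Type} (r : α → α → Bool) (l : List α) :
    (greedyBy r l).Sublist l.reverse := by
  induction l using List.reverseRecOn with
  | nil => exact List.Sublist.slnil
  | append_singleton l a ih =>
    rw [greedyBy, List.foldl_append, List.reverse_append]
    change (bif (greedyBy r l).any (r a) then greedyBy r l else a :: greedyBy r l).Sublist _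
    cases (greedyBy r l).any (r a)
    · exact ih.cons_cons a
    · exact ih.cons a

theorem headD_bids_mem {B : List ((ℕ × ℕ) × ℕ)} {s : List ((ℕ × ℕ) × ℕ) × List ℕ}
    (h : bids B s ≠ []) : (bids B s).headD ((0, 0), 0) ∈ bids B s := by
  cases h' : bids B s with
  | nil => exact absurd h' h
  | cons a l => simp

/-- Each round adds at most one entry to either list, and all entries come from `B`; this keeps the
state of the auction polynomially large. -/
theorem bid_bounds (B : List ((ℕ × ℕ) × ℕ)) (i : ℕ) :
    (((bid B)^[i] ([], [])).1.length ≤ i ∧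
      ((bid B)^[i] ([], [])).2.length ≤ i) ∧
    (∀ b ∈ ((bid B)^[i] ([], [])).1, b ∈ B) ∧
    ∀ v ∈ ((bid B)^[i] ([], [])).2, ∃ b ∈ B, v = b.2 := by
  induction i with
  | zero => simp
  | succ i ih =>
    rw [Function.iterate_succ_apply']
    generalize (bid B)^[i] ([], []) = s at ih
    obtain ⟨⟨h1, h2⟩, h3, h4⟩ := ih
    by_cases h : bids B s = []
    · have : bid B s = s := by simp [bid, h]
      rw [this]
      exact ⟨⟨by omega, by omega⟩, h3, h4⟩
    · have hm : (bids B s).headD ((0, 0), 0) ∈ B :=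
        List.mem_of_mem_filter (headD_bids_mem h)
      simp only [bid, List.isEmpty_eq_false_iff.2 h, cond_false, List.length_cons]
      have := List.length_filter_le
        (fun b' => !(b'.2 == ((bids B s).headD ((0, 0), 0)).2)) s.1
      refine ⟨⟨by omega, by omega⟩, ?_, ?_⟩
      · intro b hb
        rcases List.mem_cons.1 hb with rfl | hb
        exacts [hm, h3 b (List.mem_of_mem_filter hb)]
      · intro v hv
        rcases List.mem_cons.1 hv with rfl | hv
        exacts [⟨_, hm, rfl⟩, h4 v hv]

/-- Polynomial time is claimed for all lists, also for those that encode no tree, so the bound on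
node numbers comes from the entries of `tree`. The default value 0 does no harm. -/
theorem leafNbr_le {tree : List (List ℕ)} {b : ℕ} (h : ∀ l ∈ tree, ∀ u ∈ l, u ≤ b) (A : List ℕ) :
    leafNbr tree A ≤ b := by
  rw [leafNbr, List.headD_eq_head?_getD]
  cases h' : (nbrsIn tree A (leaf tree A)).head? with
  | none => simp
  | some u =>
    have hu := List.mem_of_mem_filter (List.mem_of_mem_head? h')
    rw [List.getD_eq_getElem?_getD] at hu
    cases h'' : tree[leaf tree A]? with
    | none => simp [h''] at hu
    | some l =>
      rw [h''] at hu
      exact h l (List.mem_of_getElem? h'') u hu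

theorem map_fst_handOver (t p : ℕ) (D : List (List ℕ × ℕ)) :
    (handOver t p D).map (fun y => y.1) = D.map fun y => y.1 := by
  simp [handOver]

theorem cluster_sublist (p : ℕ) (D : List (List ℕ × ℕ)) :
    (cluster p D).Sublist (D.map fun y => y.1) :=
  List.filter_sublist.map _

/-- Triangles are only ever dropped or split off, never created, and each round adds at most one
piece, which is a sublist of the initial triangles. Together with the bound on node numbers this
controls the size of the state. -/
theorem prune_bounds {tree : List (List ℕ)} {K b : ℕ} (h : ∀ l ∈ tree, ∀ u ∈ l, u ≤ b)
    {A : List ℕ} {D : List (List ℕ × ℕ)} (hD : ∀ y ∈ D, y.2 ≤ b) (i : ℕ) :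
    ((prune tree K)^[i] (A, D, [])).1.Sublist A ∧
    (((prune tree K)^[i] (A, D, [])).2.1.map fun y => y.1).Sublist (D.map fun y => y.1) ∧
    (∀ y ∈ ((prune tree K)^[i] (A, D, [])).2.1, y.2 ≤ b) ∧
    ((prune tree K)^[i] (A, D, [])).2.2.length ≤ i ∧
    ∀ τ ∈ ((prune tree K)^[i] (A, D, [])).2.2, τ.Sublist (D.map fun y => y.1) := by
  induction i with
  | zero => simpa using hD
  | succ i ih =>
    rw [Function.iterate_succ_apply']
    generalize (prune tree K)^[i] (A, D, []) = s at ih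
    obtain ⟨h1, h2, h3, h4, h5⟩ := ih
    have k2 : ((handOver (leaf tree s.1) (leafNbr tree s.1) s.2.1).map fun y => y.1).Sublist
        (D.map fun y => y.1) := by rwa [map_fst_handOver]
    have k3 : ∀ y ∈ handOver (leaf tree s.1) (leafNbr tree s.1) s.2.1, y.2 ≤ b := by
      intro y hy
      obtain ⟨z, hz, rfl⟩ := List.mem_map.1 hy
      dsimp only
      cases z.2 == leaf tree s.1
      exacts [h3 z hz, leafNbr_le h _]
    refine ⟨List.filter_sublist.trans h1, ?_⟩
    simp only [prune, cut]
    generalize handOver (leaf tree s.1) (leafNbr tree s.1) s.2.1 = E at k2 k3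
    cases Nat.ble K (greedy (cluster (leafNbr tree s.1) E)).length
    · exact ⟨k2, k3, by simp only [cond_false]; omega, h5⟩
    · refine ⟨(List.filter_sublist.map _).trans k2, fun y hy => k3 y (List.mem_of_mem_filter hy),
        by simp only [cond_true, List.length_cons]; omega, fun τ hτ => ?_⟩
      rcases List.mem_cons.1 hτ with rfl | hτ
      exacts [(cluster_sublist _ _).trans k2, h5 τ hτ]

/-! ### The algorithm takes polynomial time -/

namespace PTF

variable {α γ : Type} [Enc α] [Enc γ]

theorem greedyBy {r : α → α → Bool} {l : γ → List α} (hr : PTF fun x : α × α => r x.1 x.2)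
    (hl : PTF l) : PTF fun c => greedyBy r (l c) := by
  obtain ⟨p, hp⟩ := hl.esize_le
  have hr' : PTF fun x : ((γ × List α) × α) × α => r x.1.2 x.2 :=
    hr.comp (f := fun x : ((γ × List α) × α) × α => (x.1.2, x.2)) (by fun_prop)
  refine foldl (step := fun _ acc a => bif acc.any (r a) then acc else a :: acc) hl (const [])
    (by fun_prop) p fun c i => ?_
  have h := esize_le_of_sublist (greedyBy_sublist r ((l c).take i))
  rw [esize_reverse] at h
  exact h.trans ((esize_le_of_sublist (List.take_sublist i (l c))).trans (hp c))

@[fun_prop]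
theorem shares {x y : γ → List ℕ} (hx : PTF x) (hy : PTF y) : PTF fun c => shares (x c) (y c) := by
  unfold TuringKernel.shares; fun_prop

@[fun_prop]
theorem greedy {τ : γ → List (List ℕ)} (h : PTF τ) : PTF fun c => greedy (τ c) :=
  greedyBy (by fun_prop) h

@[fun_prop]
theorem vertices {τ : γ → List (List ℕ)} (h : PTF τ) : PTF fun c => vertices (τ c) :=
  greedyBy (by fun_prop) (by fun_prop)

@[fun_prop]
theorem bids {B : γ → List ((ℕ × ℕ) × ℕ)} {s : γ → List ((ℕ × ℕ) × ℕ) × List ℕ}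
    (hB : PTF B) (hs : PTF s) : PTF fun c => bids (B c) (s c) := by
  unfold TuringKernel.bids; fun_prop

@[fun_prop]
theorem bid {B : γ → List ((ℕ × ℕ) × ℕ)} {s : γ → List ((ℕ × ℕ) × ℕ) × List ℕ}
    (hB : PTF B) (hs : PTF s) : PTF fun c => bid (B c) (s c) := by
  unfold TuringKernel.bid; fun_prop

@[fun_prop]
theorem auction {B : γ → List ((ℕ × ℕ) × ℕ)} (hB : PTF B) : PTF fun c => auction (B c) := by
  have h : PTF TuringKernel.auction := by
    -- The state consists of two lists, each with at most as many entries as there are rounds, and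
    -- each entry is no larger than `B`.
    refine iterate (step := TuringKernel.bid) (by fun_prop) (const _) (by fun_prop)
      (2 * (((X + 1) * X + 1) * (X + 1)) + 3) fun B i hi => ?_
    obtain ⟨⟨h1, h2⟩, h3, h4⟩ := bid_bounds B i
    have hl := length_le_esize B
    have hn : i ≤ (esize B + 1) * esize B + 1 := hi.trans
      (Nat.add_le_add_right (Nat.mul_le_mul (by omega) (by omega)) _)
    have g1 := esize_list_le (B := esize B) fun b hb => by
      have := esize_le_of_mem (h3 b hb); omega
    have g2 := esize_list_le (B := esize B) fun v hv => by
      obtain ⟨b, hb, rfl⟩ := h4 v hv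
      have := esize_le_of_mem hb
      simp only [esize_pair] at this; omega
    have k1 := Nat.mul_le_mul_right (esize B + 1) (h1.trans hn)
    have k2 := Nat.mul_le_mul_right (esize B + 1) (h2.trans hn)
    simp only [esize_pair, eval_add, eval_mul, eval_X, eval_ofNat, eval_one]
    omega
  exact h.comp hB

@[fun_prop]
theorem inside {W x : γ → List ℕ} (hW : PTF W) (hx : PTF x) : PTF fun c => inside (W c) (x c) := by
  unfold TuringKernel.inside; fun_prop

@[fun_prop]
theorem split {W x : γ → List ℕ} (hW : PTF W) (hx : PTF x) : PTF fun c => split (W c) (x c) := by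
  unfold TuringKernel.split; fun_prop

@[fun_prop]
theorem outer {τ : γ → List (List ℕ)} (h : PTF τ) : PTF fun c => outer (τ c) := by
  unfold TuringKernel.outer; fun_prop

@[fun_prop]
theorem outerPairs {τ : γ → List (List ℕ)} (h : PTF τ) : PTF fun c => outerPairs (τ c) := by
  unfold TuringKernel.outerPairs; fun_prop

@[fun_prop]
theorem kernel {τ : γ → List (List ℕ)} (h : PTF τ) : PTF fun c => kernel (τ c) := by
  unfold TuringKernel.kernel; fun_prop

@[fun_prop]
theorem nbrsIn {T : γ → List (List ℕ)} {A : γ → List ℕ} {t : γ → ℕ} (hT : PTF T) (hA : PTF A)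
    (ht : PTF t) : PTF fun c => nbrsIn (T c) (A c) (t c) := by
  unfold TuringKernel.nbrsIn; fun_prop

@[fun_prop]
theorem leaf {T : γ → List (List ℕ)} {A : γ → List ℕ} (hT : PTF T) (hA : PTF A) :
    PTF fun c => leaf (T c) (A c) := by
  unfold TuringKernel.leaf; fun_prop

@[fun_prop]
theorem leafNbr {T : γ → List (List ℕ)} {A : γ → List ℕ} (hT : PTF T) (hA : PTF A) :
    PTF fun c => leafNbr (T c) (A c) := by
  unfold TuringKernel.leafNbr; fun_prop

@[fun_prop]
theorem handOver {t p : γ → ℕ} {D : γ → List (List ℕ × ℕ)} (ht : PTF t) (hp : PTF p) (hD : PTF D) :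
    PTF fun c => handOver (t c) (p c) (D c) := by
  unfold TuringKernel.handOver; fun_prop

@[fun_prop]
theorem cluster {p : γ → ℕ} {D : γ → List (List ℕ × ℕ)} (hp : PTF p) (hD : PTF D) :
    PTF fun c => cluster (p c) (D c) := by
  unfold TuringKernel.cluster; fun_prop

@[fun_prop]
theorem cut {K p : γ → ℕ} {s : γ → List (List ℕ × ℕ) × List (List (List ℕ))}
    (hK : PTF K) (hp : PTF p) (hs : PTF s) : PTF fun c => cut (K c) (p c) (s c) := by
  unfold TuringKernel.cut; fun_prop

@[fun_prop]
theorem prune {T : γ → List (List ℕ)} {K : γ → ℕ}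
    {s : γ → List ℕ × List (List ℕ × ℕ) × List (List (List ℕ))}
    (hT : PTF T) (hK : PTF K) (hs : PTF s) : PTF fun c => prune (T c) (K c) (s c) := by
  unfold TuringKernel.prune; fun_prop

@[fun_prop]
theorem triangles {adj : γ → List (List ℕ)} (h : PTF adj) : PTF fun c => triangles (adj c) := by
  unfold TuringKernel.triangles; fun_prop

@[fun_prop]
theorem home {bags : γ → List (List ℕ)} {x : γ → List ℕ} (hb : PTF bags) (hx : PTF x) :
    PTF fun c => home (bags c) (x c) := by
  unfold TuringKernel.home; fun_prop

@[fun_prop]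
theorem homes {adj bags : γ → List (List ℕ)} (ha : PTF adj) (hb : PTF bags) :
    PTF fun c => homes (adj c) (bags c) := by
  unfold TuringKernel.homes; fun_prop

@[fun_prop]
theorem pruned {adj T bags : γ → List (List ℕ)} {K i : γ → ℕ} (ha : PTF adj) (hT : PTF T)
    (hb : PTF bags) (hK : PTF K) (hi : PTF i) :
    PTF fun c => pruned (adj c) (T c) (bags c) (K c) (i c) := by
  have hh : PTF fun c => TuringKernel.homes (adj c) (bags c) := by fun_prop
  have hA : PTF fun c => List.range (bags c).length := by fun_prop
  obtain ⟨pT, hpT⟩ := hT.esize_le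
  obtain ⟨pi, hpi⟩ := hi.esize_le
  obtain ⟨ph, hph⟩ := hh.esize_le
  obtain ⟨pA, hpA⟩ := hA.esize_le
  refine iterate (step := fun c => TuringKernel.prune (T c) (K c)) hi (by fun_prop) (by fun_prop)
    (pA + (ph * (ph + 2 * (pT + ph) + 3) + 1) + (pi * (ph + 1) + 1) + 2) fun c i hi => ?_
  have e1 := hpT c
  have e2 := hpi c
  have e3 := hph c
  have e4 := hpA c
  rw [esize_nat] at e2
  have hmap : esize ((TuringKernel.homes (adj c) (bags c)).map fun y => y.1) ≤
      ph.eval (esize c) := by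
    refine le_trans ?_ e3
    generalize TuringKernel.homes (adj c) (bags c) = D
    induction D with
    | nil => simp
    | cons y D ih => simp only [List.map_cons, esize_cons, esize_pair]; omega
  obtain ⟨h1, h2, h3, h4, h5⟩ := prune_bounds (tree := T c) (K := K c)
    (b := pT.eval (esize c) + ph.eval (esize c)) (A := List.range (bags c).length)
    (D := TuringKernel.homes (adj c) (bags c))
    (fun l hl u hu => by
      have g1 := esize_le_of_mem hl
      have g2 := esize_le_of_mem hu
      rw [esize_nat] at g2; omega)
    (fun y hy => by
      have g1 := esize_le_of_mem hy
      rw [esize_pair, esize_nat] at g1; omega) i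
  generalize (TuringKernel.prune (T c) (K c))^[i]
    (List.range (bags c).length, TuringKernel.homes (adj c) (bags c), []) = s at h1 h2 h3 h4 h5
  have f1 := esize_le_of_sublist h1
  have f2 := esize_le_of_sublist h2
  have f3 : esize s.2.1 ≤ _ := esize_list_le
    (B := ph.eval (esize c) + 2 * (pT.eval (esize c) + ph.eval (esize c)) + 2) fun y hy => by
      have g1 := h3 y hy
      have g2 := esize_le_of_mem (List.mem_map_of_mem (f := fun y : List ℕ × ℕ => y.1) hy)
      rw [esize_pair, esize_nat]
      omega
  have f4 : s.2.1.length ≤ ph.eval (esize c) := by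
    have g1 := h2.length_le
    have g2 := length_le_esize ((TuringKernel.homes (adj c) (bags c)).map fun y => y.1)
    rw [List.length_map] at g1
    omega
  have f5 : esize s.2.2 ≤ _ := esize_list_le (B := ph.eval (esize c)) fun τ hτ =>
    (esize_le_of_sublist (h5 τ hτ)).trans hmap
  have f6 := f3.trans (Nat.add_le_add_right (Nat.mul_le_mul_right _ f4) _)
  have f7 := f5.trans (Nat.add_le_add_right
    (Nat.mul_le_mul_right _ (show s.2.2.length ≤ pi.eval (esize c) by omega)) _)
  simp only [esize_pair, eval_add, eval_mul, eval_ofNat, eval_one]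
  simp only [add_assoc] at *
  norm_num at f6 f7 ⊢
  omega

@[fun_prop]
theorem pieces {adj T bags : γ → List (List ℕ)} {K : γ → ℕ} (ha : PTF adj) (hT : PTF T)
    (hb : PTF bags) (hK : PTF K) : PTF fun c => pieces (adj c) (T c) (bags c) (K c) := by
  unfold TuringKernel.pieces; fun_prop

@[fun_prop]
theorem linked {τ : γ → List (List ℕ)} {u v : γ → ℕ} (h : PTF τ) (hu : PTF u) (hv : PTF v) :
    PTF fun c => linked (τ c) (u c) (v c) := by
  unfold TuringKernel.linked; fun_prop

@[fun_prop]
theorem query {τ : γ → List (List ℕ)} (h : PTF τ) : PTF fun c => query (τ c) := by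
  unfold TuringKernel.query; fun_prop

theorem queries (N : ℕ) : PTF (queries N) := by
  unfold TuringKernel.queries; fun_prop

@[fun_prop]
theorem collect {L : γ → List (List ℕ × List (List ℕ))} (h : PTF L) :
    PTF fun c => collect (L c) := by
  unfold TuringKernel.collect; fun_prop

end PTF

end TuringKernel

namespace TuringKernel

/-! ### Greedy choices and packings -/

theorem greedyBy_concat {α : Type} (r : α → α → Bool) (l : List α) (a : α) :
    greedyBy r (l ++ [a]) = bif (greedyBy r l).any (r a) then greedyBy r l else a :: greedyBy r l := by
  rw [greedyBy, List.foldl_append]; rfl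

theorem mem_of_mem_greedyBy {α : Type} {r : α → α → Bool} {l : List α} {a : α}
    (h : a ∈ greedyBy r l) : a ∈ l :=
  List.mem_reverse.1 ((greedyBy_sublist r l).subset h)

theorem pairwise_greedyBy {α : Type} (r : α → α → Bool) (l : List α) :
    (greedyBy r l).Pairwise fun a b => r a b = false := by
  induction l using List.reverseRecOn with
  | nil => exact List.Pairwise.nil
  | append_singleton l a ih =>
    rw [greedyBy_concat]
    cases h : (greedyBy r l).any (r a)
    · simpa using ⟨by simpa using h, ih⟩
    · exact ih

theorem greedyBy_maximal {α : Type} {r : α → α → Bool} {l : List α} {a : α} (h : a ∈ l) :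
    a ∈ greedyBy r l ∨ ∃ b ∈ greedyBy r l, r a b = true := by
  induction l using List.reverseRecOn with
  | nil => simp at h
  | append_singleton l b ih =>
    rw [greedyBy_concat]
    rw [List.mem_append, List.mem_singleton] at h
    cases hb : (greedyBy r l).any (r b)
    · rcases h with h | rfl
      · rcases ih h with h | ⟨c, hc, h⟩
        exacts [.inl (List.mem_cons_of_mem _ h), .inr ⟨c, List.mem_cons_of_mem _ hc, h⟩]
      · exact .inl List.mem_cons_self
    · rcases h with h | rfl
      · exact ih h
      · exact .inr (by simpa using hb)

theorem nodup_vertices (τ : List (List ℕ)) : (vertices τ).Nodup :=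
  (pairwise_greedyBy _ _).imp fun h => by simpa using h

theorem mem_vertices {τ : List (List ℕ)} {v : ℕ} : v ∈ vertices τ ↔ ∃ x ∈ τ, v ∈ x := by
  rw [← List.mem_flatten]
  refine ⟨fun h => mem_of_mem_greedyBy h, fun h => ?_⟩
  rcases greedyBy_maximal (r := fun u v => u == v) h with h | ⟨b, hb, h⟩
  · exact h
  · rw [beq_iff_eq] at h; rwa [h]

/-- A triangle, written as a list. -/
def IsTri (x : List ℕ) : Prop := x.Nodup ∧ x.length = 3

theorem two_le_length_iff {l : List ℕ} (hl : l.Nodup) :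
    2 ≤ l.length ↔ ∃ u ∈ l, ∃ v ∈ l, u ≠ v := by
  rw [← List.toFinset_card_of_nodup hl, ← Nat.lt_iff_add_one_le, Finset.one_lt_card]
  simp

/-- The filter in `shares` runs over `x`, so without repetitions in `x` its length counts distinct
common vertices; repetitions in `y` do not matter. -/
theorem shares_iff {x y : List ℕ} (hx : x.Nodup) :
    shares x y = true ↔ ∃ u v, u ≠ v ∧ (u ∈ x ∧ v ∈ x) ∧ u ∈ y ∧ v ∈ y := by
  rw [shares, Nat.ble_eq, two_le_length_iff (hx.filter _)]
  simp only [List.mem_filter, List.contains_iff_mem]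
  constructor
  · rintro ⟨u, ⟨h1, h2⟩, v, ⟨h3, h4⟩, h⟩
    exact ⟨u, v, h, ⟨h1, h3⟩, h2, h4⟩
  · rintro ⟨u, v, h, ⟨h1, h3⟩, h2, h4⟩
    exact ⟨u, ⟨h1, h2⟩, v, ⟨h3, h4⟩, h⟩

/-- A set of triangles no two of which have an edge in common. -/
def Packing (P : Finset (List ℕ)) : Prop :=
  (∀ x ∈ P, IsTri x) ∧ ∀ x ∈ P, ∀ y ∈ P, x ≠ y → shares x y = false

theorem Packing.subset {P Q : Finset (List ℕ)} (h : Packing P) (hQ : Q ⊆ P) : Packing Q :=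
  ⟨fun x hx => h.1 x (hQ hx), fun x hx y hy => h.2 x (hQ hx) y (hQ hy)⟩

theorem Packing.eq {P : Finset (List ℕ)} (h : Packing P) {x y : List ℕ} (hx : x ∈ P) (hy : y ∈ P)
    {u v : ℕ} (huv : u ≠ v) (hux : u ∈ x) (hvx : v ∈ x) (huy : u ∈ y) (hvy : v ∈ y) : x = y := by
  by_contra hxy
  have := (shares_iff (h.1 x hx).1).2 ⟨u, v, huv, ⟨hux, hvx⟩, huy, hvy⟩
  rw [h.2 x hx y hy hxy] at this
  cases this

/-- A packing whose members each use an edge from `E` is no larger than `E`. -/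
theorem Packing.card_le {P : Finset (List ℕ)} (h : Packing P) (E : Finset (ℕ × ℕ))
    (hE : ∀ x ∈ P, ∃ u v, u ≠ v ∧ (u ∈ x ∧ v ∈ x) ∧ (u, v) ∈ E) : P.card ≤ E.card := by
  choose! u v huv hx hm using hE
  refine Finset.card_le_card_of_injOn (fun x => (u x, v x)) hm fun x hxP y hyP hxy => ?_
  simp only [Prod.mk.injEq] at hxy
  exact h.eq hxP hyP (huv x hxP) (hx x hxP).1 (hx x hxP).2 (hxy.1 ▸ (hx y hyP).1)
    (hxy.2 ▸ (hx y hyP).2)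

/-- All `3 * 3` ordered pairs of vertices of a triangle are counted, the diagonal included; both
orders are needed because the lists are not assumed to be sorted. -/
theorem card_pairs_le {S : List (List ℕ)} (hS : ∀ x ∈ S, IsTri x) :
    (S.flatMap fun x => x ×ˢ x).toFinset.card ≤ 9 * S.length := by
  refine (List.toFinset_card_le _).trans ?_
  induction S with
  | nil => simp
  | cons x S ih =>
    have h1 := ih fun y hy => hS y (List.mem_cons_of_mem _ hy)
    have h2 := (hS x List.mem_cons_self).2
    simp only [List.flatMap_cons, List.length_append, List.length_product, List.length_cons, h2]
    omega

theorem mem_greedy {τ : List (List ℕ)} {x : List ℕ} (h : x ∈ greedy τ) : x ∈ τ :=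
  mem_of_mem_greedyBy h

theorem exists_shared_pair {τ : List (List ℕ)} (hτ : ∀ x ∈ τ, IsTri x) {x : List ℕ} (hx : x ∈ τ) :
    ∃ y ∈ greedy τ, ∃ u v, u ≠ v ∧ (u ∈ x ∧ v ∈ x) ∧ u ∈ y ∧ v ∈ y := by
  rcases greedyBy_maximal (r := shares) hx with h | ⟨y, hy, h⟩
  · obtain ⟨u, hu, v, hv, huv⟩ := (two_le_length_iff (hτ x hx).1).1 (by rw [(hτ x hx).2]; omega)
    exact ⟨x, h, u, v, huv, ⟨hu, hv⟩, hu, hv⟩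
  · exact ⟨y, hy, (shares_iff (hτ x hx).1).1 h⟩

/-- By maximality each member of `P` shares an edge with a greedily chosen triangle, and no edge
serves two members of `P`. -/
theorem Packing.card_le_greedy {τ : List (List ℕ)} (hτ : ∀ x ∈ τ, IsTri x) {P : Finset (List ℕ)}
    (hP : Packing P) (h : ∀ x ∈ P, x ∈ τ) : P.card ≤ 9 * (greedy τ).length := by
  refine (hP.card_le (((greedy τ).flatMap fun x => x ×ˢ x).toFinset) fun x hx => ?_).trans
    (card_pairs_le fun x hx => hτ x (mem_greedy hx))
  obtain ⟨y, hy, u, v, huv, hx, hu, hv⟩ := exists_shared_pair hτ (h x hx)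
  refine ⟨u, v, huv, hx, ?_⟩
  rw [List.mem_toFinset, List.mem_flatMap]
  exact ⟨y, hy, List.mem_product.2 ⟨hu, hv⟩⟩

theorem shares_self {x : List ℕ} (hx : IsTri x) : shares x x = true := by
  obtain ⟨u, hu, v, hv, huv⟩ := (two_le_length_iff hx.1).1 (by rw [hx.2]; omega)
  exact (shares_iff hx.1).2 ⟨u, v, huv, ⟨hu, hv⟩, hu, hv⟩

theorem shares_comm {x y : List ℕ} (hx : x.Nodup) (hy : y.Nodup) : shares x y = shares y x := by
  rw [Bool.eq_iff_iff, shares_iff hx, shares_iff hy]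
  exact exists_congr fun u => exists_congr fun v => and_congr_right fun _ => and_comm

/-- A triangle is in conflict with itself, so the greedy list has no repetitions, and its length is
the size of the packing. -/
theorem packing_greedy {τ : List (List ℕ)} (hτ : ∀ x ∈ τ, IsTri x) :
    Packing (greedy τ).toFinset ∧ (greedy τ).toFinset.card = (greedy τ).length := by
  have hp : (greedy τ).Pairwise fun a b => shares a b = false := pairwise_greedyBy _ _
  have ht : ∀ x ∈ greedy τ, IsTri x := fun x hx => hτ x (mem_greedy hx)
  have hnd : (greedy τ).Nodup := hp.imp_of_mem fun {a b} ha hb h e => by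
    rw [← e, shares_self (ht a ha)] at h; cases h
  refine ⟨⟨by simpa using ht, ?_⟩, List.toFinset_card_of_nodup hnd⟩
  simp only [List.mem_toFinset]
  refine fun x hx y hy hxy => List.Pairwise.forall_of_forall_of_flip
    (R := fun a b => a ≠ b → (IsTri a → IsTri b → shares a b = false)) ?_ ?_ ?_ hx hy hxy (ht x hx) (ht y hy)
  · exact fun x _ h => absurd rfl h
  · exact hp.imp fun h _ _ _ => h
  · exact hp.imp fun h _ h1 h2 => by rw [shares_comm h1.1 h2.1]; exact h

/-! ### The auction -/

/-- The invariants of the auction. -/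
structure AuctionInv (B : List ((ℕ × ℕ) × ℕ)) (s : List ((ℕ × ℕ) × ℕ) × List ℕ) : Prop where
  sub : ∀ m ∈ s.1, m ∈ B
  left : (s.1.map fun b => b.1).Nodup
  right : (s.1.map fun b => b.2).Nodup
  priced : ∀ v, 0 < s.2.count v → ∃ m ∈ s.1, m.2 = v
  cheap : ∀ m ∈ s.1, ∀ b ∈ B, b.1 = m.1 → s.2.count m.2 ≤ s.2.count b.2 + 1
  cap : ∀ v, s.2.count v ≤ B.length + 1
  hist : ∀ v ∈ s.2, v ∈ B.map fun b => b.2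

/-- A right end that has received a bid stays assigned, possibly to a later bidder, which gives
`priced`. For `cheap`: a bid goes to a cheapest neighbour and raises its price by one; afterwards
prices of other right ends only rise, while a further bid on the same right end dissolves the
assignment. -/
theorem AuctionInv.bid {B : List ((ℕ × ℕ) × ℕ)} {s : List ((ℕ × ℕ) × ℕ) × List ℕ}
    (h : AuctionInv B s) : AuctionInv B (bid B s) := by
  by_cases he : bids B s = []
  · have : TuringKernel.bid B s = s := by simp [TuringKernel.bid, he]
    rwa [this]
  have hm := headD_bids_mem he
  have hb : TuringKernel.bid B s = ((bids B s).headD ((0, 0), 0) ::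
      s.1.filter fun b' => !(b'.2 == ((bids B s).headD ((0, 0), 0)).2),
      ((bids B s).headD ((0, 0), 0)).2 :: s.2) := by
    rw [TuringKernel.bid, List.isEmpty_eq_false_iff.2 he, cond_false]
  rw [hb]
  generalize (bids B s).headD ((0, 0), 0) = a at hm
  simp only [bids, List.mem_filter, Bool.and_eq_true, Bool.not_eq_true', Nat.ble_eq,
    List.all_eq_true, Bool.or_eq_true, beq_eq_false_iff_ne] at hm
  obtain ⟨haB, hleft, hcap, hmin⟩ := hm
  have hleft : a.1 ∉ s.1.map fun x => x.1 := by
    rw [← List.contains_iff_mem]; simpa using hleft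
  have hcount : ∀ v, s.2.count v ≤ (a.2 :: s.2).count v := fun v => by
    rw [List.count_cons]; omega
  constructor
  · intro m hm
    rcases List.mem_cons.1 hm with rfl | hm
    exacts [haB, h.sub m (List.mem_of_mem_filter hm)]
  · rw [List.map_cons, List.nodup_cons]
    exact ⟨fun hx => hleft ((List.filter_sublist.map _).subset hx),
      h.left.sublist (List.filter_sublist.map _)⟩
  · rw [List.map_cons, List.nodup_cons]
    refine ⟨fun hx => ?_, h.right.sublist (List.filter_sublist.map _)⟩
    obtain ⟨m, hm, hma⟩ := List.mem_map.1 hx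
    simp [hma] at hm
  · intro v hv
    by_cases hva : v = a.2
    · exact ⟨a, List.mem_cons_self, hva.symm⟩
    · dsimp only at hv
      rw [List.count_cons_of_ne (Ne.symm hva)] at hv
      obtain ⟨m, hm, rfl⟩ := h.priced v hv
      exact ⟨m, List.mem_cons_of_mem _ (List.mem_filter.2 ⟨hm, by simpa using hva⟩), rfl⟩
  · intro m hm b hb hbm
    dsimp only
    rcases List.mem_cons.1 hm with rfl | hm
    · have := hmin b hb
      have := this.resolve_left (not_not.2 hbm)
      have := hcount b.2
      rw [List.count_cons_self]
      omega
    · obtain ⟨hm, hma⟩ := List.mem_filter.1 hm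
      have := h.cheap m hm b hb hbm
      have := hcount b.2
      rw [List.count_cons_of_ne (by rintro h; simp [h] at hma)]
      omega
  · intro v
    dsimp only
    rw [List.count_cons]
    have := h.cap v
    split_ifs with hva
    · rw [beq_iff_eq] at hva; subst hva; omega
    · omega
  · intro v hv
    rcases List.mem_cons.1 hv with rfl | hv
    exacts [List.mem_map_of_mem haB, h.hist v hv]

theorem auctionInv_iterate (B : List ((ℕ × ℕ) × ℕ)) (i : ℕ) :
    AuctionInv B ((bid B)^[i] ([], [])) := by
  induction i with
  | zero => constructor <;> simp
  | succ i ih => rw [Function.iterate_succ_apply']; exact ih.bid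

/-- As long as the auction is alive, each round makes one bid. At most `B.length` right ends receive
at most `B.length + 1` bids each, and the number of rounds exceeds the product by one. -/
theorem bids_auction (B : List ((ℕ × ℕ) × ℕ)) : bids B (auction B) = [] := by
  have key : ∀ i, bids B ((bid B)^[i] ([], [])) = [] ∨ ((bid B)^[i] ([], [])).2.length = i := by
    intro i
    induction i with
    | zero => exact .inr rfl
    | succ i ih =>
      rw [Function.iterate_succ_apply']
      by_cases h : bids B ((bid B)^[i] ([], [])) = []
      · left
        have : bid B ((bid B)^[i] ([], [])) = (bid B)^[i] ([], []) := by simp [bid, h]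
        rwa [this]
      · right
        rw [bid, List.isEmpty_eq_false_iff.2 h]
        simpa using ih.resolve_left h
  refine (key _).resolve_right fun h => ?_
  have inv := auctionInv_iterate B ((B.length + 1) * B.length + 1)
  generalize (bid B)^[(B.length + 1) * B.length + 1] ([], []) = s at h inv
  have h1 : s.2.length ≤ s.2.toFinset.card * (B.length + 1) := by
    rw [← List.sum_toFinset_count_eq_length, ← smul_eq_mul]
    exact Finset.sum_le_card_nsmul _ _ _ fun v _ => inv.cap v
  have h2 : s.2.toFinset.card ≤ B.length := by
    refine (Finset.card_le_card fun v hv => ?_).trans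
      ((List.toFinset_card_le (B.map fun b => b.2)).trans (by simp))
    exact List.mem_toFinset.2 (inv.hist v (List.mem_toFinset.1 hv))
  have h3 := Nat.mul_le_mul_right (B.length + 1) h2
  rw [mul_comm B.length] at h3
  omega

/-- The result of the auction is a matching in which all left ends adjacent to a certain set `O` of
right ends are matched into `O`, while all right ends outside `O` are matched. -/
theorem auction_spec (B : List ((ℕ × ℕ) × ℕ)) : ∃ O : ℕ → Prop,
    (∀ b ∈ B, (∃ m ∈ (auction B).1, m.2 = b.2) ∨ O b.2) ∧
    ∀ b ∈ B, O b.2 → ∃ m ∈ (auction B).1, m.1 = b.1 ∧ O m.2 := by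
  have inv : AuctionInv B (auction B) := auctionInv_iterate B _
  have hempty := bids_auction B
  generalize auction B = s at inv hempty
  have hlen : s.1.length ≤ B.length := by
    have h1 : s.1.Nodup := List.Nodup.of_map _ inv.left
    rw [← List.toFinset_card_of_nodup h1]
    refine (Finset.card_le_card fun m hm => ?_).trans (List.toFinset_card_le B)
    exact List.mem_toFinset.2 (inv.sub m (List.mem_toFinset.1 hm))
  -- Pigeonhole: at most `B.length` right ends are assigned, so one of the `B.length + 1` price
  -- levels `1, …, B.length + 1` is not the price of any of them. As positive prices occur only at
  -- assigned right ends, no right end at all has price `j`.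
  obtain ⟨j, hj, hj'⟩ : ∃ j ∈ Finset.Icc 1 (B.length + 1),
      j ∉ (s.1.map fun m => s.2.count m.2).toFinset := by
    refine Finset.exists_mem_notMem_of_card_lt_card ?_
    refine (List.toFinset_card_le _).trans_lt ?_
    simp only [List.length_map, Nat.card_Icc]; omega
  rw [Finset.mem_Icc] at hj
  have hj'' : ∀ v, s.2.count v ≠ j := by
    intro v hv
    obtain ⟨m, hm, rfl⟩ := inv.priced v (by omega)
    exact hj' (List.mem_toFinset.2 (List.mem_map.2 ⟨m, hm, hv⟩))
  -- `O` consists of the right ends below the gap. A left end adjacent to `O` that is assigned has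
  -- paid a price of at most `j`, hence less than `j`.
  refine ⟨fun v => s.2.count v < j, fun b _ => ?_, fun b hb hbj => ?_⟩
  · by_cases h : 0 < s.2.count b.2
    · exact .inl (inv.priced _ h)
    · exact .inr (by omega)
  · by_cases hleft : b.1 ∈ s.1.map fun m => m.1
    · obtain ⟨m, hm, hmb⟩ := List.mem_map.1 hleft
      refine ⟨m, hm, hmb, ?_⟩
      have h1 := inv.cheap m hm b hb hmb.symm
      have h2 := hj'' m.2
      omega
    · exfalso
      -- If that left end were unassigned, a bid for its cheapest neighbour, whose price is below `j
      -- ≤ B.length + 1`, would still be admissible.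
      obtain ⟨a, ha, hmin⟩ := (B.filter fun a => a.1 == b.1).toFinset.exists_min_image
        (fun a => s.2.count a.2) ⟨b, by simp [hb]⟩
      simp only [List.mem_toFinset, List.mem_filter, beq_iff_eq] at ha hmin
      have : a ∈ bids B s := by
        rw [bids, List.mem_filter]
        refine ⟨ha.1, ?_⟩
        simp only [Bool.and_eq_true, Bool.not_eq_true', Nat.ble_eq, List.all_eq_true,
          Bool.or_eq_true, beq_eq_false_iff_ne]
        refine ⟨?_, ?_, fun c hc => ?_⟩
        · rw [ha.2, ← Bool.not_eq_true, List.contains_iff_mem]; exact hleft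
        · have := hmin b ⟨hb, rfl⟩; omega
        · by_cases hca : c.1 = a.1
          · exact .inr (hmin c ⟨hc, hca.trans ha.2⟩)
          · exact .inl hca
      rw [hempty] at this
      simp at this

/-! ### The kernel -/

theorem inside_iff {W x : List ℕ} : inside W x = true ↔ ∀ u ∈ x, u ∈ W := by
  simp [inside]

theorem mem_outer {τ : List (List ℕ)} {x : List ℕ} :
    x ∈ outer τ ↔ x ∈ τ ∧ ∃ u ∈ x, u ∉ (greedy τ).flatten := by
  rw [outer, List.mem_filter]
  refine and_congr_right fun _ => ?_
  rw [Bool.not_eq_true', ← Bool.not_eq_true, inside_iff]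
  push Not
  rfl

/-- A triangle outside the vertices `W` of a maximal packing consists of an edge inside `W` and an
apex outside. -/
theorem split_spec {τ : List (List ℕ)} (hτ : ∀ x ∈ τ, IsTri x) {x : List ℕ} (hx : x ∈ outer τ) :
    ∃ u v w, split (greedy τ).flatten x = ((u, v), w) ∧ u ≠ v ∧
      (∀ a, a ∈ x ↔ a = u ∨ a = v ∨ a = w) ∧
      w ∉ (greedy τ).flatten ∧ ∃ y ∈ greedy τ, u ∈ y ∧ v ∈ y := by
  obtain ⟨hx, c, hcx, hc⟩ := mem_outer.1 hx
  obtain ⟨y, hy, a, b, hab, ⟨hax, hbx⟩, hay, hby⟩ := exists_shared_pair hτ hx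
  have ha : a ∈ (greedy τ).flatten := List.mem_flatten.2 ⟨y, hy, hay⟩
  have hb : b ∈ (greedy τ).flatten := List.mem_flatten.2 ⟨y, hy, hby⟩
  obtain ⟨hnd, hlen⟩ := hτ x hx
  have hac : a ≠ c := fun h => hc (h ▸ ha)
  have hbc : b ≠ c := fun h => hc (h ▸ hb)
  obtain ⟨x₁, x₂, x₃, rfl⟩ := List.length_eq_three.1 hlen
  simp only [List.mem_cons, List.not_mem_nil, or_false] at hcx hax hbx
  simp only [split]
  -- The vertex `c` is outside `W`, while `a` and `b` are inside; only the six arrangements with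
  -- distinct positions survive.
  rcases hcx with rfl | rfl | rfl <;> rcases hax with rfl | rfl | rfl <;>
    rcases hbx with rfl | rfl | rfl <;>
    (try exact absurd rfl hab) <;> (try exact absurd rfl hac) <;> (try exact absurd rfl hbc)
  all_goals
    simp only [List.filter_cons, List.contains_iff_mem, ha, hb, hc, if_true, if_false,
      List.filter_nil, Bool.not_eq_true', List.headD_cons, List.tail_cons, ← Bool.not_eq_true,
      not_true, not_false_eq_true]
    refine ⟨_, _, _, rfl, ?_, ?_, hc, y, hy, ?_⟩
    · first
      | exact hab
      | exact hab.symm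
    · intro d; simp only [List.mem_cons, List.not_mem_nil, or_false] <;> tauto
    · first
      | exact ⟨hay, hby⟩
      | exact ⟨hby, hay⟩

/-- `12 = 3 + 9`: three vertices for each greedy triangle, and one matched apex for each ordered
pair of vertices of a greedy triangle, since distinct assignments have distinct left ends. -/
theorem length_vertices_kernel {τ : List (List ℕ)} (hτ : ∀ x ∈ τ, IsTri x) :
    (vertices (kernel τ)).length ≤ 12 * (greedy τ).length := by
  have hg : ∀ x ∈ greedy τ, IsTri x := fun x hx => hτ x (mem_greedy hx)
  have inv : AuctionInv (outerPairs τ) (auction (outerPairs τ)) := auctionInv_iterate _ _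
  have h1 : (vertices (kernel τ)).toFinset ⊆
      ((greedy τ).flatten ++ (auction (outerPairs τ)).1.map fun b => b.2).toFinset := by
    intro v hv
    rw [List.mem_toFinset, mem_vertices] at hv
    obtain ⟨x, hx, hv⟩ := hv
    exact List.mem_toFinset.2 (inside_iff.1 (List.mem_filter.1 hx).2 v hv)
  have h2 := (Finset.card_le_card h1).trans (List.toFinset_card_le _)
  rw [List.toFinset_card_of_nodup (nodup_vertices _), List.length_append, List.length_map] at h2
  have h3 : (greedy τ).flatten.length ≤ 3 * (greedy τ).length := by
    rw [List.length_flatten]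
    refine (List.sum_le_card_nsmul _ 3 ?_).trans (by simp [mul_comm])
    simp only [List.mem_map, forall_exists_index, and_imp]
    rintro _ x hx rfl
    exact (hg x hx).2.le
  have h4 : (auction (outerPairs τ)).1.length ≤ 9 * (greedy τ).length := by
    refine le_trans ?_ (card_pairs_le hg)
    rw [← List.length_map (f := fun b : (ℕ × ℕ) × ℕ => b.1), ← List.toFinset_card_of_nodup inv.left]
    refine Finset.card_le_card fun e he => ?_
    obtain ⟨b, hb, rfl⟩ := List.mem_map.1 (List.mem_toFinset.1 he)
    obtain ⟨x, hx, rfl⟩ := List.mem_map.1 (inv.sub b hb)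
    obtain ⟨u, v, w, h, -, -, -, y, hy, hu, hv⟩ := split_spec hτ hx
    rw [h, List.mem_toFinset, List.mem_flatMap]
    exact ⟨y, hy, List.mem_product.2 ⟨hu, hv⟩⟩
  omega

theorem mem_of_mem_kernel {τ : List (List ℕ)} {x : List ℕ} (h : x ∈ kernel τ) : x ∈ τ :=
  List.mem_of_mem_filter h

/-- The kernel has packings as large as the given list of triangles. -/
theorem exists_packing_kernel {τ : List (List ℕ)} (hτ : ∀ x ∈ τ, IsTri x) {P : Finset (List ℕ)}
    (hP : Packing P) (hPτ : ∀ x ∈ P, x ∈ τ) :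
    ∃ P', Packing P' ∧ (∀ x ∈ P', x ∈ kernel τ) ∧ P'.card = P.card := by
  classical
  obtain ⟨O, hO₁, hO₂⟩ := auction_spec (outerPairs τ)
  have inv : AuctionInv (outerPairs τ) (auction (outerPairs τ)) := auctionInv_iterate _ _
  set W := (greedy τ).flatten with hW
  set M := (auction (outerPairs τ)).1 with hM
  -- the triangles to be replaced
  let bad : List ℕ → Prop := fun x => x ∈ outer τ ∧ O (split W x).2
  have hrep : ∀ x, bad x → ∃ y ∈ outer τ, (split W y).1 = (split W x).1 ∧ O (split W y).2 ∧
      split W y ∈ M := by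
    rintro x ⟨hx, hxO⟩
    obtain ⟨m, hm, h1, h2⟩ := hO₂ _ (List.mem_map_of_mem hx) hxO
    obtain ⟨y, hy, rfl⟩ := List.mem_map.1 (inv.sub m hm)
    exact ⟨y, hy, h1, h2, hm⟩
  choose! r hr₁ hr₂ hr₃ hr₄ using hrep
  -- Outer triangles with apex in `O` keep their edge inside `W` and receive the apex matched with
  -- it; all others stay. A triangle that stays has its vertices in `W`, except possibly an apex
  -- outside `O`, which is matched and hence kept.
  let φ : List ℕ → List ℕ := fun x => if bad x then r x else x
  have hφτ : ∀ x ∈ P, φ x ∈ kernel τ := by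
    intro x hx
    by_cases hb : bad x
    · simp only [φ, if_pos hb]
      refine List.mem_filter.2 ⟨(mem_outer.1 (hr₁ x hb)).1, inside_iff.2 fun a ha => ?_⟩
      obtain ⟨u, v, w, h, -, hmem, -, y, hy, hu, hv⟩ := split_spec hτ (hr₁ x hb)
      rw [List.mem_append]
      rcases (hmem a).1 ha with rfl | rfl | rfl
      · exact .inl (List.mem_flatten.2 ⟨y, hy, hu⟩)
      · exact .inl (List.mem_flatten.2 ⟨y, hy, hv⟩)
      · exact .inr (List.mem_map.2 ⟨_, hr₄ x hb, by rw [hW, h]⟩)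
    · simp only [φ, if_neg hb]
      refine List.mem_filter.2 ⟨hPτ x hx, inside_iff.2 fun a ha => ?_⟩
      rw [List.mem_append]
      by_cases ho : x ∈ outer τ
      · obtain ⟨u, v, w, h, -, hmem, -, y, hy, hu, hv⟩ := split_spec hτ ho
        rcases (hmem a).1 ha with rfl | rfl | rfl
        · exact .inl (List.mem_flatten.2 ⟨y, hy, hu⟩)
        · exact .inl (List.mem_flatten.2 ⟨y, hy, hv⟩)
        · have hm := (hO₁ _ (List.mem_map_of_mem ho)).resolve_right fun h => hb ⟨ho, h⟩
          obtain ⟨m, hm, hma⟩ := hm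
          exact .inr (List.mem_map.2 ⟨m, hm, by rw [hma, ← hW, hW, h]⟩)
      · left
        by_contra h
        exact ho (mem_outer.2 ⟨hPτ x hx, a, ha, h⟩)
  -- The images of different members of `P` have no edge in common. This gives both
  -- edge-disjointness and injectivity of `φ`.
  have hkey : ∀ x ∈ P, ∀ y ∈ P, ∀ u v, u ≠ v → u ∈ φ x → v ∈ φ x → u ∈ φ y → v ∈ φ y → x = y := by
    -- A new apex lies in `O` and outside `W`. An unreplaced `y` that contained it would be an outer
    -- triangle with this apex, hence bad. So `r x` meets `y` only in vertices of `x`.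
    have mixed : ∀ x ∈ P, bad x → ∀ y ∈ P, ¬ bad y → ∀ a, a ∈ r x → a ∈ y → a ∈ x := by
      intro x _ hbx y hy hby a hax hay
      obtain ⟨u, v, w, h, -, hmem, hw, -⟩ := split_spec hτ (hr₁ x hbx)
      obtain ⟨u', v', w', h', -, hmem', hw', -⟩ := split_spec hτ hbx.1
      have e := hr₂ x hbx
      rw [hW, h, h'] at e
      simp only [Prod.mk.injEq] at e
      rw [hmem', ← e.1, ← e.2]
      rcases (hmem a).1 hax with rfl | rfl | rfl
      · exact .inl rfl
      · exact .inr (.inl rfl)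
      · exfalso
        have hyo : y ∈ outer τ := mem_outer.2 ⟨hPτ y hy, a, hay, hw⟩
        obtain ⟨u₁, v₁, w₁, h₁, -, hmem₁, -, z, hz, hu, hv⟩ := split_spec hτ hyo
        rcases (hmem₁ a).1 hay with rfl | rfl | rfl
        · exact hw (List.mem_flatten.2 ⟨z, hz, hu⟩)
        · exact hw (List.mem_flatten.2 ⟨z, hz, hv⟩)
        · refine hby ⟨hyo, ?_⟩
          have := hr₃ x hbx
          rw [hW, h] at this
          rw [hW, h₁]
          exact this
    intro x hx y hy u v huv hux hvx huy hvy
    by_cases hbx : bad x <;> by_cases hby : bad y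
    · simp only [φ, if_pos hbx, if_pos hby] at hux hvx huy hvy
      obtain ⟨u₁, v₁, w₁, h₁, -, hmem₁, hw₁, z₁, hz₁, hu₁, hv₁⟩ := split_spec hτ (hr₁ x hbx)
      obtain ⟨u₂, v₂, w₂, h₂, -, hmem₂, hw₂, z₂, hz₂, hu₂, hv₂⟩ := split_spec hτ (hr₁ y hby)
      obtain ⟨u₃, v₃, w₃, h₃, hne₃, hmem₃, -⟩ := split_spec hτ hbx.1
      obtain ⟨u₄, v₄, w₄, h₄, -, hmem₄, -⟩ := split_spec hτ hby.1
      have e₁ := hr₂ x hbx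
      have e₂ := hr₂ y hby
      rw [hW, h₁, h₃] at e₁
      rw [hW, h₂, h₄] at e₂
      simp only [Prod.mk.injEq] at e₁ e₂
      obtain ⟨rfl, rfl⟩ := e₁
      obtain ⟨rfl, rfl⟩ := e₂
      -- If the new apices agree, so do the matched edges, and `x` and `y` share that edge. If they
      -- differ, neither apex is a common vertex, so `r x` and `r y` meet only in vertices common to
      -- `x` and `y`.
      by_cases hw : w₁ = w₂
      · subst hw
        have hm₁ := hr₄ x hbx
        have hm₂ := hr₄ y hby
        rw [hW, h₁] at hm₁
        rw [hW, h₂] at hm₂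
        have := List.inj_on_of_nodup_map inv.right hm₁ hm₂ rfl
        simp only [Prod.mk.injEq] at this
        obtain ⟨⟨rfl, rfl⟩, -⟩ := this
        exact hP.eq hx hy hne₃ ((hmem₃ _).2 (.inl rfl)) ((hmem₃ _).2 (.inr (.inl rfl)))
          ((hmem₄ _).2 (.inl rfl)) ((hmem₄ _).2 (.inr (.inl rfl)))
      · have hout : ∀ a, a ∈ r x → a ∈ r y → a ∈ x ∧ a ∈ y := by
          intro a ha ha'
          have hne₁ : a ≠ w₁ := by
            rintro rfl
            rcases (hmem₂ a).1 ha' with rfl | rfl | h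
            · exact hw₁ (List.mem_flatten.2 ⟨z₂, hz₂, hu₂⟩)
            · exact hw₁ (List.mem_flatten.2 ⟨z₂, hz₂, hv₂⟩)
            · exact hw h
          have hne₂ : a ≠ w₂ := by
            rintro rfl
            rcases (hmem₁ a).1 ha with rfl | rfl | h
            · exact hw₂ (List.mem_flatten.2 ⟨z₁, hz₁, hu₁⟩)
            · exact hw₂ (List.mem_flatten.2 ⟨z₁, hz₁, hv₁⟩)
            · exact hw h.symm
          have := (hmem₁ a).1 ha
          have := (hmem₂ a).1 ha'
          rw [hmem₃, hmem₄]
          tauto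
        exact hP.eq hx hy huv (hout u hux huy).1 (hout v hvx hvy).1 (hout u hux huy).2
          (hout v hvx hvy).2
    · simp only [φ, if_pos hbx, if_neg hby] at hux hvx huy hvy
      exact hP.eq hx hy huv (mixed x hx hbx y hy hby u hux huy) (mixed x hx hbx y hy hby v hvx hvy)
        huy hvy
    · simp only [φ, if_neg hbx, if_pos hby] at hux hvx huy hvy
      exact hP.eq hx hy huv hux hvx (mixed y hy hby x hx hbx u huy hux)
        (mixed y hy hby x hx hbx v hvy hvx)
    · simp only [φ, if_neg hbx, if_neg hby] at hux hvx huy hvy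
      exact hP.eq hx hy huv hux hvx huy hvy
  have htri : ∀ x ∈ P, IsTri (φ x) := fun x hx => hτ _ (mem_of_mem_kernel (hφτ x hx))
  refine ⟨P.image φ, ⟨?_, ?_⟩, ?_, ?_⟩
  · simpa using htri
  · simp only [Finset.mem_image]
    rintro _ ⟨x, hx, rfl⟩ _ ⟨y, hy, rfl⟩ hne
    rw [← Bool.not_eq_true, shares_iff (htri x hx).1]
    rintro ⟨u, v, huv, ⟨h1, h2⟩, h3, h4⟩
    exact hne (congrArg φ (hkey x hx y hy u v huv h1 h2 h3 h4))
  · simpa using hφτ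
  · refine Finset.card_image_of_injOn fun x hx y hy hxy => ?_
    obtain ⟨u, hu, v, hv, huv⟩ := (two_le_length_iff (htri x hx).1).1 (by rw [(htri x hx).2]; omega)
    exact hkey x hx y hy u v huv hu hv (by simpa only [← hxy] using hu)
      (by simpa only [← hxy] using hv)

end TuringKernel

namespace TuringKernel

/-! ### Splitting a graph along a tree decomposition -/

/-- Every proper nonempty part of `A` has an edge to the rest of `A`. -/
def CutConn (E : ℕ → ℕ → Prop) (A : Set ℕ) : Prop :=
  ∀ C : Set ℕ, C ⊆ A → C.Nonempty → C ≠ A → ∃ a ∈ C, ∃ b ∈ A, b ∉ C ∧ E a b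

/-- What is needed of a tree decomposition with nodes `0, …, m - 1`, tree edges `E` and bags `X`. -/
structure Decomp (m : ℕ) (E : ℕ → ℕ → Prop) (X : ℕ → Finset ℕ) : Prop where
  symm : ∀ {a b}, E a b → E b a
  irrefl : ∀ a, ¬ E a a
  lt : ∀ {a b}, E a b → a < m
  whole : CutConn E {t | t < m}
  conn : ∀ v, CutConn E {t | v ∈ X t}
  leaf : ∀ A : Finset ℕ, (∀ t ∈ A, t < m) → CutConn E A → 2 ≤ A.card →
    ∃ t ∈ A, ∃ p ∈ A, E t p ∧ ∀ q ∈ A, E t q → q = p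

section

variable {m : ℕ} {E : ℕ → ℕ → Prop} {X : ℕ → Finset ℕ} {tree : List (List ℕ)}

/-- The search returns some node with exactly one neighbour in `A`. Such a node exists by `h.leaf`,
so the default values of `headD` are never used. -/
theorem leaf_spec (h : Decomp m E X) (htree : ∀ t u, u ∈ tree.getD t [] ↔ E t u)
    (hnd : ∀ t, (tree.getD t []).Nodup) {A : List ℕ} (hA : A.Nodup) (hlt : ∀ t ∈ A, t < m)
    (hconn : CutConn E {t | t ∈ A}) (hlen : 2 ≤ A.length) :
    leaf tree A ∈ A ∧ leafNbr tree A ∈ A ∧ E (leaf tree A) (leafNbr tree A) ∧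
      ∀ q ∈ A, E (leaf tree A) q → q = leafNbr tree A := by
  have hmem : ∀ t u, u ∈ nbrsIn tree A t ↔ E t u ∧ u ∈ A := by
    intro t u
    rw [nbrsIn, List.mem_filter, htree, List.contains_iff_mem]
  obtain ⟨t, ht, p, hp, htp, huniq⟩ := h.leaf A.toFinset (by simpa using hlt) (by simpa using hconn)
    (by rwa [List.toFinset_card_of_nodup hA])
  have ht1 : (nbrsIn tree A t).length = 1 := by
    have hn : (nbrsIn tree A t).Nodup := (hnd t).filter _
    rw [← List.toFinset_card_of_nodup hn, Finset.card_eq_one]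
    refine ⟨p, ?_⟩
    ext q
    rw [List.mem_toFinset, hmem, Finset.mem_singleton]
    refine ⟨fun hq => huniq q (List.mem_toFinset.2 hq.2) hq.1, ?_⟩
    rintro rfl
    exact ⟨htp, List.mem_toFinset.1 hp⟩
  have hl : leaf tree A ∈ A.filter fun t => (nbrsIn tree A t).length == 1 := by
    rw [leaf]
    cases hf : A.filter fun t => (nbrsIn tree A t).length == 1 with
    | nil =>
      have : t ∈ A.filter fun t => (nbrsIn tree A t).length == 1 := by
        simpa [ht1] using ht
      rw [hf] at this; simp at this
    | cons a l => simp
  simp only [List.mem_filter, beq_iff_eq] at hl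
  obtain ⟨p', hp'⟩ := List.length_eq_one_iff.1 hl.2
  have hnbr : leafNbr tree A = p' := by rw [leafNbr, hp']; rfl
  rw [hnbr]
  have h1 : p' ∈ nbrsIn tree A (leaf tree A) := by simp [hp']
  rw [hmem] at h1
  refine ⟨hl.1, h1.2, h1.1, fun q hq hE => ?_⟩
  have : q ∈ nbrsIn tree A (leaf tree A) := (hmem _ _).2 ⟨hE, hq⟩
  simpa [hp'] using this

/-- The invariants of the active nodes `A`, where `own` maps a node to the active node that has
taken it over. -/
structure OwnInv (m : ℕ) (E : ℕ → ℕ → Prop) (X : ℕ → Finset ℕ) (own : ℕ → ℕ) (A : List ℕ) :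
    Prop where
  nodup : A.Nodup
  lt : ∀ t ∈ A, t < m
  conn : CutConn E {t | t ∈ A}
  own_mem : ∀ u < m, own u ∈ A
  own_self : ∀ t ∈ A, own t = t
  edge : ∀ a b, E a b → own a ≠ own b → own a = a ∧ own b = b
  bag : ∀ v u, v ∈ X u → v ∈ X (own u) ∨ ∀ u', v ∈ X u' → own u' = own u

/-- The owners after `t` has been taken over by `p`. -/
def takeOver (t p : ℕ) (own : ℕ → ℕ) (u : ℕ) : ℕ := if own u = t then p else own u

/-- A leaf of the active subtree is contracted into its neighbour. The territories remain such that
tree edges between different ones join the owners themselves, and a vertex whose bags meet several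
territories lies in the bag of the owner of each of them. -/
theorem OwnInv.takeOver (h : Decomp m E X) {own : ℕ → ℕ} {A : List ℕ} (inv : OwnInv m E X own A)
    {t p : ℕ} (ht : t ∈ A) (hp : p ∈ A) (htp : E t p) (huniq : ∀ q ∈ A, E t q → q = p) :
    OwnInv m E X (takeOver t p own) (A.filter fun u => !(u == t)) := by
  have hne : p ≠ t := by rintro rfl; exact h.irrefl _ htp
  have hmem : ∀ u, u ∈ A.filter (fun u => !(u == t)) ↔ u ∈ A ∧ u ≠ t := by
    intro u; simp
  have ho : ∀ u, own u = t → TuringKernel.takeOver t p own u = p := fun u hu => if_pos hu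
  have ho' : ∀ u, own u ≠ t → TuringKernel.takeOver t p own u = own u := fun u hu => if_neg hu
  constructor
  · exact inv.nodup.filter _
  · exact fun u hu => inv.lt u ((hmem u).1 hu).1
  · intro C hC hCne hCA
    simp only [hmem] at hC hCA ⊢
    obtain ⟨b₀, hb₀, hb₀C⟩ : ∃ b, (b ∈ A ∧ b ≠ t) ∧ b ∉ C := by
      by_contra! hcon
      exact hCA (hC.antisymm fun b hb => hcon b hb)
    -- A part of the smaller tree is turned into a part of the old one by adding `t` exactly when it
    -- contains `p`; then the only edge at `t`, the one to `p`, does not cross the cut.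
    by_cases hpC : p ∈ C
    · obtain ⟨a, ha, b, hb, hbC, hE⟩ := inv.conn (insert t C)
        (Set.insert_subset ht fun u hu => (hC hu).1) ⟨t, Set.mem_insert _ _⟩ (by
          intro he
          have : b₀ ∈ insert t C := he ▸ hb₀.1
          exact (Set.mem_insert_iff.1 this).elim hb₀.2 hb₀C)
      rw [Set.mem_insert_iff, not_or] at hbC
      rcases Set.mem_insert_iff.1 ha with rfl | ha
      · exact absurd (huniq b hb hE ▸ hpC) hbC.2
      · exact ⟨a, ha, b, ⟨hb, hbC.1⟩, hbC.2, hE⟩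
    · obtain ⟨a, ha, b, hb, hbC, hE⟩ := inv.conn C (fun u hu => (hC hu).1) hCne (by
          rintro rfl; exact hb₀C hb₀.1)
      refine ⟨a, ha, b, ⟨hb, ?_⟩, hbC, hE⟩
      rintro rfl
      exact hpC (huniq a (hC ha).1 (h.symm hE) ▸ ha)
  · intro u hu
    rw [hmem]
    by_cases hut : own u = t
    · rw [ho u hut]; exact ⟨hp, hne⟩
    · rw [ho' u hut]; exact ⟨inv.own_mem u hu, hut⟩
  · intro u hu
    rw [hmem] at hu
    have := inv.own_self u hu.1
    rw [ho' u (by rw [this]; exact hu.2), this]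
  · intro a b hE hab
    have hab' : own a ≠ own b := fun he => hab (by unfold TuringKernel.takeOver; rw [he])
    obtain ⟨ha, hb⟩ := inv.edge a b hE hab'
    have hbA : b ∈ A := hb ▸ inv.own_mem b (h.lt (h.symm hE))
    have haA : a ∈ A := ha ▸ inv.own_mem a (h.lt hE)
    have hat : a ≠ t := by
      rintro rfl
      have := huniq b hbA hE
      subst this
      exact hab (by rw [ho a ha, ho' b (by rw [hb]; exact hne), hb])
    have hbt : b ≠ t := by
      rintro rfl
      have := huniq a haA (h.symm hE)
      subst this
      exact hab (by rw [ho b hb, ho' a (by rw [ha]; exact hne), ha])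
    exact ⟨(ho' a (by rwa [ha])).trans ha, (ho' b (by rwa [hb])).trans hb⟩
  · intro v u hvu
    have hall : (∀ u', v ∈ X u' → own u' = own u) →
        ∀ u', v ∈ X u' → TuringKernel.takeOver t p own u' = TuringKernel.takeOver t p own u :=
      fun hh u' hu' => by unfold TuringKernel.takeOver; rw [hh u' hu']
    rcases inv.bag v u hvu with hv | hv
    · by_cases hut : own u = t
      · rw [ho u hut]
        by_cases hvp : v ∈ X p
        · exact .inl hvp
        · right
          intro u' hu'
          refine ho u' ?_
          by_contra hu't
          rw [hut] at hv
          -- If some bag with `v` is outside the territory of `t`, a tree edge between bags with `v`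
          -- leaves this territory. Both of its ends are owners, so it is the edge from `t` to `p`,
          -- and `v` is in the bag of `p`.
          obtain ⟨a, ⟨ha, hat⟩, b, hb, hbC, hE⟩ := h.conn v {x | v ∈ X x ∧ own x = t}
            (fun x hx => hx.1) ⟨t, hv, inv.own_self t ht⟩ (by
              intro he
              have : u' ∈ {x | v ∈ X x ∧ own x = t} := he ▸ hu'
              exact hu't this.2)
          have hbt : own b ≠ t := fun hbt => hbC ⟨hb, hbt⟩
          obtain ⟨h1, h2⟩ := inv.edge a b hE (by rw [hat]; exact hbt.symm)
          have hat' : a = t := h1.symm.trans hat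
          subst hat'
          have hbA : b ∈ A := h2 ▸ inv.own_mem b (h.lt (h.symm hE))
          rw [huniq b hbA hE] at hb
          exact hvp hb
      · exact .inl (by rwa [ho' u hut])
    · exact .inr (hall hv)

end

/-! ### Handing over and splitting off triangles -/

theorem mem_cluster {p : ℕ} {D : List (List ℕ × ℕ)} {x : List ℕ} :
    x ∈ cluster p D ↔ (x, p) ∈ D := by
  rw [cluster, List.mem_map]
  constructor
  · rintro ⟨y, hy, rfl⟩
    rw [List.mem_filter, beq_iff_eq] at hy
    rw [← hy.2]; exact hy.1
  · intro h
    exact ⟨(x, p), List.mem_filter.2 ⟨h, by simp⟩, rfl⟩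

theorem mem_handOver {t p q : ℕ} {D : List (List ℕ × ℕ)} {x : List ℕ} :
    (x, q) ∈ handOver t p D ↔ ((x, q) ∈ D ∧ q ≠ t) ∨ ((x, t) ∈ D ∧ q = p) := by
  rw [handOver, List.mem_map]
  constructor
  · rintro ⟨⟨y, s⟩, hy, he⟩
    simp only [Prod.mk.injEq] at he
    obtain ⟨rfl, he⟩ := he
    by_cases hs : s = t
    · subst hs
      simp only [beq_self_eq_true, cond_true] at he
      exact .inr ⟨hy, he.symm⟩
    · rw [beq_false_of_ne hs, cond_false] at he
      subst he
      exact .inl ⟨hy, hs⟩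
  · rintro (⟨h, hq⟩ | ⟨h, rfl⟩)
    · exact ⟨_, h, by simp [beq_false_of_ne hq]⟩
    · exact ⟨_, h, by simp⟩

/-- No triangle from `σ` has an edge in common with one from `τ`. -/
def Apart (σ τ : List (List ℕ)) : Prop := ∀ x ∈ σ, ∀ y ∈ τ, shares x y = false

open Classical in
/-- The invariants of the lists of triangles: `Δ` are all triangles, `K` the size at which pieces
are split off, and `w` bounds the loss for each piece. -/
structure SplitInv (m : ℕ) (X : ℕ → Finset ℕ) (Δ : List (List ℕ)) (K w : ℕ) (own : ℕ → ℕ)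
    (D : List (List ℕ × ℕ)) (out : List (List (List ℕ))) : Prop where
  sub : ∀ y ∈ D, y.1 ∈ Δ
  node : ∀ y ∈ D, ∃ u < m, own u = y.2 ∧ ∀ v ∈ y.1, v ∈ X u
  light : ∀ t, ∀ P, Packing P → (∀ x ∈ P, x ∈ cluster t D) → P.card ≤ 9 * K
  piece : ∀ τ ∈ out, (∀ x ∈ τ, x ∈ Δ) ∧ K ≤ (greedy τ).length ∧ (greedy τ).length ≤ 18 * K
  apart : ∀ τ ∈ out, Apart (D.map fun y => y.1) τ
  apart' : out.Pairwise Apart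
  loss : ∀ P, Packing P → (∀ x ∈ P, x ∈ Δ) → P.card ≤ (P.filter fun x => ∃ y ∈ D, y.1 = x).card +
    (out.map fun τ => (P.filter fun x => x ∈ τ).card + w).sum

section

variable {m : ℕ} {X : ℕ → Finset ℕ} {Δ : List (List ℕ)} {K w : ℕ} {own : ℕ → ℕ}

/-- Only the cluster of `p` grows in a round. If it becomes heavy it is split off, and the loss is
paid by the pairs in the bag of `p`; otherwise its greedy packing is smaller than `K`, so it is
light. -/
theorem SplitInv.prune {E : ℕ → ℕ → Prop} (hΔ : ∀ x ∈ Δ, IsTri x) (hw : ∀ t, (X t).card ^ 2 ≤ w)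
    {D : List (List ℕ × ℕ)} {out : List (List (List ℕ))} {A : List ℕ}
    (inv : SplitInv m X Δ K w own D out) {t p : ℕ} (htp : t ≠ p)
    (hown : OwnInv m E X (TuringKernel.takeOver t p own) A) :
    SplitInv m X Δ K w (TuringKernel.takeOver t p own) (cut K p (handOver t p D, out)).1
      (cut K p (handOver t p D, out)).2 := by
  classical
  set D' := handOver t p D with hD'
  have hmap : ∀ x, (∃ y ∈ D', y.1 = x) ↔ ∃ y ∈ D, y.1 = x := by
    intro x
    have := congrArg (x ∈ ·) (map_fst_handOver t p D)
    simpa [hD'] using this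
  have hsub : ∀ y ∈ D', y.1 ∈ Δ := by
    intro y hy
    obtain ⟨z, hz, hzy⟩ := (hmap y.1).1 ⟨y, hy, rfl⟩
    exact hzy ▸ inv.sub z hz
  have hnode : ∀ y ∈ D', ∃ u < m, TuringKernel.takeOver t p own u = y.2 ∧ ∀ v ∈ y.1, v ∈ X u := by
    rintro ⟨x, q⟩ hy
    rcases mem_handOver.1 hy with ⟨h, hq⟩ | ⟨h, rfl⟩
    · obtain ⟨u, hu, rfl, hX⟩ := inv.node _ h
      exact ⟨u, hu, if_neg hq, hX⟩
    · obtain ⟨u, hu, hut, hX⟩ := inv.node _ h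
      exact ⟨u, hu, if_pos hut, hX⟩
  have hapart : ∀ τ ∈ out, Apart (D'.map fun y => y.1) τ := by
    rw [hD', map_fst_handOver]; exact inv.apart
  have hlight : ∀ q ≠ p, ∀ P, Packing P → (∀ x ∈ P, x ∈ cluster q D') → P.card ≤ 9 * K := by
    intro q hq P hP hPq
    refine inv.light q P hP fun x hx => ?_
    rcases mem_handOver.1 (mem_cluster.1 (hPq x hx)) with h | h
    · exact mem_cluster.2 h.1
    · exact absurd h.2 hq
  -- The cluster of `p` is now the union of two light clusters, that of `t` and the former one of
  -- `p`.
  have hlight' : ∀ P, Packing P → (∀ x ∈ P, x ∈ cluster p D') → P.card ≤ 18 * K := by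
    intro P hP hPp
    have h1 := inv.light t _ (hP.subset (Finset.filter_subset (fun x => x ∈ cluster t D) P))
      (by simp)
    have h2 := inv.light p _ (hP.subset (Finset.filter_subset (fun x => x ∈ cluster p D) P))
      (by simp)
    have h3 : P ⊆ P.filter (fun x => x ∈ cluster t D) ∪ P.filter (fun x => x ∈ cluster p D) := by
      intro x hx
      simp only [Finset.mem_union, Finset.mem_filter, mem_cluster]
      rcases mem_handOver.1 (mem_cluster.1 (hPp x hx)) with h | h
      exacts [.inr ⟨hx, h.1⟩, .inl ⟨hx, h.1⟩]
    have := (Finset.card_le_card h3).trans (Finset.card_union_le _ _)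
    omega
  have hτ : ∀ x ∈ cluster p D', x ∈ Δ := fun x hx => hsub _ (mem_cluster.1 hx)
  have hτtri : ∀ x ∈ cluster p D', IsTri x := fun x hx => hΔ x (hτ x hx)
  unfold cut
  by_cases hK : K ≤ (greedy (cluster p D')).length
  · simp only [Nat.ble_eq_true_of_le hK, cond_true]
    have hmem : ∀ y, y ∈ D'.filter (fun y => !(y.2 == p) &&
        !(cluster p D').any fun x => shares y.1 x) ↔
        y ∈ D' ∧ y.2 ≠ p ∧ ∀ x ∈ cluster p D', shares y.1 x = false := by
      intro y
      simp [List.mem_filter]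
    constructor
    · exact fun y hy => hsub y ((hmem y).1 hy).1
    · exact fun y hy => hnode y ((hmem y).1 hy).1
    · intro q P hP hPq
      by_cases hq : q = p
      · subst hq
        have : P = ∅ := by
          rw [Finset.eq_empty_iff_forall_notMem]
          intro x hx
          exact ((hmem _).1 (mem_cluster.1 (hPq x hx))).2.1 rfl
        simp [this]
      · exact hlight q hq P hP fun x hx =>
          mem_cluster.2 ((hmem _).1 (mem_cluster.1 (hPq x hx))).1
    · intro τ hτ'
      rcases List.mem_cons.1 hτ' with rfl | hτ'
      · obtain ⟨h1, h2⟩ := packing_greedy hτtri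
        refine ⟨hτ, hK, ?_⟩
        rw [← h2]
        exact hlight' _ h1 fun x hx => mem_greedy (List.mem_toFinset.1 hx)
      · exact inv.piece τ hτ'
    · intro τ hτ' x hx z hz
      obtain ⟨y, hy, rfl⟩ := List.mem_map.1 hx
      rw [hmem] at hy
      rcases List.mem_cons.1 hτ' with rfl | hτ'
      · exact hy.2.2 z hz
      · exact hapart τ hτ' _ (List.mem_map_of_mem hy.1) z hz
    · rw [List.pairwise_cons]
      refine ⟨fun τ hτ' x hx z hz => ?_, inv.apart'⟩
      exact hapart τ hτ' x (List.mem_map.2 ⟨_, mem_cluster.1 hx, rfl⟩) z hz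
    · intro P hP hPΔ
      have h1 := inv.loss P hP hPΔ
      rw [List.map_cons, List.sum_cons]
      simp only [← hmap] at h1
      -- `R` is the part of `P` that is lost: triangles held elsewhere that share an edge with the
      -- new piece.
      set R := P.filter fun x => ∃ y ∈ D', y.1 = x ∧ y.2 ≠ p ∧
        ∃ z ∈ cluster p D', shares y.1 z = true with hR
      have hRw : R.card ≤ w := by
        refine ((hP.subset (Finset.filter_subset _ _)).card_le (X p ×ˢ X p) fun x hx => ?_).trans
          (by rw [Finset.card_product, ← sq]; exact hw p)
        obtain ⟨hxP, y, hy, rfl, hyp, z, hz, hs⟩ := Finset.mem_filter.1 hx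
        obtain ⟨u, v, huv, hxy, hzu, hzv⟩ := (shares_iff (hΔ _ (hsub y hy)).1).1 hs
        obtain ⟨a, -, hay, haX⟩ := hnode y hy
        obtain ⟨b, -, hbz, hbX⟩ := hnode _ (mem_cluster.1 hz)
        -- A common vertex lies in bags owned by `p` and in bags with another owner, so by the
        -- invariant `bag` it lies in the bag of `p`.
        have key : ∀ c, c ∈ y.1 → c ∈ z → c ∈ X p := by
          intro c hcy hcz
          rcases hown.bag c b (hbX c hcz) with h | h
          · rwa [hbz] at h
          · have := h a (haX c hcy)
            rw [hay, hbz] at this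
            exact absurd this hyp
        exact ⟨u, v, huv, hxy, Finset.mem_product.2 ⟨key u hxy.1 hzu, key v hxy.2 hzv⟩⟩
      have hcov : (P.filter fun x => ∃ y ∈ D', y.1 = x) ⊆
          (P.filter fun x => ∃ y ∈ D'.filter (fun y => !(y.2 == p) &&
            !(cluster p D').any fun x => shares y.1 x), y.1 = x) ∪
          (P.filter fun x => x ∈ cluster p D') ∪ R := by
        intro x hx
        obtain ⟨hxP, y, hy, rfl⟩ := Finset.mem_filter.1 hx
        simp only [Finset.mem_union, Finset.mem_filter, hmem, hR]
        by_cases hyp : y.2 = p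
        · exact .inl (.inr ⟨hxP, mem_cluster.2 (hyp ▸ hy)⟩)
        · by_cases hs : ∃ z ∈ cluster p D', shares y.1 z = true
          · exact .inr ⟨hxP, y, hy, rfl, hyp, hs⟩
          · push Not at hs
            exact .inl (.inl ⟨hxP, y, ⟨hy, hyp, fun x hx => by simpa using hs x hx⟩, rfl⟩)
      have h2 := Finset.card_le_card hcov
      have h3 := Finset.card_union_le ((P.filter fun x => ∃ y ∈ D'.filter (fun y => !(y.2 == p) &&
            !(cluster p D').any fun x => shares y.1 x), y.1 = x) ∪
          (P.filter fun x => x ∈ cluster p D')) R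
      have h4 := Finset.card_union_le (P.filter fun x => ∃ y ∈ D'.filter (fun y => !(y.2 == p) &&
            !(cluster p D').any fun x => shares y.1 x), y.1 = x)
          (P.filter fun x => x ∈ cluster p D')
      have h5 := h1.trans (Nat.add_le_add_right ((h2.trans h3).trans (Nat.add_le_add h4 hRw)) _)
      refine h5.trans (le_of_eq ?_)
      rw [add_assoc, add_assoc, ← add_assoc (Finset.card _) w]
      congr!
  · have hb : Nat.ble K (greedy (cluster p D')).length = false := by
      rw [← Bool.not_eq_true, Nat.ble_eq]; exact hK
    simp only [hb, cond_false]
    refine ⟨hsub, hnode, fun q P hP hPq => ?_, inv.piece, hapart, inv.apart', fun P hP hPΔ => ?_⟩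
    · by_cases hq : q = p
      · subst hq
        have := hP.card_le_greedy hτtri hPq
        omega
      · exact hlight q hq P hP hPq
    · simpa only [hmap] using inv.loss P hP hPΔ

end

/-- By the hypothesis the filtered list is nonempty, so the default value 0 is not used. -/
theorem exists_home {bags : List (List ℕ)} {x : List ℕ}
    (h : ∃ t < bags.length, ∀ v ∈ x, v ∈ bags.getD t []) :
    home bags x < bags.length ∧ ∀ v ∈ x, v ∈ bags.getD (home bags x) [] := by
  have hl : home bags x ∈ (List.range bags.length).filter fun t => inside (bags.getD t []) x := by
    rw [home]
    cases hf : (List.range bags.length).filter fun t => inside (bags.getD t []) x with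
    | nil =>
      obtain ⟨t, ht, hx⟩ := h
      have : t ∈ (List.range bags.length).filter fun t => inside (bags.getD t []) x :=
        List.mem_filter.2 ⟨List.mem_range.2 ht, inside_iff.2 hx⟩
      rw [hf] at this; simp at this
    | cons a l => simp
  rw [List.mem_filter, List.mem_range, inside_iff] at hl
  exact hl

/-- The properties of the pieces into which a graph is split. -/
theorem pieces_spec {E : ℕ → ℕ → Prop} {adj tree bags : List (List ℕ)} {N K w : ℕ}
    (h : Decomp bags.length E fun t => (bags.getD t []).toFinset)
    (htree : ∀ t u, u ∈ tree.getD t [] ↔ E t u) (hnd : ∀ t, (tree.getD t []).Nodup)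
    (hΔ : ∀ x ∈ triangles adj, IsTri x)
    (hbag : ∀ x ∈ triangles adj, ∃ t < bags.length, ∀ v ∈ x, v ∈ bags.getD t [])
    (hw : ∀ t, (bags.getD t []).toFinset.card ^ 2 ≤ w) (hwK : N * w ≤ K) (hN : 1 ≤ N) :
    (∀ τ ∈ pieces adj tree bags K, (∀ x ∈ τ, x ∈ triangles adj) ∧ (greedy τ).length ≤ 18 * K) ∧
    (pieces adj tree bags K).Pairwise Apart ∧
    ∀ (ν : List (List ℕ) → ℕ), (∀ τ ∈ pieces adj tree bags K, ∀ P, Packing P → (∀ x ∈ P, x ∈ τ) →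
      P.card ≤ ν τ) → ∀ P, Packing P → (∀ x ∈ P, x ∈ triangles adj) →
        N * P.card ≤ (N + 1) * ((pieces adj tree bags K).map ν).sum := by
  classical
  set X : ℕ → Finset ℕ := fun t => (bags.getD t []).toFinset
  set m := bags.length
  -- After `i` rounds exactly `m - i` nodes are active; a leaf can be removed as long as there are
  -- two of them.
  have main : ∀ i, i + 1 ≤ m → ∃ own,
      OwnInv m E X own (pruned adj tree bags K i).1 ∧
      (pruned adj tree bags K i).1.length + i = m ∧
      SplitInv m X (triangles adj) K w own (pruned adj tree bags K i).2.1
        (pruned adj tree bags K i).2.2 := by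
    intro i
    induction i with
    | zero =>
      intro hi
      refine ⟨id, ⟨List.nodup_range, by simp [pruned, m], ?_, by simp [pruned, m], by simp, by simp,
        fun v u hv => .inl hv⟩, by simp [pruned, m], ?_⟩
      · simpa [pruned] using h.whole
      · have hmem : ∀ y ∈ homes adj bags, y.1 ∈ triangles adj ∧ y.2 = home bags y.1 := by
          intro y hy
          obtain ⟨x, hx, rfl⟩ := List.mem_map.1 hy
          exact ⟨hx, rfl⟩
        refine ⟨fun y hy => (hmem y hy).1, fun y hy => ?_, fun t P hP hPt => ?_, by simp [pruned],
          by simp [pruned], by simp [pruned], fun P _ hPΔ => ?_⟩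
        · obtain ⟨h1, h2⟩ := hmem y hy
          obtain ⟨h3, h4⟩ := exists_home (hbag y.1 h1)
          exact ⟨y.2, h2 ▸ h3, rfl, fun v hv => by simpa [X, h2] using h4 v hv⟩
        · have h1 : P.card ≤ w := by
            refine (hP.card_le (X t ×ˢ X t) fun x hx => ?_).trans
              (by rw [Finset.card_product, ← sq]; exact hw t)
            obtain ⟨h1, h2⟩ := hmem _ (mem_cluster.1 (hPt x hx))
            obtain ⟨h3, h4⟩ := exists_home (hbag _ h1)
            obtain ⟨u, hu, v, hv, huv⟩ := (two_le_length_iff (hP.1 x hx).1).1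
              (by rw [(hP.1 x hx).2]; omega)
            dsimp only at h2 h4
            rw [← h2] at h4
            exact ⟨u, v, huv, ⟨hu, hv⟩, Finset.mem_product.2
              ⟨List.mem_toFinset.2 (h4 u hu), List.mem_toFinset.2 (h4 v hv)⟩⟩
          have h2 : w ≤ N * w := Nat.le_mul_of_pos_left _ hN
          omega
        · have : (P.filter fun x => ∃ y ∈ homes adj bags, y.1 = x) = P := by
            rw [Finset.filter_eq_self]
            exact fun x hx => ⟨_, List.mem_map_of_mem (hPΔ x hx), rfl⟩
          have h0 : P.card ≤ (P.filter fun x => ∃ y ∈ homes adj bags, y.1 = x).card := by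
            rw [this]
          simpa [pruned] using h0
    | succ i ih =>
      intro hi
      obtain ⟨own, ho, hlen, hs⟩ := ih (by omega)
      have hstep : pruned adj tree bags K (i + 1) = prune tree K (pruned adj tree bags K i) :=
        Function.iterate_succ_apply' _ _ _
      rw [hstep]
      generalize pruned adj tree bags K i = s at ho hlen hs
      obtain ⟨h1, h2, h3, h4⟩ := leaf_spec h htree hnd ho.nodup ho.lt ho.conn (by omega)
      have ho' := ho.takeOver h h1 h2 h3 h4
      refine ⟨_, ho', ?_, hs.prune hΔ hw ?_ ho'⟩
      · have : (s.1.filter fun u => !(u == leaf tree s.1)) = s.1.erase (leaf tree s.1) := by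
          rw [ho.nodup.erase_eq_filter]; rfl
        simp only [prune]
        rw [this, List.length_erase_of_mem h1]
        omega
      · intro he
        rw [← he] at h3
        exact h.irrefl _ h3
  -- Without nodes there are no triangles; `m - 1` is then 0, no round takes place, and the only
  -- piece is empty.
  have hm : 1 ≤ m ∨ m = 0 := by omega
  rcases hm with hm | hm
  swap
  · have hΔ0 : triangles adj = [] := by
      rw [List.eq_nil_iff_forall_not_mem]
      intro x hx
      obtain ⟨t, ht, -⟩ := hbag x hx
      omega
    have hp : pieces adj tree bags K = [[]] := by
      have : bags.length = 0 := hm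
      simp [pieces, pruned, this, homes, hΔ0]
    rw [hp, hΔ0]
    refine ⟨by simp [greedy, greedyBy], by simp, fun ν _ P _ hP => ?_⟩
    have : P = ∅ := Finset.eq_empty_iff_forall_notMem.2 fun x hx => by simpa using hP x hx
    simp [this]
  obtain ⟨own, ho, hlen, hs⟩ := main (m - 1) (by omega)
  have hp : pieces adj tree bags K = (pruned adj tree bags K (m - 1)).2.1.map (fun y => y.1) ::
    (pruned adj tree bags K (m - 1)).2.2 := rfl
  rw [hp]
  generalize pruned adj tree bags K (m - 1) = s at ho hlen hs
  obtain ⟨r, hr⟩ := List.length_eq_one_iff.1 (show s.1.length = 1 by omega)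
  -- The single remaining node owns every node, so all remaining triangles form one light cluster.
  -- They are the last piece, which costs nothing.
  have hcl : ∀ x ∈ s.2.1.map (fun y => y.1), x ∈ cluster r s.2.1 := by
    intro x hx
    obtain ⟨y, hy, rfl⟩ := List.mem_map.1 hx
    obtain ⟨u, hu, huy, -⟩ := hs.node y hy
    have := ho.own_mem u hu
    rw [hr, List.mem_singleton, huy] at this
    exact mem_cluster.2 (this ▸ hy)
  have hsub : ∀ x ∈ s.2.1.map (fun y => y.1), x ∈ triangles adj := by
    intro x hx
    obtain ⟨y, hy, rfl⟩ := List.mem_map.1 hx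
    exact hs.sub y hy
  refine ⟨fun τ hτ => ?_, List.pairwise_cons.2 ⟨hs.apart, hs.apart'⟩, fun ν hν P hP hPΔ => ?_⟩
  · rcases List.mem_cons.1 hτ with rfl | hτ
    · refine ⟨hsub, ?_⟩
      obtain ⟨h1, h2⟩ := packing_greedy fun x hx => hΔ x (hsub x hx)
      rw [← h2]
      exact (hs.light r _ h1 fun x hx => hcl x (mem_greedy (List.mem_toFinset.1 hx))).trans
        (by omega)
    · exact ⟨(hs.piece τ hτ).1, (hs.piece τ hτ).2.2⟩
  · rw [List.map_cons, List.sum_cons]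
    have h1 := hs.loss P hP hPΔ
    have h2 := hν _ List.mem_cons_self (P.filter fun x => ∃ y ∈ s.2.1, y.1 = x)
      (hP.subset (Finset.filter_subset _ _)) (fun x hx => by simpa using (Finset.mem_filter.1 hx).2)
    -- Each piece split off pays for its own loss: `N * w ≤ K`, and `K` is at most the size of its
    -- greedy packing, hence at most `ν τ`.
    have h3 : ∀ out : List (List (List ℕ)), (∀ τ ∈ out, τ ∈ s.2.2) →
        N * (out.map fun τ => (P.filter fun x => x ∈ τ).card + w).sum ≤
          (N + 1) * (out.map ν).sum := by
      intro out
      induction out with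
      | nil => simp
      | cons τ out ih =>
        intro hout
        have k1 := ih fun σ hσ => hout σ (List.mem_cons_of_mem _ hσ)
        have hτ := hout τ List.mem_cons_self
        have k2 := hν τ (List.mem_cons_of_mem _ hτ) _
          (hP.subset (Finset.filter_subset (fun x => x ∈ τ) P))
          (fun x hx => (Finset.mem_filter.1 hx).2)
        have k3 := hs.piece τ hτ
        obtain ⟨k4, k5⟩ := packing_greedy fun x hx => hΔ x (k3.1 x hx)
        have k6 := hν τ (List.mem_cons_of_mem _ hτ) _ k4
          (fun x hx => mem_greedy (List.mem_toFinset.1 hx))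
        simp only [List.map_cons, List.sum_cons]
        have k7 := Nat.mul_le_mul_left N k2
        have k8 : N * w ≤ ν τ := by omega
        linarith
    have h4 := h3 s.2.2 fun _ => id
    have h5 := Nat.mul_le_mul_left N h1
    have h6 := Nat.mul_le_mul_left N h2
    rw [mul_add] at h5
    rw [mul_add (N + 1), add_mul N 1 (ν _)]
    omega

end TuringKernel

namespace TuringKernel
open Enc (enc)

/-! ### Tree decompositions -/

section Tree

variable {V : Type} {T : SimpleGraph V}

theorem exists_walk_of_induce {S : Set V} (h : (T.induce S).Connected) {a b : V} (ha : a ∈ S)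
    (hb : b ∈ S) : ∃ w : T.Walk a b, ∀ x ∈ w.support, x ∈ S := by
  obtain ⟨w⟩ := h.preconnected ⟨a, ha⟩ ⟨b, hb⟩
  refine ⟨w.map (SimpleGraph.Embedding.induce S).toHom, fun x hx => ?_⟩
  have hmap := SimpleGraph.Walk.support_map (SimpleGraph.Embedding.induce S).toHom w
  obtain ⟨y, -, rfl⟩ := List.mem_map.1 ((congrArg (x ∈ ·) hmap).mp hx)
  exact y.2

/-- The first vertex of the walk in `C` is either the start, which is in `B`, or the end of an edge
that starts outside `C` and therefore lies within `B`. -/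
theorem exists_mem_inter_of_walk {B C : Set V} {u v : V} (w : T.Walk u v) (hu : u ∈ B) (hv : v ∈ C)
    (h : ∀ x y, s(x, y) ∈ w.edges → (x ∈ B ∧ y ∈ B) ∨ (x ∈ C ∧ y ∈ C)) :
    ∃ x ∈ w.support, x ∈ B ∧ x ∈ C := by
  induction w with
  | nil => exact ⟨_, by simp, hu, hv⟩
  | @cons a b c hab p ih =>
    by_cases ha : a ∈ C
    · exact ⟨a, by simp, hu, ha⟩
    · have h1 := h a b (by simp)
      obtain ⟨x, hx, hx'⟩ := ih (h1.elim (fun h => h.2) fun h => absurd h.1 ha) hv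
        fun x y hxy => h x y (by simp [hxy])
      exact ⟨x, by simp [hx], hx'⟩

/-- Three subtrees that intersect pairwise have a common node. -/
theorem exists_mem_three (hT : T.IsTree) {A B C : Set V} (hA : (T.induce A).Connected)
    (hB : (T.induce B).Connected) (hC : (T.induce C).Connected) {p q r : V} (hpA : p ∈ A)
    (hpB : p ∈ B) (hqB : q ∈ B) (hqC : q ∈ C) (hrA : r ∈ A) (hrC : r ∈ C) :
    ∃ x, x ∈ A ∧ x ∈ B ∧ x ∈ C := by
  classical
  obtain ⟨a, ha⟩ := exists_walk_of_induce hA hpA hrA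
  obtain ⟨b, hb⟩ := exists_walk_of_induce hB hpB hqB
  obtain ⟨c, hc⟩ := exists_walk_of_induce hC hqC hrC
  -- Paths in a tree are unique: the path from `p` to `r` obtained inside `A` is also a shortcut of
  -- the detour through `B` and `C`, so each of its edges lies within `B` or within `C`.
  have heq : a.toPath = (b.append c).toPath := (hT.isAcyclic.subsingleton_path p r).elim _ _
  have heq' : a.bypass = (b.append c).bypass := congrArg Subtype.val heq
  obtain ⟨x, hx, hxB, hxC⟩ := exists_mem_inter_of_walk a.bypass hpB hrC (B := B) (C := C) (by
    intro x y hxy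
    rw [heq'] at hxy
    have := SimpleGraph.Walk.edges_bypass_subset_edges _ hxy
    rw [SimpleGraph.Walk.edges_append, List.mem_append] at this
    rcases this with h | h
    · exact .inl ⟨hb _ (b.fst_mem_support_of_mem_edges h), hb _ (b.snd_mem_support_of_mem_edges h)⟩
    · exact .inr ⟨hc _ (c.fst_mem_support_of_mem_edges h), hc _ (c.snd_mem_support_of_mem_edges h)⟩)
  exact ⟨x, ha x (SimpleGraph.Walk.support_bypass_subset_support a hx), hxB, hxC⟩

end Tree

/-! ### Instances as lists of numbers -/

/-- Adjacency of the vertices with the numbers `i` and `j`. -/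
def AdjN {n : ℕ} (G : SimpleGraph (Fin n)) (i j : ℕ) : Prop :=
  ∃ (hi : i < n) (hj : j < n), G.Adj ⟨i, hi⟩ ⟨j, hj⟩

theorem AdjN.symm {n : ℕ} {G : SimpleGraph (Fin n)} {i j : ℕ} (h : AdjN G i j) : AdjN G j i := by
  obtain ⟨hi, hj, h⟩ := h
  exact ⟨hj, hi, h.symm⟩

open Classical in
/-- The increasing list of the members of a set. -/
noncomputable def setList {n : ℕ} (s : Set (Fin n)) : List ℕ :=
  ((List.finRange n).filter fun v => decide (v ∈ s)).map fun v : Fin n => v.val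

/-- The list of the neighbourhoods of a graph. -/
noncomputable def adjList {n : ℕ} (G : SimpleGraph (Fin n)) : List (List ℕ) :=
  (List.finRange n).map fun v => setList (G.neighborSet v)

/-- The list of the bags. -/
noncomputable def TDGraph.bagList (I : TDGraph) : List (List ℕ) :=
  (List.finRange I.m).map fun t => setList (I.bag t : Set (Fin I.n))

theorem enc_setList {n : ℕ} (s : Set (Fin n)) : enc (setList s) = encSet s := by
  simp only [setList, encSet, enc, List.map_map]; rfl

theorem enc_adjList {n : ℕ} (G : SimpleGraph (Fin n)) : enc (adjList G) = encGraph G := by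
  unfold adjList encGraph
  change Data.ofList (List.map enc _) = _
  rw [List.map_map]
  congr 2
  funext v
  exact enc_setList _

theorem enc_input (I : TDGraph) :
    ETP.input I = enc ((adjList I.G, adjList I.T, I.bagList), I.width) := by
  rw [enc_pair, enc_pair, enc_pair, enc_adjList, enc_adjList]
  unfold ParamMaxProblem.input
  change Data.cons (I.enc) (Data.ofNat I.width) = _
  unfold TDGraph.enc TDGraph.bagList
  congr 3
  change _ = Data.ofList (List.map enc _)
  rw [List.map_map]
  congr 2
  funext t
  exact (enc_setList _).symm

theorem mem_setList {n : ℕ} {s : Set (Fin n)} {i : ℕ} : i ∈ setList s ↔ ∃ h : i < n, ⟨i, h⟩ ∈ s := by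
  simp only [setList, List.mem_map, List.mem_filter, List.mem_finRange, true_and, decide_eq_true_eq]
  constructor
  · rintro ⟨v, hv, rfl⟩; exact ⟨v.2, hv⟩
  · rintro ⟨h, hi⟩; exact ⟨_, hi, rfl⟩

theorem nodup_setList {n : ℕ} (s : Set (Fin n)) : (setList s).Nodup :=
  ((List.nodup_finRange n).filter _).map Fin.val_injective

theorem getD_map_finRange {n : ℕ} {α : Type} (f : Fin n → α) (d : α) (i : ℕ) :
    ((List.finRange n).map f).getD i d = if h : i < n then f ⟨i, h⟩ else d := by
  rw [List.getD_eq_getElem?_getD, List.getElem?_map]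
  split_ifs with h
  · rw [List.getElem?_eq_getElem (by simpa using h)]; simp
  · rw [List.getElem?_eq_none (by simpa using h)]; simp

theorem mem_adjList {n : ℕ} {G : SimpleGraph (Fin n)} {i j : ℕ} :
    j ∈ (adjList G).getD i [] ↔ AdjN G i j := by
  rw [adjList, getD_map_finRange]
  split_ifs with h
  · rw [mem_setList]; simp [AdjN, h]
  · simp [AdjN, h]

theorem nodup_adjList {n : ℕ} (G : SimpleGraph (Fin n)) (i : ℕ) : ((adjList G).getD i []).Nodup := by
  rw [adjList, getD_map_finRange]
  split_ifs
  exacts [nodup_setList _, List.nodup_nil]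

theorem mem_bagList {I : TDGraph} {t v : ℕ} :
    v ∈ I.bagList.getD t [] ↔ ∃ (ht : t < I.m) (hv : v < I.n), ⟨v, hv⟩ ∈ I.bag ⟨t, ht⟩ := by
  rw [TDGraph.bagList, getD_map_finRange]
  split_ifs with h
  · rw [mem_setList]; simp [h]
  · simp [h]

theorem length_bagList (I : TDGraph) : I.bagList.length = I.m := by simp [TDGraph.bagList]

theorem card_bag_le (I : TDGraph) (t : Fin I.m) : (I.bag t).card ≤ I.width + 1 := by
  have : (I.bag t).card ≤ Finset.univ.sup fun t => (I.bag t).card :=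
    Finset.le_sup (f := fun t => (I.bag t).card) (Finset.mem_univ t)
  unfold TDGraph.width
  omega

theorem card_bagList_le (I : TDGraph) (t : ℕ) :
    (I.bagList.getD t []).toFinset.card ≤ I.width + 1 := by
  refine (List.toFinset_card_le _).trans ?_
  rw [TDGraph.bagList, getD_map_finRange]
  split_ifs with h
  · refine le_trans (le_of_eq ?_) (card_bag_le I ⟨t, h⟩)
    rw [← List.toFinset_card_of_nodup (nodup_setList _), ← Finset.card_map Fin.valEmbedding]
    congr 1
    ext i
    rw [List.mem_toFinset, mem_setList, Finset.mem_map]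
    constructor
    · rintro ⟨hi, h⟩; exact ⟨_, h, rfl⟩
    · rintro ⟨a, ha, rfl⟩; exact ⟨a.2, ha⟩
  · simp

/-- A walk inside `S` from the part `C` to a point of `S` outside `C` must cross the boundary of
`C`. -/
theorem cutConn_of_walks {m : ℕ} {T : SimpleGraph (Fin m)} {S : Set (Fin m)}
    (h : ∀ a ∈ S, ∀ b ∈ S, ∃ w : T.Walk a b, ∀ x ∈ w.support, x ∈ S) :
    CutConn (AdjN T) {t | ∃ ht : t < m, ⟨t, ht⟩ ∈ S} := by
  intro C hC hne hCS
  obtain ⟨a, ha⟩ := hne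
  obtain ⟨b, hb, hbC⟩ : ∃ b ∈ {t | ∃ ht : t < m, (⟨t, ht⟩ : Fin m) ∈ S}, b ∉ C := by
    by_contra! hcon
    exact hCS (hC.antisymm hcon)
  obtain ⟨ha', haS⟩ := hC ha
  obtain ⟨hb', hbS⟩ := hb
  obtain ⟨w, hw⟩ := h _ haS _ hbS
  obtain ⟨d, hd, h1, h2⟩ := w.exists_boundary_dart {x | x.val ∈ C} ha hbC
  exact ⟨d.fst, h1, d.snd, ⟨d.snd.2, hw _ (w.dart_snd_mem_support_of_mem_darts hd)⟩, h2,
    d.fst.2, d.snd.2, d.adj⟩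

theorem exists_leaf {m : ℕ} {T : SimpleGraph (Fin m)} (hT : T.IsAcyclic) (A : Finset ℕ)
    (hlt : ∀ t ∈ A, t < m) (hconn : CutConn (AdjN T) A) (hcard : 2 ≤ A.card) :
    ∃ t ∈ A, ∃ p ∈ A, AdjN T t p ∧ ∀ q ∈ A, AdjN T t q → q = p := by
  classical
  let S : Set (Fin m) := {t | t.val ∈ A}
  -- If `v` were not reachable from `u` within `A`, the nodes reachable from `u` would be a proper
  -- part of `A` without an edge to the rest. Thus `A` induces a tree, and a tree with two nodes has
  -- a node of degree one.
  have hpre : (T.induce S).Preconnected := by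
    intro u v
    by_contra huv
    let C : Set ℕ := {t | ∃ (ht : t < m) (hS : (⟨t, ht⟩ : Fin m) ∈ S),
      (T.induce S).Reachable u ⟨⟨t, ht⟩, hS⟩}
    have hCA : C ⊆ A := by rintro t ⟨ht, hS, -⟩; exact hS
    obtain ⟨a, ⟨ha, haS, hua⟩, b, hb, hbC, ha', hb', hab⟩ := hconn C hCA
      ⟨u.1.1, u.1.2, u.2, SimpleGraph.Reachable.refl _⟩ (by
        intro he
        have : v.1.1 ∈ C := by rw [he]; exact v.2
        obtain ⟨_, _, h⟩ := this
        exact huv h)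
    refine hbC ⟨hb', hb, hua.trans ?_⟩
    exact SimpleGraph.Adj.reachable (by simpa using hab)
  obtain ⟨a, ha, b, hb, hab⟩ := Finset.one_lt_card.1 hcard
  have : Nontrivial S := ⟨⟨⟨a, hlt a ha⟩, ha⟩, ⟨⟨b, hlt b hb⟩, hb⟩, by simpa using hab⟩
  have htree : (T.induce S).IsTree := ⟨⟨hpre⟩, hT.induce S⟩
  obtain ⟨t, ht⟩ := htree.exists_vert_degree_one_of_nontrivial
  obtain ⟨p, hp, huniq⟩ := SimpleGraph.degree_eq_one_iff_existsUnique_adj.1 ht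
  refine ⟨t.1.1, t.2, p.1.1, p.2, ⟨t.1.2, p.1.2, by simpa using hp⟩, ?_⟩
  rintro q hq ⟨h1, h2, h3⟩
  have := huniq ⟨⟨q, h2⟩, hq⟩ (by simpa using h3)
  exact congrArg (fun x => x.1.1) this

theorem TDGraph.decomp (I : TDGraph) :
    Decomp I.bagList.length (AdjN I.T) fun t => (I.bagList.getD t []).toFinset := by
  rw [length_bagList]
  refine ⟨AdjN.symm, ?_, ?_, ?_, ?_, ?_⟩
  · rintro a ⟨h, h', hadj⟩
    exact I.T.loopless.irrefl _ hadj
  · rintro a b ⟨h, -⟩; exact h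
  · have := cutConn_of_walks (T := I.T) (S := Set.univ) fun a _ b _ =>
      ⟨(I.isTree.connected.preconnected a b).some, fun _ _ => Set.mem_univ _⟩
    simpa using this
  · intro v
    by_cases hv : v < I.n
    · have := cutConn_of_walks (T := I.T) (S := {t | ⟨v, hv⟩ ∈ I.bag t}) fun a ha b hb =>
        exists_walk_of_induce (I.connected ⟨v, hv⟩) ha hb
      convert this using 1
      ext t
      simp only [Set.mem_ofPred_eq, List.mem_toFinset, mem_bagList, hv, exists_true_left]
    -- A number `v` that is not a vertex lies in no bag, and the empty set of nodes has no nonempty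
    -- part.
    · rintro C hC ⟨t, ht⟩ -
      have := hC ht
      simp only [Set.mem_ofPred_eq, List.mem_toFinset, mem_bagList] at this
      obtain ⟨-, h, -⟩ := this
      exact absurd h hv
  · exact fun A => exists_leaf I.isTree.isAcyclic A

theorem mem_triangles {n : ℕ} {G : SimpleGraph (Fin n)} {x : List ℕ} :
    x ∈ triangles (adjList G) ↔ ∃ a b c, x = [a, b, c] ∧ a < b ∧ b < c ∧ AdjN G a b ∧ AdjN G b c ∧
      AdjN G a c := by
  simp only [triangles, List.mem_flatMap, List.mem_map, List.mem_filter, mem_adjList, List.mem_range,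
    Bool.and_eq_true, Nat.ble_eq, List.contains_iff_mem]
  constructor
  · rintro ⟨a, -, b, hab, c, ⟨hbc, h1, h2, hac⟩, rfl⟩
    exact ⟨a, b, c, rfl, h1, h2, hab, hbc, hac⟩
  · rintro ⟨a, b, c, rfl, h1, h2, hab, hbc, hac⟩
    exact ⟨a, by simpa [adjList] using hab.1, b, hab, c, ⟨hbc, h1, h2, hac⟩, rfl⟩

theorem isTri_of_mem_triangles {n : ℕ} {G : SimpleGraph (Fin n)} {x : List ℕ}
    (hx : x ∈ triangles (adjList G)) : IsTri x := by
  obtain ⟨a, b, c, rfl, h1, h2, -⟩ := mem_triangles.1 hx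
  refine ⟨?_, rfl⟩
  simp only [List.nodup_cons, List.mem_cons, List.not_mem_nil, or_false, not_or, not_false_eq_true,
    List.nodup_nil, and_true]
  omega

theorem adjN_of_mem_triangles {n : ℕ} {G : SimpleGraph (Fin n)} {x : List ℕ}
    (hx : x ∈ triangles (adjList G)) {u v : ℕ} (hu : u ∈ x) (hv : v ∈ x) (huv : u ≠ v) :
    AdjN G u v := by
  obtain ⟨a, b, c, rfl, -, -, hab, hbc, hac⟩ := mem_triangles.1 hx
  simp only [List.mem_cons, List.not_mem_nil, or_false] at hu hv
  rcases hu with rfl | rfl | rfl <;> rcases hv with rfl | rfl | rfl <;>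
    first
    | exact absurd rfl huv
    | assumption
    | exact AdjN.symm ‹_›

/-- The nodes whose bags contain a given vertex form a subtree. The three edges of a triangle make
the three subtrees meet pairwise, hence they have a common node. -/
theorem exists_bag_of_mem_triangles (I : TDGraph) {x : List ℕ} (hx : x ∈ triangles (adjList I.G)) :
    ∃ t < I.bagList.length, ∀ v ∈ x, v ∈ I.bagList.getD t [] := by
  obtain ⟨a, b, c, rfl, -, -, ⟨ha, hb, hab⟩, ⟨hb', hc, hbc⟩, ⟨ha', hc', hac⟩⟩ := mem_triangles.1 hx
  obtain ⟨p, hpa, hpb⟩ := I.edge_mem _ _ hab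
  obtain ⟨q, hqb, hqc⟩ := I.edge_mem _ _ hbc
  obtain ⟨r, hra, hrc⟩ := I.edge_mem _ _ hac
  obtain ⟨t, h1, h2, h3⟩ := exists_mem_three I.isTree (I.connected ⟨a, ha⟩) (I.connected ⟨b, hb⟩)
    (I.connected ⟨c, hc⟩) hpa hpb hqb hqc hra hrc
  refine ⟨t, by rw [length_bagList]; exact t.2, fun v hv => ?_⟩
  rw [mem_bagList]
  simp only [List.mem_cons, List.not_mem_nil, or_false] at hv
  rcases hv with rfl | rfl | rfl
  exacts [⟨t.2, ha, h1⟩, ⟨t.2, hb, h2⟩, ⟨t.2, hc, h3⟩]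

end TuringKernel

open Polynomial

namespace TuringKernel
open Enc (enc)

/-! ### The queries -/

/-- The graph formed by the triangles in `τ`, with a tree decomposition with a single bag. -/
def queryInst (τ : List (List ℕ)) : TDGraph where
  n := (vertices τ).length
  G :=
    { Adj := fun i j => linked τ ((vertices τ).getD i 0) ((vertices τ).getD j 0) = true
      symm := ⟨fun i j h => by
        simp only [linked, Bool.and_eq_true, List.any_eq_true, Bool.not_eq_true',
          beq_eq_false_iff_ne] at h ⊢
        obtain ⟨h, x, hx, h1, h2⟩ := h
        exact ⟨h.symm, x, hx, h2, h1⟩⟩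
      loopless := ⟨fun i h => by simp [linked] at h⟩ }
  m := 1
  T := ⊥
  isTree := ⟨⟨fun u v => Subsingleton.elim u v ▸ SimpleGraph.Reachable.refl _⟩,
    SimpleGraph.isAcyclic_bot⟩
  bag _ := Finset.univ
  vertex_mem _ := ⟨0, Finset.mem_univ _⟩
  edge_mem _ _ _ := ⟨0, Finset.mem_univ _, Finset.mem_univ _⟩
  connected _ :=
    { preconnected := fun u v => Subsingleton.elim u v ▸ SimpleGraph.Reachable.refl _
      nonempty := ⟨⟨(0 : Fin 1), by simp⟩⟩ }

open Classical in
theorem setList_eq {n : ℕ} (s : Set (Fin n)) (p : ℕ → Bool) (h : ∀ v : Fin n, p v.1 = true ↔ v ∈ s) :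
    setList s = (List.range n).filter p := by
  have hr : List.range n = (List.finRange n).map fun v : Fin n => v.val := by
    simp [List.finRange_eq_pmap_range, List.map_pmap]
  rw [hr, List.filter_map, setList]
  congr 1
  refine List.filter_congr fun v _ => ?_
  rw [Bool.eq_iff_iff, decide_eq_true_eq]
  exact (h v).symm

theorem adjList_eq {n : ℕ} (G : SimpleGraph (Fin n)) (p : ℕ → ℕ → Bool)
    (h : ∀ u v : Fin n, p u.1 v.1 = true ↔ G.Adj u v) :
    adjList G = (List.range n).map fun i => (List.range n).filter (p i) := by
  have hr : List.range n = (List.finRange n).map fun v : Fin n => v.val := by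
    simp [List.finRange_eq_pmap_range, List.map_pmap]
  conv_rhs => arg 2; rw [hr]
  rw [List.map_map, adjList]
  refine List.map_congr_left fun v _ => ?_
  exact setList_eq _ _ fun u => h v u

theorem width_queryInst (τ : List (List ℕ)) :
    (queryInst τ).width = (vertices τ).length - 1 := by
  unfold TDGraph.width
  congr 1
  have : (Finset.univ.sup fun t => ((queryInst τ).bag t).card) =
      (Finset.univ : Finset (Fin 1)).sup fun _ => (vertices τ).length := by
    refine Finset.sup_congr rfl fun t _ => ?_
    exact (Finset.card_univ).trans (Fintype.card_fin _)
  rw [this]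
  simp

/-- The oracle only promises good answers on encodings of instances, so the computed data must equal
the encoding of `queryInst τ` exactly. -/
theorem enc_query (τ : List (List ℕ)) : enc (query τ) = ETP.input (queryInst τ) := by
  rw [enc_input, width_queryInst]
  unfold query
  have h1 : adjList (queryInst τ).G = (List.range (vertices τ).length).map fun i =>
      (List.range (vertices τ).length).filter fun j =>
        linked τ ((vertices τ).getD i 0) ((vertices τ).getD j 0) :=
    adjList_eq (queryInst τ).G _ fun u v => Iff.rfl
  have h2 : adjList (queryInst τ).T = [[]] := by
    rw [adjList_eq (queryInst τ).T (fun _ _ => false) fun u v => by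
      simp only [Bool.false_eq_true, false_iff]; exact fun h => h]
    simp only [List.filter_false]
    rfl
  have h3 : (queryInst τ).bagList = [List.range (vertices τ).length] := by
    have : (queryInst τ).bagList = (List.finRange 1).map fun _ =>
        List.range (vertices τ).length := by
      refine List.map_congr_left fun t _ => ?_
      refine (setList_eq ((queryInst τ).bag t : Set (Fin (queryInst τ).n)) (fun _ => true)
        fun v => ⟨fun _ => Finset.mem_coe.2 (Finset.mem_univ v), fun _ => rfl⟩).trans ?_
      rw [List.filter_true]
      rfl
    rw [this]; rfl
  rw [h1, h2, h3]

/-- `ETP.opt` is a supremum in `ℕ`, which is meaningful only for a bounded set. -/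
theorem bddAbove_value (I : TDGraph) : BddAbove (Set.range (ETP.value I)) := by
  refine ⟨Fintype.card (Finset (Fin I.n)), ?_⟩
  rintro _ ⟨S, rfl⟩
  exact Finset.card_le_univ S.1

/-- The original name of a vertex of a query. -/
def name (τ : List (List ℕ)) (i : ℕ) : ℕ := (vertices τ).getD i 0

theorem name_inj {τ : List (List ℕ)} {i j : Fin (vertices τ).length} (h : name τ i = name τ j) :
    i = j := by
  unfold name at h
  rw [List.getD_eq_getElem _ _ i.2, List.getD_eq_getElem _ _ j.2] at h
  exact Fin.ext ((nodup_vertices τ).getElem_inj_iff.1 h)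

theorem exists_name {τ : List (List ℕ)} {x : List ℕ} (hx : x ∈ τ) {v : ℕ} (hv : v ∈ x) :
    ∃ i : Fin (vertices τ).length, name τ i = v := by
  obtain ⟨i, hi, rfl⟩ := List.getElem_of_mem (mem_vertices.2 ⟨x, hx, hv⟩)
  exact ⟨⟨i, hi⟩, List.getD_eq_getElem _ _ hi⟩

theorem linked_iff {τ : List (List ℕ)} {u v : ℕ} :
    linked τ u v = true ↔ u ≠ v ∧ ∃ x ∈ τ, u ∈ x ∧ v ∈ x := by
  simp [linked]

/-- Renaming vertices by their positions turns `P` into a solution of the query. Only this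
inequality is needed: the query graph may have more triangles than `τ`, and a larger optimum does no
harm. -/
theorem Packing.card_le_opt {τ : List (List ℕ)} {P : Finset (List ℕ)} (hP : Packing P)
    (hPτ : ∀ x ∈ P, x ∈ τ) : P.card ≤ ETP.opt (queryInst τ) := by
  classical
  let f : List ℕ → Finset (Fin (queryInst τ).n) := fun x =>
    Finset.univ.filter fun i : Fin (vertices τ).length => name τ i ∈ x
  have hmem : ∀ x (i : Fin (vertices τ).length), i ∈ f x ↔ name τ i ∈ x := fun x i =>
    Finset.mem_filter.trans (and_iff_right (Finset.mem_univ i))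
  have hcard : ∀ x ∈ P, (f x).card = 3 := by
    intro x hx
    rw [← (hP.1 x hx).2, ← List.toFinset_card_of_nodup (hP.1 x hx).1]
    refine Finset.card_bij (fun (i : Fin (vertices τ).length) _ => name τ i) ?_ ?_ ?_
    · intro i hi; rw [List.mem_toFinset]; exact (hmem x i).1 hi
    · intro i _ j _ h; exact name_inj h
    · intro v hv
      rw [List.mem_toFinset] at hv
      obtain ⟨i, rfl⟩ := exists_name (hPτ x hx) hv
      exact ⟨i, (hmem x i).2 hv, rfl⟩
  have hmeet : ∀ x ∈ P, ∀ y ∈ P, ∀ i ∈ f x, ∀ j ∈ f x, i ∈ f y → j ∈ f y → i ≠ j → x = y := by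
    intro x hx y hy i hi j hj hi' hj' hij
    exact hP.eq hx hy (fun h => hij (name_inj h)) ((hmem _ _).1 hi) ((hmem _ _).1 hj)
      ((hmem _ _).1 hi') ((hmem _ _).1 hj')
  have hinj : Set.InjOn f P := by
    intro x hx y hy hxy
    obtain ⟨i, hi, j, hj, hij⟩ := Finset.one_lt_card.1 (by rw [hcard x hx]; omega)
    exact hmeet x hx y hy i hi j hj (hxy ▸ hi) (hxy ▸ hj) hij
  have hS : IsTrianglePacking (queryInst τ).G (P.image f) := by
    constructor
    · intro Y hY
      obtain ⟨x, hx, rfl⟩ := Finset.mem_image.1 hY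
      refine ⟨fun i hi j hj hij => ?_, hcard x hx⟩
      exact linked_iff.2 ⟨fun h => hij (name_inj h), x, hPτ x hx, (hmem _ _).1 hi, (hmem _ _).1 hj⟩
    · intro Y hY Z hZ hne i hi j hj
      obtain ⟨x, hx, rfl⟩ := Finset.mem_image.1 (Finset.mem_coe.1 hY)
      obtain ⟨y, hy, rfl⟩ := Finset.mem_image.1 (Finset.mem_coe.1 hZ)
      by_contra hij
      exact hne (congrArg f (hmeet x hx y hy i hi.1 j hj.1 hi.2 hj.2 hij))
  rw [← Finset.card_image_of_injOn hinj]
  exact le_csSup (bddAbove_value _) ⟨⟨P.image f, hS⟩, rfl⟩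

/-- A triple as a list. -/
def tripleList {n : ℕ} (x : Fin n × Fin n × Fin n) : List ℕ := [x.1.1, x.2.1.1, x.2.2.1]

theorem enc_map_tripleList {n : ℕ} (L : List (Fin n × Fin n × Fin n)) :
    enc (L.map tripleList) = Data.ofList (L.map encTriple) := by
  change Data.ofList (List.map enc _) = _
  rw [List.map_map]; rfl

/-- An answer without repetitions is polynomially large in the number of vertices of the query. This
makes the running time independent of the oracle. -/
theorem esize_triples_le {n : ℕ} {L : List (Fin n × Fin n × Fin n)} (hL : L.Nodup) :
    esize (L.map tripleList) ≤ n ^ 3 * (6 * n + 8) + 1 := by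
  have h1 : L.length ≤ n ^ 3 := by
    refine hL.length_le_card.trans (le_of_eq ?_)
    simp only [Fintype.card_prod, Fintype.card_fin]; ring
  refine (esize_list_le (B := 6 * n + 7) fun a ha => ?_).trans ?_
  · obtain ⟨x, -, rfl⟩ := List.mem_map.1 ha
    have := x.1.2
    have := x.2.1.2
    have := x.2.2.2
    simp only [tripleList, esize_cons, esize_nil, esize_nat]
    omega
  · rw [List.length_map]
    exact Nat.add_le_add_right (Nat.mul_le_mul_right _ h1) _

/-- A triangle all of whose edges are edges of members of `τ`. -/
def Covered (τ : List (List ℕ)) (x : List ℕ) : Prop :=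
  ∃ u v w, x = [u, v, w] ∧ linked τ u v = true ∧ linked τ v w = true ∧ linked τ u w = true

theorem linked_comm (τ : List (List ℕ)) (u v : ℕ) : linked τ u v = linked τ v u := by
  rw [Bool.eq_iff_iff, linked_iff, linked_iff, ne_comm]
  exact and_congr_right fun _ => exists_congr fun _ => and_congr_right fun _ => and_comm

theorem Covered.isTri {τ : List (List ℕ)} {x : List ℕ} (h : Covered τ x) : IsTri x := by
  obtain ⟨u, v, w, rfl, h1, h2, h3⟩ := h
  rw [linked_iff] at h1 h2 h3
  exact ⟨by simp [h1.1, h2.1, h3.1], rfl⟩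

/-- A triangle in an answer need not belong to `τ`: its three edges may come from three different
members. Being covered edge by edge is enough, since pieces are separated with respect to edges. -/
theorem Covered.linked {τ : List (List ℕ)} {x : List ℕ} (h : Covered τ x) {a b : ℕ} (ha : a ∈ x)
    (hb : b ∈ x) (hab : a ≠ b) : linked τ a b = true := by
  obtain ⟨u, v, w, rfl, h1, h2, h3⟩ := h
  simp only [List.mem_cons, List.not_mem_nil, or_false] at ha hb
  rcases ha with rfl | rfl | rfl <;> rcases hb with rfl | rfl | rfl <;>
    first
    | exact absurd rfl hab
    | assumption
    | (rw [linked_comm]; assumption)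

/-- The answer to a query, in the original names. -/
theorem answer_spec {τ : List (List ℕ)} {c : ℝ} {s : Data}
    (h : ETP.IsApproxSolution c (queryInst τ) s) :
    ∃ A : List (List ℕ), s = enc A ∧
      esize A ≤ (vertices τ).length ^ 3 * (6 * (vertices τ).length + 8) + 1 ∧
      (ETP.opt (queryInst τ) : ℝ) ≤ c * A.length ∧
      (∀ x ∈ A.map fun x => x.map (name τ), Covered τ x) ∧
      (A.map fun x => x.map (name τ)).Pairwise fun x y => shares x y = false := by
  classical
  obtain ⟨⟨S, hS⟩, ⟨L, rfl, hnd, hLS⟩, hopt⟩ := h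
  have hval : ETP.value (queryInst τ) ⟨S, hS⟩ = L.length := by
    change S.card = _
    have hLS' : _ = S := hLS
    rw [← hLS', List.toFinset_card_of_nodup hnd, List.length_map]
  have hcov : ∀ x ∈ L, Covered τ ((tripleList x).map (name τ)) := by
    intro x hx
    have hX : ({x.1, x.2.1, x.2.2} : Finset (Fin (queryInst τ).n)) ∈ S := by
      have hLS' : _ = S := hLS
      rw [← hLS', List.mem_toFinset]; exact List.mem_map_of_mem hx
    have hc := hS.1 _ hX
    rw [SimpleGraph.is3Clique_triple_iff] at hc
    exact ⟨_, _, _, rfl, hc.1, hc.2.2, hc.2.1⟩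
  refine ⟨L.map tripleList, (enc_map_tripleList L).symm,
    esize_triples_le (List.Nodup.of_map _ hnd), ?_, ?_, ?_⟩
  · rw [List.length_map, ← hval]; exact hopt
  · intro y hy
    rw [List.map_map] at hy
    obtain ⟨x, hx, rfl⟩ := List.mem_map.1 hy
    exact hcov x hx
  · rw [List.map_map, List.pairwise_map]
    refine (List.pairwise_map.1 hnd).imp_of_mem fun {x y} hx hy hne => ?_
    rw [← Bool.not_eq_true]
    intro hsh
    obtain ⟨u, v, huv, ⟨hux, hvx⟩, huy, hvy⟩ := (shares_iff (hcov x hx).isTri.1).1 hsh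
    have key : ∀ (z : Fin (vertices τ).length × Fin (vertices τ).length × Fin (vertices τ).length) u,
        u ∈ (tripleList z).map (name τ) →
        ∃ i ∈ ({z.1, z.2.1, z.2.2} : Finset (Fin (vertices τ).length)), name τ i = u := by
      intro z u hu
      simp only [tripleList, List.map_cons, List.map_nil, List.mem_cons, List.not_mem_nil,
        or_false] at hu
      rcases hu with rfl | rfl | rfl <;> exact ⟨_, by simp, rfl⟩
    obtain ⟨i, hi, rfl⟩ := key x u hux
    obtain ⟨j, hj, rfl⟩ := key x v hvx
    obtain ⟨i', hi', h1⟩ := key y _ huy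
    obtain ⟨j', hj', h2⟩ := key y _ hvy
    rw [name_inj h1] at hi'
    rw [name_inj h2] at hj'
    have hmem : ∀ z ∈ L, ({z.1, z.2.1, z.2.2} : Finset (Fin (queryInst τ).n)) ∈ S := by
      intro z hz
      have hLS' : _ = S := hLS
      rw [← hLS', List.mem_toFinset]; exact List.mem_map_of_mem hz
    have := hS.2 (Finset.mem_coe.2 (hmem x hx)) (Finset.mem_coe.2 (hmem y hy)) hne
      (Set.mem_inter (Finset.mem_coe.2 hi) (Finset.mem_coe.2 hi'))
      (Set.mem_inter (Finset.mem_coe.2 hj) (Finset.mem_coe.2 hj'))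
    exact huv (by rw [this])

/-! ### Solutions of the given instance -/

/-- A list of pairwise edge-disjoint triangles is a solution. -/
theorem exists_sol_of_list (I : TDGraph) (A : List (List ℕ))
    (hA : ∀ x ∈ A, ∃ u v w, x = [u, v, w] ∧ AdjN I.G u v ∧ AdjN I.G v w ∧ AdjN I.G u w)
    (hp : A.Pairwise fun x y => shares x y = false) :
    ∃ S : ETP.Sol I, ETP.Repr I (enc A) S ∧ ETP.value I S = A.length := by
  classical
  let tri : Fin I.n × Fin I.n × Fin I.n → Finset (Fin I.n) := fun x => {x.1, x.2.1, x.2.2}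
  obtain ⟨L, rfl, hL⟩ : ∃ L : List (Fin I.n × Fin I.n × Fin I.n), A = L.map tripleList ∧
      ∀ x ∈ L, I.G.Adj x.1 x.2.1 ∧ I.G.Adj x.2.1 x.2.2 ∧ I.G.Adj x.1 x.2.2 := by
    clear hp
    induction A with
    | nil => exact ⟨[], rfl, by simp⟩
    | cons x A ih =>
      obtain ⟨L, rfl, hL⟩ := ih fun y hy => hA y (List.mem_cons_of_mem _ hy)
      obtain ⟨u, v, w, rfl, ⟨hu, hv, h1⟩, ⟨_, hw, h2⟩, ⟨_, _, h3⟩⟩ := hA x List.mem_cons_self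
      refine ⟨(⟨u, hu⟩, ⟨v, hv⟩, ⟨w, hw⟩) :: L, rfl, ?_⟩
      intro y hy
      rcases List.mem_cons.1 hy with rfl | hy
      exacts [⟨h1, h2, h3⟩, hL y hy]
  have hclique : ∀ x ∈ L, I.G.IsNClique 3 (tri x) := by
    intro x hx
    rw [SimpleGraph.is3Clique_triple_iff]
    exact ⟨(hL x hx).1, (hL x hx).2.2, (hL x hx).2.1⟩
  have htri : ∀ x ∈ L, IsTri (tripleList x) := by
    intro x hx
    obtain ⟨h1, h2, h3⟩ := hL x hx
    refine ⟨?_, rfl⟩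
    simp [tripleList, Fin.val_inj, h1.ne, h2.ne, h3.ne]
  have hmem : ∀ (x : Fin I.n × Fin I.n × Fin I.n) i, i ∈ tri x → i.1 ∈ tripleList x := by
    intro x i hi
    simp only [tri, Finset.mem_insert, Finset.mem_singleton] at hi
    rcases hi with rfl | rfl | rfl <;> simp [tripleList]
  have hmeet : ∀ x ∈ L, ∀ y ∈ L, shares (tripleList x) (tripleList y) = false →
      ((tri x : Set (Fin I.n)) ∩ tri y).Subsingleton := by
    intro x hx y hy hs i hi j hj
    by_contra hij
    have := (shares_iff (htri x hx).1).2 ⟨i.1, j.1, fun h => hij (Fin.ext h),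
      ⟨hmem x i hi.1, hmem x j hj.1⟩, hmem y i hi.2, hmem y j hj.2⟩
    rw [hs] at this
    cases this
  have hpw : (L.map tri).Pairwise fun X Y : Finset (Fin I.n) =>
      X ≠ Y ∧ ((X : Set (Fin I.n)) ∩ (Y : Set (Fin I.n))).Subsingleton := by
    rw [List.pairwise_map] at hp ⊢
    refine hp.imp_of_mem fun {x y} hx hy hs => ?_
    have hsub := hmeet x hx y hy hs
    refine ⟨fun he => ?_, hsub⟩
    rw [← he, Set.inter_self] at hsub
    have := (hclique x hx).2
    have h1 : (tri x).card ≤ 1 := Finset.card_le_one.2 fun a ha b hb => hsub ha hb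
    omega
  have hnd : (L.map tri).Nodup := hpw.imp fun h => h.1
  refine ⟨⟨(L.map tri).toFinset, ⟨?_, ?_⟩⟩, ⟨L, enc_map_tripleList L, hnd, rfl⟩, ?_⟩
  · intro X hX
    obtain ⟨x, hx, rfl⟩ := List.mem_map.1 (List.mem_toFinset.1 hX)
    exact hclique x hx
  · intro X hX Y hY hne
    have hX' := List.mem_toFinset.1 (Finset.mem_coe.1 hX)
    have hY' := List.mem_toFinset.1 (Finset.mem_coe.1 hY)
    refine List.Pairwise.forall_of_forall_of_flip
      (R := fun X Y : Finset (Fin I.n) => X ≠ Y →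
        ((X : Set (Fin I.n)) ∩ (Y : Set (Fin I.n))).Subsingleton) ?_ ?_ ?_ hX' hY' hne
    · exact fun X _ h => absurd rfl h
    · exact hpw.imp fun h _ => h.2
    · exact hpw.imp fun h _ => by rw [Set.inter_comm]; exact h.2
  · change (L.map tri).toFinset.card = _
    rw [List.toFinset_card_of_nodup hnd, List.length_map, List.length_map]

theorem setList_mem_triangles (I : TDGraph) {Y : Finset (Fin I.n)} (hY : I.G.IsNClique 3 Y) :
    setList (Y : Set (Fin I.n)) ∈ triangles (adjList I.G) := by
  have hlen : (setList (Y : Set (Fin I.n))).length = 3 := by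
    rw [← List.toFinset_card_of_nodup (nodup_setList _), ← hY.2,
      ← Finset.card_map Fin.valEmbedding]
    congr 1
    ext i
    rw [List.mem_toFinset, mem_setList, Finset.mem_map]
    constructor
    · rintro ⟨hi, h⟩; exact ⟨_, h, rfl⟩
    · rintro ⟨a, ha, rfl⟩; exact ⟨a.2, ha⟩
  have hsorted : (setList (Y : Set (Fin I.n))).Pairwise (· < ·) := by
    rw [setList, List.pairwise_map]
    exact (List.pairwise_lt_finRange I.n).filter _
  have hadj : ∀ u ∈ setList (Y : Set (Fin I.n)), ∀ v ∈ setList (Y : Set (Fin I.n)), u ≠ v →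
      AdjN I.G u v := by
    intro u hu v hv huv
    obtain ⟨hu, hu'⟩ := mem_setList.1 hu
    obtain ⟨hv, hv'⟩ := mem_setList.1 hv
    exact ⟨hu, hv, hY.1 hu' hv' fun h => huv (congrArg Fin.val h)⟩
  obtain ⟨a, b, c, he⟩ := List.length_eq_three.1 hlen
  rw [he] at hsorted hadj ⊢
  simp only [List.pairwise_cons, List.mem_cons, List.not_mem_nil, or_false, forall_eq_or_imp,
    forall_eq] at hsorted
  obtain ⟨⟨hab, hac⟩, hbc, -⟩ := hsorted
  exact mem_triangles.2 ⟨a, b, c, rfl, hab, hbc, hadj a (by simp) b (by simp) hab.ne,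
    hadj b (by simp) c (by simp) hbc.ne, hadj a (by simp) c (by simp) hac.ne⟩

/-- The empty family is a solution and values are bounded, so the optimum is attained; its triangles
are then written as increasing lists. -/
theorem exists_packing_of_opt (I : TDGraph) :
    ∃ P, Packing P ∧ (∀ x ∈ P, x ∈ triangles (adjList I.G)) ∧ P.card = ETP.opt I := by
  classical
  have hne : (Set.range (ETP.value I)).Nonempty :=
    ⟨_, ⟨⟨∅, by simp [IsTrianglePacking]⟩, rfl⟩⟩
  obtain ⟨⟨S, hS⟩, hval⟩ := Nat.sSup_mem hne (bddAbove_value I)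
  let f : Finset (Fin I.n) → List ℕ := fun Y => setList (Y : Set (Fin I.n))
  have hmem : ∀ Y (i : Fin I.n), i.1 ∈ f Y ↔ i ∈ Y := by
    intro Y i
    rw [mem_setList]
    exact ⟨fun ⟨_, h⟩ => h, fun h => ⟨i.2, h⟩⟩
  have hinj : Function.Injective f := by
    intro Y Z h
    ext i
    rw [← hmem, ← hmem, h]
  refine ⟨S.image f, ⟨?_, ?_⟩, ?_, ?_⟩
  · intro x hx
    obtain ⟨Y, hY, rfl⟩ := Finset.mem_image.1 hx
    exact isTri_of_mem_triangles (setList_mem_triangles I (hS.1 Y hY))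
  · intro x hx y hy hxy
    obtain ⟨Y, hY, rfl⟩ := Finset.mem_image.1 hx
    obtain ⟨Z, hZ, rfl⟩ := Finset.mem_image.1 hy
    rw [← Bool.not_eq_true, shares_iff (nodup_setList _)]
    rintro ⟨u, v, huv, ⟨h1, h2⟩, h3, h4⟩
    obtain ⟨hu, h1⟩ := mem_setList.1 h1
    obtain ⟨hv, h2⟩ := mem_setList.1 h2
    obtain ⟨_, h3⟩ := mem_setList.1 h3
    obtain ⟨_, h4⟩ := mem_setList.1 h4
    have := hS.2 hY hZ (fun h => hxy (congrArg f h)) ⟨h1, h3⟩ ⟨h2, h4⟩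
    exact huv (congrArg Fin.val this)
  · intro x hx
    obtain ⟨Y, hY, rfl⟩ := Finset.mem_image.1 hx
    exact setList_mem_triangles I (hS.1 Y hY)
  · rw [Finset.card_image_of_injective _ hinj]
    exact hval

end TuringKernel

open Polynomial

namespace TuringKernel
open Enc (enc)

/-! ### Asking the oracle -/

/-- Replace the second components of the members of a list by the answers of the oracle, and
reverse the list. -/
def askAll : Prog :=
  .comp .snd (.comp
    (.loop .fst (.pair (.comp .snd .fst)
      (.pair (.pair (.comp .fst (.comp .fst .fst)) (.comp .ask (.comp .snd (.comp .fst .fst))))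
        .snd)))
    (.pair .id .nil))

/-- `S` bounds the size of the request list, hence also the number of queries and the size of each
name list; `B` bounds the answers. Answers are put in front of those obtained before, so the result
is reversed. -/
theorem runIn_askAll {ι α β δ : Type} [Enc α] [Enc β] [Enc δ] {O : Data → Data}
    {Q : Data → Prop} (l : List ι) (f : ι → α) (g : ι → β) (ans : ι → δ) (B S : ℕ)
    (hS : esize (l.map fun y => (f y, g y)) ≤ S) (hans : ∀ y ∈ l, O (enc (g y)) = enc (ans y))
    (hB : ∀ y ∈ l, esize (ans y) ≤ B) (hQ : ∀ y ∈ l, Q (enc (g y))) :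
    RunIn O askAll (enc (l.map fun y => (f y, g y))) (enc (l.map fun y => (f y, ans y)).reverse)
      ((S + 2) * (30 * (S + S * (S + B + 2) + 2) + 41)) Q := by
  have hlen : l.length ≤ S := by
    have := length_le_esize (l.map fun y => (f y, g y))
    rw [List.length_map] at this; omega
  set done : ℕ → List (α × δ) := fun i => ((l.take i).map fun y => (f y, ans y)).reverse
  set Z := S + S * (S + B + 2) + 2 with hZ
  let st : ℕ → Data := fun i => Data.cons (enc ((l.drop i).map fun y => (f y, g y))) (enc (done i))
  have hsz : ∀ i, (st i).size ≤ Z := by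
    intro i
    have h1 : esize ((l.drop i).map fun y => (f y, g y)) ≤ S :=
      (esize_le_of_sublist ((List.drop_sublist _ _).map _)).trans hS
    have h2 : esize (done i) ≤ S * (S + B + 2) + 1 := by
      refine (esize_list_le (B := S + B + 1) fun a ha => ?_).trans ?_
      · obtain ⟨y, hy, rfl⟩ := List.mem_map.1 (List.mem_reverse.1 ha)
        have hy := List.mem_of_mem_take hy
        have k1 := esize_le_of_mem (List.mem_map_of_mem (f := fun y => (f y, g y)) hy)
        have k2 := hB y hy
        simp only [esize_pair] at k1 ⊢
        omega
      · refine Nat.add_le_add_right (Nat.mul_le_mul_right _ ?_) _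
        simp only [done, List.length_reverse, List.length_map, List.length_take]
        omega
    simp only [st, Data.size]
    simp only [esize] at h1 h2
    omega
  have hloop := RunIn.loop (O := O) (B := .fst) (P := .pair (.comp .snd .fst)
      (.pair (.pair (.comp .fst (.comp .fst .fst)) (.comp .ask (.comp .snd (.comp .fst .fst))))
        .snd)) (T := 14 * Z + 20) (Q := Q) st l.length (by
    intro i hi
    have hd : l.drop i = l[i] :: l.drop (i + 1) := List.drop_eq_getElem_cons hi
    have hmem : l[i] ∈ l := List.getElem_mem hi
    have hst : st i = Data.cons (Data.cons (Data.cons (enc (f l[i])) (enc (g l[i])))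
        (enc ((l.drop (i + 1)).map fun y => (f y, g y)))) (enc (done i)) := by
      simp only [st, hd, List.map_cons, enc_cons, enc_pair]
    have hst' : st (i + 1) = Data.cons (enc ((l.drop (i + 1)).map fun y => (f y, g y)))
        (Data.cons (Data.cons (enc (f l[i])) (O (enc (g l[i])))) (enc (done i))) := by
      rw [hans _ hmem]
      simp only [st, done]
      rw [List.take_succ_eq_append_getElem hi, List.map_append, List.reverse_append]
      rfl
    have hx := hsz i
    refine ⟨(st i).fst, by rw [hst]; simp [Data.fst], RunIn.fst.le (by omega), ?_⟩
    rw [hst']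
    rw [hst] at hx ⊢
    have h1 := RunIn.fst (O := O) (Q := Q) (x := Data.cons (Data.cons (Data.cons (enc (f l[i]))
      (enc (g l[i]))) (enc ((l.drop (i + 1)).map fun y => (f y, g y)))) (enc (done i)))
    have h2 := h1.comp (RunIn.fst (O := O) (Q := Q))
    have h3 := h1.comp (RunIn.snd (O := O) (Q := Q))
    have h4 := h2.comp (RunIn.fst (O := O) (Q := Q))
    have h5 := (h2.comp (RunIn.snd (O := O) (Q := Q))).comp (RunIn.ask (hQ _ hmem))
    have h6 := h3.pair ((h4.pair h5).pair (RunIn.snd (O := O) (Q := Q)))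
    refine h6.le ?_
    simp only [Data.size, Data.fst] at hx ⊢
    omega) (by
    have : Data.nil = (st l.length).fst := by simp [st, Data.fst, enc_nil]
    rw [this]
    exact RunIn.fst.le ((hsz _).trans (by omega))) ((hsz _).trans (by omega))
  have hinit : RunIn O (.pair .id .nil) (enc (l.map fun y => (f y, g y))) (st 0)
      (S + 1 + 1) Q :=
    (RunIn.id.le hS).pair RunIn.nil
  have hfin : RunIn O .snd (st l.length) (enc (l.map fun y => (f y, ans y)).reverse) Z Q := by
    have : enc (l.map fun y => (f y, ans y)).reverse = (st l.length).snd := by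
      simp only [st, done, Data.snd, List.take_length]
    rw [this]
    exact RunIn.snd.le (hsz _)
  refine ((hinit.comp hloop).comp hfin).le ?_
  have h1 : S + 2 ≤ Z := by omega
  rw [add_mul]
  have h2 : l.length * (2 * (14 * Z + 20) + 1) ≤ S * (30 * Z + 41) :=
    Nat.mul_le_mul hlen (by omega)
  omega

/-! ### The whole program -/

theorem esize_input (I : TDGraph) :
    esize ((adjList I.G, adjList I.T, I.bagList), I.width) ≤
      2 * ((ETP.enc I).size + ETP.param I) + 2 := by
  have h : esize ((adjList I.G, adjList I.T, I.bagList), I.width) = (ETP.input I).size := by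
    rw [enc_input]; rfl
  have h2 : (ETP.input I).size = 1 + (ETP.enc I).size + (Data.ofNat (ETP.param I)).size := rfl
  have h3 : (Data.ofNat (ETP.param I)).size = 2 * ETP.param I + 1 := esize_nat _
  omega

/-- The union of the answers is a solution of size at least `c⁻¹` times the total optimum. -/
theorem collect_spec (I : TDGraph) {c : ℝ} (Ps : List (List (List ℕ)))
    (hΔ : ∀ τ ∈ Ps, ∀ x ∈ τ, x ∈ triangles (adjList I.G)) (hap : Ps.Pairwise Apart)
    (ans : List (List ℕ) → List (List ℕ))
    (hopt : ∀ τ ∈ Ps, (ETP.opt (queryInst (kernel τ)) : ℝ) ≤ c * (ans τ).length)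
    (hcov : ∀ τ ∈ Ps, ∀ x ∈ (ans τ).map fun x => x.map (name (kernel τ)), Covered (kernel τ) x)
    (hpw : ∀ τ ∈ Ps, ((ans τ).map fun x => x.map (name (kernel τ))).Pairwise
      fun x y => shares x y = false) :
    ∃ S : ETP.Sol I, ETP.Repr I (enc (collect (Ps.map fun τ => (vertices (kernel τ), ans τ)))) S ∧
      (((Ps.map fun τ => ETP.opt (queryInst (kernel τ))).sum : ℕ) : ℝ) ≤
        c * (ETP.value I S : ℝ) := by
  have hcol : collect (Ps.map fun τ => (vertices (kernel τ), ans τ)) =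
      Ps.flatMap fun τ => (ans τ).map fun x => x.map (name (kernel τ)) := by
    rw [collect, List.flatMap_map]; rfl
  have hedge : ∀ τ ∈ Ps, ∀ u v, linked (kernel τ) u v = true → AdjN I.G u v := by
    intro τ hτ u v h
    obtain ⟨huv, x, hx, hu, hv⟩ := linked_iff.1 h
    exact adjN_of_mem_triangles (hΔ τ hτ x (mem_of_mem_kernel hx)) hu hv huv
  obtain ⟨S, hS, hval⟩ := exists_sol_of_list I
    (Ps.flatMap fun τ => (ans τ).map fun x => x.map (name (kernel τ)))
    (by
      intro x hx
      obtain ⟨τ, hτ, hx⟩ := List.mem_flatMap.1 hx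
      obtain ⟨u, v, w, rfl, h1, h2, h3⟩ := hcov τ hτ x hx
      exact ⟨u, v, w, rfl, hedge τ hτ _ _ h1, hedge τ hτ _ _ h2, hedge τ hτ _ _ h3⟩)
    (by
      rw [List.pairwise_flatMap]
      -- A pair of vertices common to answers for two pieces would be an edge of a triangle in each
      -- of the pieces, which are edge-disjoint.
      refine ⟨hpw, hap.imp_of_mem fun {σ τ} hσ hτ h x hx y hy => ?_⟩
      have hcx := hcov σ hσ x hx
      have hcy := hcov τ hτ y hy
      rw [← Bool.not_eq_true, shares_iff hcx.isTri.1]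
      rintro ⟨u, v, huv, ⟨h1, h2⟩, h3, h4⟩
      obtain ⟨-, z, hz, hzu, hzv⟩ := linked_iff.1 (hcx.linked h1 h2 huv)
      obtain ⟨-, z', hz', hzu', hzv'⟩ := linked_iff.1 (hcy.linked h3 h4 huv)
      have hs := h z (mem_of_mem_kernel hz) z' (mem_of_mem_kernel hz')
      have := (shares_iff (isTri_of_mem_triangles
        (hΔ σ hσ z (mem_of_mem_kernel hz))).1).2 ⟨u, v, huv, ⟨hzu, hzv⟩, hzu', hzv'⟩
      rw [hs] at this
      cases this)
  refine ⟨S, hcol ▸ hS, ?_⟩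
  rw [hval]
  clear hcol hS hval S hedge hap hΔ hcov hpw
  induction Ps with
  | nil => simp
  | cons τ Ps ih =>
    have h1 := ih fun σ hσ => hopt σ (List.mem_cons_of_mem _ hσ)
    have h2 := hopt τ List.mem_cons_self
    simp only [List.map_cons, List.sum_cons, List.flatMap_cons, List.length_append, List.length_map]
    rw [Nat.cast_add, Nat.cast_add, mul_add]
    exact add_le_add h2 h1

/-- A triangle needs a bag with three vertices. In width 0 the size bound is 0, which no query
satisfies as it has one tree node; so none is made, and the empty solution is optimal. -/
theorem triangles_eq_nil {I : TDGraph} (h : I.width = 0) : triangles (adjList I.G) = [] := by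
  rw [List.eq_nil_iff_forall_not_mem]
  intro x hx
  obtain ⟨t, -, ht⟩ := exists_bag_of_mem_triangles I hx
  obtain ⟨hnd, hlen⟩ := isTri_of_mem_triangles hx
  have h1 := card_bagList_le I t
  have h2 : x.toFinset ⊆ (I.bagList.getD t []).toFinset := by
    intro v hv
    exact List.mem_toFinset.2 (ht v (List.mem_toFinset.1 hv))
  have h3 := Finset.card_le_card h2
  rw [List.toFinset_card_of_nodup hnd, hlen] at h3
  omega

/-- The pieces into which the instance is split. -/
noncomputable def parts (N : ℕ) (I : TDGraph) : List (List (List ℕ)) :=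
  bif I.width == 0 then [] else
    pieces (adjList I.G) (adjList I.T) I.bagList (4 * N * (I.width * I.width))

theorem queries_eq (N : ℕ) (I : TDGraph) :
    queries (4 * N) ((adjList I.G, adjList I.T, I.bagList), I.width) =
      (parts N I).map fun τ => (vertices (kernel τ), query (kernel τ)) := by
  unfold queries parts
  cases h : I.width == 0 <;> simp

theorem parts_spec {N : ℕ} (hN : 1 ≤ N) (I : TDGraph) :
    (∀ τ ∈ parts N I, (∀ x ∈ τ, x ∈ triangles (adjList I.G)) ∧
      (vertices (kernel τ)).length ≤ 864 * N * (I.width * I.width) ∧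
      1 ≤ 864 * N * (I.width * I.width)) ∧
    (parts N I).Pairwise Apart ∧
    N * ETP.opt I ≤ (N + 1) * ((parts N I).map fun τ => ETP.opt (queryInst (kernel τ))).sum := by
  obtain ⟨P, hP, hPΔ, hcard⟩ := exists_packing_of_opt I
  rw [← hcard]
  by_cases h0 : I.width = 0
  · have hp : parts N I = [] := by simp [parts, h0]
    have : P = ∅ := by
      rw [triangles_eq_nil h0] at hPΔ
      exact Finset.eq_empty_iff_forall_notMem.2 fun x hx => by simpa using hPΔ x hx
    rw [hp, this]
    simp
  · have hp : parts N I =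
        pieces (adjList I.G) (adjList I.T) I.bagList (4 * N * (I.width * I.width)) := by
      rw [parts, beq_false_of_ne h0, cond_false]
    have hl : 1 ≤ I.width * I.width := Nat.mul_pos (by omega) (by omega)
    have hΔ : ∀ x ∈ triangles (adjList I.G), IsTri x := fun x hx => isTri_of_mem_triangles hx
    obtain ⟨h1, h2, h3⟩ := pieces_spec (N := N) (K := 4 * N * (I.width * I.width))
      (w := 4 * (I.width * I.width)) I.decomp (fun t u => mem_adjList)
      (nodup_adjList I.T) hΔ (fun x hx => exists_bag_of_mem_triangles I hx)
      (fun t => by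
        have := card_bagList_le I t
        -- Here `1 ≤ ℓ` is used: `(ℓ + 1)² ≤ (2ℓ)²`, which is where `w = 4ℓ²` comes from.
        have h2 : (I.bagList.getD t []).toFinset.card ≤ 2 * I.width := by omega
        calc _ ≤ (2 * I.width) ^ 2 := Nat.pow_le_pow_left h2 2
          _ = 4 * (I.width * I.width) := by ring)
      (le_of_eq (by ring)) hN
    rw [hp]
    refine ⟨fun τ hτ => ⟨(h1 τ hτ).1, ?_, ?_⟩, h2, ?_⟩
    · have k1 := length_vertices_kernel fun x hx => hΔ x ((h1 τ hτ).1 x hx)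
      have k2 := (h1 τ hτ).2
      -- 12 vertices for each greedy triangle, at most `18 * K` greedy triangles, `K = 4 * N * ℓ²`.
      calc _ ≤ 12 * (18 * (4 * N * (I.width * I.width))) := by omega
        _ = _ := by ring
    · exact Nat.mul_pos (Nat.mul_pos (by norm_num) hN) hl
    · refine h3 _ (fun τ hτ Q hQ hQτ => ?_) P hP hPΔ
      obtain ⟨Q', h4, h5, h6⟩ := exists_packing_kernel
        (fun x hx => hΔ x ((h1 τ hτ).1 x hx)) hQ hQτ
      rw [← h6]
      exact h4.card_le_opt h5

/-- The program computes all queries, asks them, and collects the answers. The vertex lists needed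
to restore the original names travel along with the queries. -/
theorem hasApproxTuringKernel {N : ℕ} (hN : 1 ≤ N) {ε : ℝ} (hε : 0 < ε) (hNε : 1 ≤ ε * N) :
    ETP.HasApproxTuringKernel (1 + ε) fun ℓ => 864 * N * (ℓ * ℓ) := by
  obtain ⟨P₁, p₁, h₁⟩ := PTF.queries (4 * N)
  obtain ⟨P₂, p₂, h₂⟩ : PTF fun L : List (List ℕ × List (List ℕ)) => collect L.reverse := by
    fun_prop
  -- The vertex lists are part of the output of `P₁`, so `p₁` bounds the number of vertices of each
  -- query; `b` then bounds each answer and `Z` the list of all of them.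
  let b : ℕ[X] := p₁ ^ 3 * (6 * p₁ + 8) + 1
  let Z : ℕ[X] := p₁ + p₁ * (p₁ + b + 2) + 2
  let p₃ : ℕ[X] := (p₁ + 2) * (30 * Z + 41)
  -- The substitution `2 * X + 2` accounts for the parameter, which is written in unary next to the
  -- encoded instance.
  refine ⟨by linarith, ?_, .comp P₂ (.comp askAll P₁), (p₁ + p₃ + p₂.comp Z + 2).comp (2 * X + 2),
    fun c _ O hO (I : TDGraph) => ?_⟩
  · exact (Primrec.nat_mul.comp (Primrec.const _)
      (Primrec.nat_mul.comp Primrec.id Primrec.id)).to_comp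
  obtain ⟨hp₁, hp₂, hp₃⟩ := parts_spec hN I
  have hans : ∀ τ, ∃ A : List (List ℕ), O (enc (query (kernel τ))) = enc A ∧
      esize A ≤ (vertices (kernel τ)).length ^ 3 * (6 * (vertices (kernel τ)).length + 8) + 1 ∧
      (ETP.opt (queryInst (kernel τ)) : ℝ) ≤ c * A.length ∧
      (∀ x ∈ A.map fun x => x.map (name (kernel τ)), Covered (kernel τ) x) ∧
      (A.map fun x => x.map (name (kernel τ))).Pairwise fun x y => shares x y = false := by
    intro τ
    rw [enc_query]
    exact answer_spec (hO (queryInst (kernel τ)))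
  choose ans ha₁ ha₂ ha₃ ha₄ ha₅ using hans
  obtain ⟨S, hS₁, hS₂⟩ := collect_spec I (parts N I) (fun τ hτ => (hp₁ τ hτ).1) hp₂ ans
    (fun τ _ => ha₃ τ) (fun τ _ => ha₄ τ) (fun τ _ => ha₅ τ)
  set x := ((adjList I.G, adjList I.T, I.bagList), I.width) with hx
  obtain ⟨n, hn⟩ : ∃ n, n = esize x := ⟨_, rfl⟩
  let Q : Data → Prop := fun q => ∃ J : ETP.Inst, q = ETP.input J ∧
    ETP.measure J ≤ 864 * N * (I.width * I.width) ∧ ETP.param J ≤ 864 * N * (I.width * I.width)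
  -- the queries, together with the pieces
  have hrun₁ : RunIn O P₁ (enc x) (enc ((parts N I).map fun τ =>
      (vertices (kernel τ), query (kernel τ)))) (p₁.eval n) Q := by
    have := h₁ O x
    rw [← hn, hx, queries_eq] at this
    exact this.mono le_rfl fun _ h => h.elim
  have hsize₁ : esize ((parts N I).map fun τ => (vertices (kernel τ), query (kernel τ))) ≤
      p₁.eval n := by
    have := (h₁ O x).size_le
    rw [← hn, hx, queries_eq] at this
    exact this
  have hv : ∀ τ ∈ parts N I, esize (vertices (kernel τ)) ≤ p₁.eval n := by
    intro τ hτ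
    have k := esize_le_of_mem (List.mem_map_of_mem
      (f := fun τ => (vertices (kernel τ), query (kernel τ))) hτ)
    simp only [esize_pair] at k
    omega
  have hb : ∀ τ ∈ parts N I, esize (ans τ) ≤ b.eval n := by
    intro τ hτ
    refine (ha₂ τ).trans ?_
    have k : (vertices (kernel τ)).length ≤ p₁.eval n := by
      have := length_le_esize (vertices (kernel τ))
      have := hv τ hτ
      omega
    simp only [b, eval_add, eval_mul, eval_pow, eval_one, eval_ofNat]
    gcongr
  have hrun₂ := runIn_askAll (O := O) (Q := Q) (parts N I) (fun τ => vertices (kernel τ))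
    (fun τ => query (kernel τ)) ans (b.eval n) _ hsize₁ (fun τ _ => ha₁ τ) hb (by
      intro τ hτ
      obtain ⟨-, k1, k2⟩ := hp₁ τ hτ
      refine ⟨queryInst (kernel τ), enc_query _, max_le k1 k2, ?_⟩
      change (queryInst (kernel τ)).width ≤ _
      rw [width_queryInst]
      exact (Nat.sub_le _ _).trans k1)
  have hrun₃ := (h₂ O ((parts N I).map fun τ => (vertices (kernel τ), ans τ)).reverse).mono
    (Q' := Q) le_rfl fun _ h => h.elim
  simp only [List.reverse_reverse] at hrun₃
  have hsize₂ : esize ((parts N I).map fun τ => (vertices (kernel τ), ans τ)).reverse ≤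
      Z.eval n := by
    have hlen : (parts N I).length ≤ p₁.eval n := by
      have := length_le_esize ((parts N I).map fun τ => (vertices (kernel τ), query (kernel τ)))
      rw [List.length_map] at this
      omega
    refine (esize_list_le (B := p₁.eval n + b.eval n + 1) fun a ha => ?_).trans ?_
    · obtain ⟨τ, hτ, rfl⟩ := List.mem_map.1 (List.mem_reverse.1 ha)
      have k1 := hv τ hτ
      have k2 := hb τ hτ
      simp only [esize_pair]
      omega
    · rw [List.length_reverse, List.length_map]
      have := Nat.mul_le_mul_right (p₁.eval n + b.eval n + 2) hlen
      simp only [Z, eval_add, eval_mul, eval_ofNat]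
      change _ * (p₁.eval n + b.eval n + 2) + 1 ≤ _
      omega
  have hrun := ((hrun₁.comp hrun₂).comp (hrun₃.le (eval_mono p₂ hsize₂)))
  obtain ⟨t, qs, hr, ht, hq⟩ := hrun
  refine ⟨_, t, qs, by rw [enc_input]; exact hr, ?_, ⟨S, hS₁, ?_⟩, hq⟩
  · have k1 := (le_of_eq hn).trans (esize_input I)
    refine ht.trans (le_trans ?_ ((eval_mono (p₁ + p₃ + p₂.comp Z + 2) k1).trans ?_))
    · simp only [p₃, Z, eval_add, eval_mul, eval_comp, eval_ofNat]
      omega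
    · simp only [eval_comp, eval_add, eval_mul, eval_X, eval_ofNat, le_refl]
  · have k1 : (N : ℝ) * ETP.opt I ≤ (N + 1) *
        ((((parts N I).map fun τ => ETP.opt (queryInst (kernel τ))).sum : ℕ) : ℝ) := by
      exact_mod_cast hp₃
    have hs : (0 : ℝ) ≤ ((((parts N I).map fun τ => ETP.opt (queryInst (kernel τ))).sum : ℕ) : ℝ) :=
      Nat.cast_nonneg _
    generalize ((((parts N I).map fun τ => ETP.opt (queryInst (kernel τ))).sum : ℕ) : ℝ) = s
      at k1 hS₂ hs
    generalize (ETP.opt I : ℝ) = o at k1 ⊢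
    generalize (ETP.value I S : ℝ) = v at hS₂ ⊢
    have hN' : (1 : ℝ) ≤ N := by exact_mod_cast hN
    have k2 : (N : ℝ) * o ≤ N * ((1 + ε) * s) := by
      have := mul_le_mul_of_nonneg_right hNε hs
      linarith
    have k3 := le_of_mul_le_mul_left k2 (by linarith)
    have k4 := mul_le_mul_of_nonneg_left hS₂ (show (0 : ℝ) ≤ 1 + ε by linarith)
    linarith

end TuringKernel


theorem mainTheorem4 :
    ∃ C : ℝ, 0 < C ∧ ∀ ε : ℝ, 0 < ε → ε ≤ 1 →
      ∃ f : ℕ → ℕ, (∀ ℓ : ℕ, (f ℓ : ℝ) ≤ C * (ℓ : ℝ) ^ 2 / ε) ∧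
        TuringKernel.ETP.HasApproxTuringKernel (1 + ε) f := by
  -- `1728 = 2 * 864`, where `⌈1 / ε⌉₊ ≤ 2 / ε` because `ε ≤ 1`. The real number `ε` enters the
  -- program and `f` only through this natural number, so `f` is computable for every `ε`.
  refine ⟨1728, by norm_num, fun ε hε hε' => ⟨fun ℓ => 864 * ⌈1 / ε⌉₊ * (ℓ * ℓ), fun ℓ => ?_, ?_⟩⟩
  · have h1 : (⌈1 / ε⌉₊ : ℝ) ≤ 2 / ε := by
      have h2 := (Nat.ceil_lt_add_one (show 0 ≤ 1 / ε by positivity)).le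
      have h3 : 1 ≤ 1 / ε := (one_le_div hε).2 hε'
      calc _ ≤ 1 / ε + 1 := h2
        _ ≤ 1 / ε + 1 / ε := by linarith
        _ = 2 / ε := by ring
    push_cast
    calc 864 * (⌈1 / ε⌉₊ : ℝ) * (ℓ * ℓ) ≤ 864 * (2 / ε) * (ℓ * ℓ) := by gcongr
      _ = 1728 * (ℓ : ℝ) ^ 2 / ε := by ring
  · refine TuringKernel.hasApproxTuringKernel (Nat.ceil_pos.2 (by positivity)) hε ?_
    calc 1 = ε * (1 / ε) := by field_simp
      _ ≤ ε * ⌈1 / ε⌉₊ := by gcongr; exact Nat.le_ceil _
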